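/- **Notation.** $\mathrm W[f_1,\dots,f_m](x)=\det\bigl(f_k^{(j-1)}(x)\bigr)_{1\le j,k\le m}$ is the Wronskian ($\mathrm W[\,]=1$). A *system* consists of an open interval $(x_1,x_2)$, parameters $\lambda$ with a shift $\delta$, a smooth potential $U(x;\lambda)$, energies $\mathcal E(n;\lambda)$ ($n\in\mathbb Z$), eigenfunctions $\phi_n(x;\lambda)$ and pseudo virtual state wavefunctions $\tilde\phi_{\rm v}(x;\lambda)$ ($n,{\rm v}\in\mathbb Z_{\ge0}$) of $-\frac{d^2}{dx^2}+U(x;\lambda)$, with energies $\mathcal E(n;\lambda)$ and $\mathcal E(-{\rm v}-1;\lambda)$. With $H_n$, $L_n^{(\alpha)}$, $P_n^{(\alpha,\beta)}$ the Hermite, Laguerre and Jacobi polynomials, the three fundamental systems are: * (H) on $\mathbb R$, without parameters: $U=x^2-1$, $\mathcal E(n)=2n$, $\phi_n=e^{-x^2/2}H_n(x)$, $\tilde\phi_{\rm v}=e^{x^2/2}\,i^{-\rm v}H_{\rm v}(ix)$. * (L) on $(0,\infty)$, $\lambda=g>\frac12$, $\delta=1$: $U=x^2+\frac{g(g-1)}{x^2}-1-2g$,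 $\mathcal E(n)=4n$, $\phi_n=e^{-x^2/2}x^gL_n^{(g-1/2)}(x^2)$, $\tilde\phi_{\rm v}=e^{x^2/2}x^{1-g}L_{\rm v}^{(1/2-g)}(-x^2)$. * (J) on $(0,\frac\pi2)$, $\lambda=(g,h)$, $g,h>\frac12$, $\delta=(1,1)$: $U=\frac{g(g-1)}{\sin^2x}+\frac{h(h-1)}{\cos^2x}-(g+h)^2$, $\mathcal E(n;g,h)=4n(n+g+h)$, $\phi_n=(\sin x)^g(\cos x)^hP_n^{(g-1/2,h-1/2)}(\cos2x)$, $\tilde\phi_{\rm v}=(\sin x)^{1-g}(\cos x)^{1-h}P_{\rm v}^{(1/2-g,1/2-h)}(\cos2x)$. More generally, a *shape-invariant system* is given by smooth real prepotentials $w(x;\lambda)$ on an open interval, $\lambda$ in a set of admissible parameters, and numbers $\mathcal E(1;\lambda)>0$, such that with $\mathcal A(\lambda)=\frac{d}{dx}-w'(\lambda)$, $\mathcal A(\lambda)^\dagger=-\frac{d}{dx}-w'(\lambda)$ one has $\mathcal A(\lambda)\mathcal A(\lambda)^\dagger=\mathcal A(\lambda+\delta)^\dagger\mathcal A(\lambda+\delta)+\mathcal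 E(1;\lambda)$ whenever $\lambda,\lambda+\delta$ are admissible. For it $U=(w')^2+w''$, $\mathcal E(n;\lambda)=\sum_{s=0}^{n-1}\mathcal E(1;\lambda+s\delta)$ and $\mathcal E(-n;\lambda)=-\sum_{s=1}^{n}\mathcal E(1;\lambda-s\delta)$ for $n\ge0$, $\phi_0=e^{w}$, $\phi_n(\lambda)=\mathcal A(\lambda)^\dagger\phi_{n-1}(\lambda+\delta)$, $\tilde\phi_0(\lambda)=1/\phi_0(\lambda-\delta)$, $\tilde\phi_{\rm v}(\lambda)=\mathcal A(\lambda-\delta)\tilde\phi_{{\rm v}-1}(\lambda-\delta)$. Let $\mathcal D=\{d_1,\dots,d_M\}\subset\mathbb Z_{\ge0}$ be a finite set of distinct integers, $N\ge\max\mathcal D$, $\bar d_j=N-d_j$, $\bar{\mathcal D}=\{0,1,\dots,N\}\setminus\{\bar d_1,\dots,\bar d_M\}=\{e_1,\dots,e_{N+1-M}\}$ and $\bar\lambda=\lambda-(N+1)\delta$. Put $$U^{\rm DP}=U(\cdot;\lambda)-2\partial_x^2\log\bigl|\mathrm W[\tilde\phi_{d_1},\dots,\tilde\phi_{d_M}](x;\lambda)\bigr|,\qquad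 U^{\rm KA}=U(\cdot;\bar\lambda)-2\partial_x^2\log\bigl|\mathrm W[\phi_{e_1},\dots,\phi_{e_{N+1-M}}](x;\bar\lambda)\bigr|,$$ $$\Phi^{\rm DP}_n=\frac{\mathrm W[\tilde\phi_{d_1},\dots,\tilde\phi_{d_M},\phi_n](x;\lambda)}{\mathrm W[\tilde\phi_{d_1},\dots,\tilde\phi_{d_M}](x;\lambda)},\qquad \Phi^{\rm KA}_n=\frac{\mathrm W[\phi_{e_1},\dots,\phi_{e_{N+1-M}},\phi_{N+1+n}](x;\bar\lambda)}{\mathrm W[\phi_{e_1},\dots,\phi_{e_{N+1-M}}](x;\bar\lambda)},$$ and let $\breve\Phi^{\rm DP}_j$, $\breve\Phi^{\rm KA}_j$ ($1\le j\le M$) be the quotients with the same denominators whose numerators are obtained from them by omitting $\tilde\phi_{d_j}$, respectively by inserting $\phi_{\bar d_j}$ in its place. **Theorem.** (1) *Duality.* For H; for L with $\bar g=g-N-1>\frac12$; for J with $\bar g,\bar h>\frac12$; and for every shape-invariant system such that $\bar\lambda,\bar\lambda+\delta,\dots,\bar\lambda+(N+1)\delta=\lambda$ are admissible: the Wronskians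 $\mathrm W[\tilde\phi_{d_1},\dots,\tilde\phi_{d_M}](x;\lambda)$ and $\mathrm W[\phi_{e_1},\dots,\phi_{e_{N+1-M}}](x;\bar\lambda)$ have the same zeros in $(x_1,x_2)$; the points where they do not vanish are dense in $(x_1,x_2)$, and at all these points $$U^{\rm DP}(x)-\mathcal E(-N-1;\lambda)=U^{\rm KA}(x),\qquad \Phi^{\rm DP}_n(x)\propto\Phi^{\rm KA}_n(x)\ (n=0,1,\dots),\qquad \breve\Phi^{\rm DP}_j(x)\propto\breve\Phi^{\rm KA}_j(x)\ (j=1,\dots,M),$$ with non-zero constants of proportionality; here, for a general shape-invariant system, $n$ runs over those $n\ge0$ for which also $\lambda+\delta,\dots,\lambda+n\delta$ are admissible. Accordingly $\mathcal E(n;\lambda)-\mathcal E(-N-1;\lambda)=\mathcal E(N+1+n;\bar\lambda)$ and $\mathcal E(-d_j-1;\lambda)-\mathcal E(-N-1;\lambda)=\mathcal E(\bar d_j;\bar\lambda)$. These equalities hold whether or not condition $(*)$ below is satisfied. (2) *Singularities.* For H, L and J under the same conditions on the parameters, $U^{\rm DP}$ is non-singular (smooth) on $(x_1,x_2)$ if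 and only if $$\prod_{j=1}^{N+1-M}(m-e_j)\ge0\qquad\text{for all } m\in\mathbb Z_{\ge0},\tag{$*$}$$ and this is also equivalent to $\mathrm W[\tilde\phi_{d_1},\dots,\tilde\phi_{d_M}](x;\lambda)$ having no zero in $(x_1,x_2)$. For $M=1$, $\mathcal D=\{{\rm v}\}$, ${\rm v}\le N$, condition $(*)$ holds exactly when ${\rm v}$ is even; in particular $\tilde\phi_{\rm v}(x;\lambda)$ has no zero in $(x_1,x_2)$ for even ${\rm v}\le N$. -/

import Mathlib

noncomputable section

namespace Duality

/-! ### Wronskians and Darboux transformations -/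

/-- The Wronskian `W[f₁, …, f_m](x) = det (f_k^{(j-1)}(x))` of a list of functions
(equal to `1` for the empty list). -/
def wronskian (l : List (ℝ → ℝ)) (x : ℝ) : ℝ :=
  (Matrix.of fun j k : Fin l.length => iteratedDeriv (j : ℕ) (l.get k) x).det

/-- The potential `U - 2 ∂ₓ² log |W[l]|` obtained from `U` by the multiple Darboux transformation
with the seed solutions `l`. It is meaningful at the points where `W[l]` does not vanish. -/
def darbouxPotential (U : ℝ → ℝ) (l : List (ℝ → ℝ)) (x : ℝ) : ℝ :=
  U x - 2 * iteratedDeriv 2 (fun y => Real.log |wronskian l y|) x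

/-- The quotient `W[l'] / W[l]`. -/
def wronskianRatio (l' l : List (ℝ → ℝ)) (x : ℝ) : ℝ :=
  wronskian l' x / wronskian l x

/-- `f ∝ g` on `s`: equality up to a non-zero multiplicative constant. -/
def PropOn (s : Set ℝ) (f g : ℝ → ℝ) : Prop :=
  ∃ c : ℝ, c ≠ 0 ∧ ∀ x ∈ s, f x = c * g x

/-! ### Index sets -/

/-- `D̄ = {0, 1, …, N} \ {N - d₁, …, N - d_M}`, in increasing order. -/
def barD (N : ℕ) (d : List ℕ) : List ℕ :=
  (List.range (N + 1)).filter fun m => m ∉ d.map fun v => N - v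

/-- `∏ⱼ (m - eⱼ) ≥ 0` for all `m ∈ ℤ_{≥0}`, where `{e₁, e₂, …} = D̄`. -/
def KreinAdler (N : ℕ) (d : List ℕ) : Prop :=
  ∀ m : ℕ, 0 ≤ ((barD N d).map fun e => (m : ℤ) - (e : ℤ)).prod

/-! ### One-dimensional systems and the two transformed systems -/

/-- The explicit data of a parametrised one-dimensional quantum system. It is only ever used for
the concrete systems constructed below. -/
structure Model (P : Type*) where
  /-- the interval `(x₁, x₂)` -/
  dom : Set ℝ
  /-- the shift `δ` of the parameters -/
  shift : P
  /-- the potential `U(x; lam)` -/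
  U : P → ℝ → ℝ
  /-- the energy `E(n; lam)`, for all integers `n` -/
  E : ℤ → P → ℝ
  /-- the eigenfunction `φ_n(x; lam)` -/
  phi : ℕ → P → ℝ → ℝ
  /-- the pseudo virtual state wavefunction `φ̃_v(x; lam)` -/
  pv : ℕ → P → ℝ → ℝ

namespace Model

variable {P : Type*} [AddCommGroup P]

/-- `lam - (N + 1) δ`. -/
def barParam (S : Model P) (N : ℕ) (lam : P) : P := lam - (N + 1) • S.shift

/-- The seed functions `φ̃_{d₁}, …, φ̃_{d_M}` at the parameters `lam`. -/
def seedsDP (S : Model P) (lam : P) (d : List ℕ) : List (ℝ → ℝ) :=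
  d.map fun v => S.pv v lam

/-- The seed functions `φ_e`, `e ∈ D̄`, at the parameters `lam - (N + 1) δ`. -/
def seedsKA (S : Model P) (N : ℕ) (lam : P) (d : List ℕ) : List (ℝ → ℝ) :=
  (barD N d).map fun e => S.phi e (S.barParam N lam)

def potDP (S : Model P) (lam : P) (d : List ℕ) : ℝ → ℝ :=
  darbouxPotential (S.U lam) (S.seedsDP lam d)

def potKA (S : Model P) (N : ℕ) (lam : P) (d : List ℕ) : ℝ → ℝ :=
  darbouxPotential (S.U (S.barParam N lam)) (S.seedsKA N lam d)

/-- `W[φ̃_{d₁}, …, φ̃_{d_M}, φ_n] / W[φ̃_{d₁}, …, φ̃_{d_M}]` at `lam`. -/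
def eigDP (S : Model P) (lam : P) (d : List ℕ) (n : ℕ) : ℝ → ℝ :=
  wronskianRatio (S.seedsDP lam d ++ [S.phi n lam]) (S.seedsDP lam d)

/-- The extra eigenfunction attached to `v ∈ d`: the seed `φ̃_v` is left out in the numerator. -/
def extraDP (S : Model P) (lam : P) (d : List ℕ) (v : ℕ) : ℝ → ℝ :=
  wronskianRatio (S.seedsDP lam (d.erase v)) (S.seedsDP lam d)

/-- `W[φ_e (e ∈ D̄), φ_{N+1+n}] / W[φ_e (e ∈ D̄)]` at `lam - (N + 1) δ`. -/
def eigKA (S : Model P) (N : ℕ) (lam : P) (d : List ℕ) (n : ℕ) : ℝ → ℝ :=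
  wronskianRatio (S.seedsKA N lam d ++ [S.phi (N + 1 + n) (S.barParam N lam)])
    (S.seedsKA N lam d)

/-- The eigenfunction attached to `N - v`, `v ∈ d`: in the numerator `φ_{N-v}` is put back in its
place, i.e. the index set is `{0, …, N} \ {N - v' : v' ∈ d, v' ≠ v}`. -/
def extraKA (S : Model P) (N : ℕ) (lam : P) (d : List ℕ) (v : ℕ) : ℝ → ℝ :=
  wronskianRatio (S.seedsKA N lam (d.erase v)) (S.seedsKA N lam d)

/-- The points of the interval at which the first transformed system is regular. -/
def regularSet (S : Model P) (lam : P) (d : List ℕ) : Set ℝ :=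
  {x | x ∈ S.dom ∧ wronskian (S.seedsDP lam d) x ≠ 0}

/-- Equivalence of the two transformed systems: both Wronskians have the same zeros in the
interval, the regular points are dense, and at the regular points the potentials agree up to the
constant `E(-N-1; lam)` and the eigenfunctions agree up to constant factors; the energies match
accordingly. `levels` is the set of the levels `n` of the original system. -/
def Equivalent (S : Model P) (N : ℕ) (lam : P) (d : List ℕ) (levels : Set ℕ) : Prop :=
  (∀ x ∈ S.dom, wronskian (S.seedsDP lam d) x = 0 ↔ wronskian (S.seedsKA N lam d) x = 0) ∧
  S.dom ⊆ closure (S.regularSet lam d) ∧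
  (∀ x ∈ S.regularSet lam d, S.potDP lam d x - S.E (-(N : ℤ) - 1) lam = S.potKA N lam d x) ∧
  (∀ n ∈ levels,
    PropOn (S.regularSet lam d) (S.eigDP lam d n) (S.eigKA N lam d n) ∧
    S.E n lam - S.E (-(N : ℤ) - 1) lam = S.E ((N : ℤ) + 1 + n) (S.barParam N lam)) ∧
  (∀ v ∈ d,
    PropOn (S.regularSet lam d) (S.extraDP lam d v) (S.extraKA N lam d v) ∧
    S.E (-(v : ℤ) - 1) lam - S.E (-(N : ℤ) - 1) lam = S.E ((N : ℤ) - v) (S.barParam N lam))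

/-- The statements on the absence of singularities: the potential of the transformed system is
smooth on the whole interval, and the Wronskian is nodeless, precisely under the Krein-Adler
condition; for a single seed `v` the condition means that `v` is even, and then `φ̃_v` is
nodeless. -/
def SingularityConditions (S : Model P) (N : ℕ) (lam : P) (d : List ℕ) : Prop :=
  (ContDiffOn ℝ ((⊤ : ℕ∞) : WithTop ℕ∞) (S.potDP lam d) S.dom ↔ KreinAdler N d) ∧
  ((∀ x ∈ S.dom, wronskian (S.seedsDP lam d) x ≠ 0) ↔ KreinAdler N d) ∧
  (∀ v ≤ N, (KreinAdler N [v] ↔ Even v) ∧ (Even v → ∀ x ∈ S.dom, S.pv v lam x ≠ 0))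

end Model

/-! ### General shape-invariant systems -/

/-- A shape-invariant system: a family of smooth prepotentials `w(x; lam)` on an open interval,
`lam` running over a set of admissible parameters, with shift `δ` and `E(1; lam) > 0`, satisfying
`(∂w(lam))² - ∂²w(lam) = (∂w(lam+δ))² + ∂²w(lam+δ) + E(1; lam)`,
i.e. `A(lam) A(lam)† = A(lam+δ)† A(lam+δ) + E(1; lam)`. -/
structure ShapeInvariantSystem (P : Type*) [AddCommGroup P] where
  dom : Set ℝ
  isOpen_dom : IsOpen dom
  ordConnected_dom : dom.OrdConnected
  nonempty_dom : dom.Nonempty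
  /-- the admissible parameters -/
  params : Set P
  shift : P
  /-- the prepotential -/
  w : P → ℝ → ℝ
  contDiffOn_w : ∀ lam ∈ params, ContDiffOn ℝ ((⊤ : ℕ∞) : WithTop ℕ∞) (w lam) dom
  /-- the energy of the first excited state -/
  E₁ : P → ℝ
  E₁_pos : ∀ lam ∈ params, lam + shift ∈ params → 0 < E₁ lam
  shape_invariance : ∀ lam ∈ params, lam + shift ∈ params → ∀ x ∈ dom,
    deriv (w lam) x ^ 2 - deriv (deriv (w lam)) x =
      deriv (w (lam + shift)) x ^ 2 + deriv (deriv (w (lam + shift))) x + E₁ lam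

namespace ShapeInvariantSystem

variable {P : Type*} [AddCommGroup P]

/-- `A(lam) = d/dx - ∂w(lam)`. -/
def opA (S : ShapeInvariantSystem P) (lam : P) (f : ℝ → ℝ) (x : ℝ) : ℝ :=
  deriv f x - deriv (S.w lam) x * f x

/-- `A(lam)† = -d/dx - ∂w(lam)`. -/
def opAdag (S : ShapeInvariantSystem P) (lam : P) (f : ℝ → ℝ) (x : ℝ) : ℝ :=
  -deriv f x - deriv (S.w lam) x * f x

/-- `U = (∂w)² + ∂²w`, so that `-d²/dx² + U = A† A`. -/
def U (S : ShapeInvariantSystem P) (lam : P) (x : ℝ) : ℝ :=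
  deriv (S.w lam) x ^ 2 + deriv (deriv (S.w lam)) x

/-- `E(n; lam) = ∑_{s=0}^{n-1} E(1; lam + s δ)` for `n ≥ 0`, continued to negative integers through
the same recursion `E(n; lam) = E(1; lam) + E(n-1; lam + δ)`, that is
`E(-n; lam) = -∑_{s=1}^{n} E(1; lam - s δ)`. -/
def E (S : ShapeInvariantSystem P) : ℤ → P → ℝ
  | Int.ofNat n, lam => ∑ s ∈ Finset.range n, S.E₁ (lam + s • S.shift)
  | Int.negSucc n, lam => -∑ s ∈ Finset.range (n + 1), S.E₁ (lam - (s + 1) • S.shift)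

/-- The eigenfunctions: `φ_0 = e^w` and the universal Rodrigues formula
`φ_n(lam) = A(lam)† A(lam+δ)† ⋯ A(lam+(n-1)δ)† φ_0(lam+nδ)`. -/
def phi (S : ShapeInvariantSystem P) : ℕ → P → ℝ → ℝ
  | 0, lam => fun x => Real.exp (S.w lam x)
  | n + 1, lam => S.opAdag lam (phi S n (lam + S.shift))

/-- The pseudo virtual state wavefunctions:
`φ̃_0(lam) = 1 / φ_0(lam-δ)` and
`φ̃_v(lam) = A(lam-δ) A(lam-2δ) ⋯ A(lam-vδ) φ̃_0(lam-vδ)`. -/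
def pv (S : ShapeInvariantSystem P) : ℕ → P → ℝ → ℝ
  | 0, lam => fun x => (Real.exp (S.w (lam - S.shift) x))⁻¹
  | v + 1, lam => S.opA (lam - S.shift) (pv S v (lam - S.shift))

/-- The model carried by a shape-invariant system. -/
def toModel (S : ShapeInvariantSystem P) : Model P where
  dom := S.dom
  shift := S.shift
  U := S.U
  E := S.E
  phi := S.phi
  pv := S.pv

/-- The levels `n` of the system at `lam` for which all of `lam - (N+1)δ, …, lam + nδ` are
admissible (all `n ≥ 0` if the admissible set is closed under the shift and contains
`lam - (N+1)δ`; possibly finitely many if there are only finitely many bound states). -/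
def levels (S : ShapeInvariantSystem P) (N : ℕ) (lam : P) : Set ℕ :=
  {n | ∀ k ≤ N + 1 + n, lam - (N + 1) • S.shift + k • S.shift ∈ S.params}

end ShapeInvariantSystem

/-! ### The three classical families of polynomials -/

/-- The Hermite polynomial `H_n = ∑_k (-1)^k n! / (k! (n-2k)!) (2X)^{n-2k}`. -/
def hermiteH (n : ℕ) : Polynomial ℝ :=
  ∑ k ∈ Finset.range (n / 2 + 1),
    Polynomial.C ((-1) ^ k * (n.factorial : ℝ) / (k.factorial * (n - 2 * k).factorial)) *
      (Polynomial.C 2 * Polynomial.X) ^ (n - 2 * k)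

/-- The Laguerre polynomial
`L_n^{(α)} = (α+1)_n / n! ₁F₁(-n; α+1; X) = ∑_k (-1)^k (α+k+1)_{n-k} / ((n-k)! k!) X^k`. -/
def laguerreL (n : ℕ) (α : ℝ) : Polynomial ℝ :=
  ∑ k ∈ Finset.range (n + 1),
    Polynomial.C ((-1) ^ k * (ascPochhammer ℝ (n - k)).eval (α + k + 1) /
      ((n - k).factorial * k.factorial)) * Polynomial.X ^ k

/-- The Jacobi polynomial
`P_n^{(α,β)} = (α+1)_n / n! ₂F₁(-n, n+α+β+1; α+1; (1-X)/2)
  = ∑_k (-1)^k (α+k+1)_{n-k} (n+α+β+1)_k / ((n-k)! k!) ((1-X)/2)^k`. -/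
def jacobiP (n : ℕ) (α β : ℝ) : Polynomial ℝ :=
  ∑ k ∈ Finset.range (n + 1),
    Polynomial.C ((-1) ^ k * (ascPochhammer ℝ (n - k)).eval (α + k + 1) *
      (ascPochhammer ℝ k).eval (n + α + β + 1) / ((n - k).factorial * k.factorial)) *
      (Polynomial.C (1 / 2) * (1 - Polynomial.X)) ^ k

/-! ### The harmonic oscillator, the radial oscillator and the Pöschl-Teller potential -/

/-- `ξ_v(x) = i^{-v} H_v(i x)`, which is a real number. -/
def hermiteXi (v : ℕ) (x : ℝ) : ℝ :=
  (Complex.I ^ (-(v : ℤ)) * Polynomial.aeval (Complex.I * (x : ℂ)) (hermiteH v)).re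

/-- H: the harmonic oscillator (there are no parameters). -/
def modelH : Model Unit where
  dom := Set.univ
  shift := 0
  U := fun _ x => x ^ 2 - 1
  E := fun n _ => 2 * n
  phi := fun n _ x => Real.exp (-x ^ 2 / 2) * (hermiteH n).eval x
  pv := fun v _ x => Real.exp (x ^ 2 / 2) * hermiteXi v x

/-- L: the radial oscillator, with parameter `g`. -/
def modelL : Model ℝ where
  dom := Set.Ioi 0
  shift := 1
  U := fun g x => x ^ 2 + g * (g - 1) / x ^ 2 - 1 - 2 * g
  E := fun n _ => 4 * n
  phi := fun n g x => Real.exp (-x ^ 2 / 2) * x ^ g * (laguerreL n (g - 1 / 2)).eval (x ^ 2)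
  pv := fun v g x =>
    Real.exp (x ^ 2 / 2) * x ^ (1 - g) * (laguerreL v (1 - g - 1 / 2)).eval (-x ^ 2)

/-- J: the Pöschl-Teller potential, with parameters `(g, h)`. -/
def modelJ : Model (ℝ × ℝ) where
  dom := Set.Ioo 0 (Real.pi / 2)
  shift := (1, 1)
  U := fun p x => p.1 * (p.1 - 1) / Real.sin x ^ 2 + p.2 * (p.2 - 1) / Real.cos x ^ 2
    - (p.1 + p.2) ^ 2
  E := fun n p => 4 * n * (n + p.1 + p.2)
  phi := fun n p x => Real.sin x ^ p.1 * Real.cos x ^ p.2 *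
    (jacobiP n (p.1 - 1 / 2) (p.2 - 1 / 2)).eval (Real.cos (2 * x))
  pv := fun v p x => Real.sin x ^ (1 - p.1) * Real.cos x ^ (1 - p.2) *
    (jacobiP v (1 - p.1 - 1 / 2) (1 - p.2 - 1 / 2)).eval (Real.cos (2 * x))

/-- `i^{-v} H_v(i x)` is indeed real. -/
theorem ofReal_hermiteXi (v : ℕ) (x : ℝ) :
    ((hermiteXi v x : ℝ) : ℂ) =
      Complex.I ^ (-(v : ℤ)) * Polynomial.aeval (Complex.I * (x : ℂ)) (hermiteH v) := by
  have key : Complex.I ^ (-(v : ℤ)) * Polynomial.aeval (Complex.I * (x : ℂ)) (hermiteH v) =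
      ((∑ k ∈ Finset.range (v / 2 + 1),
        (v.factorial : ℝ) / (k.factorial * (v - 2 * k).factorial) * (2 * x) ^ (v - 2 * k) : ℝ) :
          ℂ) := by
    unfold hermiteH
    rw [map_sum, Finset.mul_sum, Complex.ofReal_sum]
    refine Finset.sum_congr rfl fun k hk => ?_
    have hk2 : 2 * k ≤ v := by
      have := Finset.mem_range.1 hk
      omega
    obtain ⟨m, rfl⟩ := Nat.exists_eq_add_of_le hk2
    have e : 2 * k + m - 2 * k = m := by omega
    rw [e]
    have hI : Complex.I ^ (-((2 * k + m : ℕ) : ℤ)) * ((-1) ^ k * Complex.I ^ m) = 1 := by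
      rw [zpow_neg, zpow_natCast, pow_add, pow_mul, Complex.I_sq]
      exact inv_mul_cancel₀ (mul_ne_zero (pow_ne_zero _ (by norm_num))
        (pow_ne_zero _ Complex.I_ne_zero))
    simp only [map_mul, map_pow, Polynomial.aeval_C, Polynomial.aeval_X, Complex.coe_algebraMap]
    push_cast
    have e2 : (2 * (Complex.I * (x : ℂ))) ^ m = Complex.I ^ m * (2 * (x : ℂ)) ^ m := by
      rw [← mul_pow]; ring
    rw [e2]
    calc _ = (Complex.I ^ (-((2 * k + m : ℕ) : ℤ)) * ((-1) ^ k * Complex.I ^ m)) *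
        (((2 * k + m).factorial : ℂ) / ((k.factorial : ℂ) * (m.factorial : ℂ)) *
          (2 * (x : ℂ)) ^ m) := by
          push_cast; ring
      _ = _ := by rw [hI, one_mul]
  unfold hermiteXi
  rw [key, Complex.ofReal_re]

end Duality

end

noncomputable section

namespace Duality

section

open Filter Set Topology
open scoped ContDiff

/-! ### Wronskians of finite families -/

/-! Duality. Put μ = λ - (N+1)δ and climb from μ to λ one shift at a time. By shape invariance the
Darboux transformation with the ground state ψ = exp w(μ+jδ) carries the system at μ+jδ to the
system at μ+(j+1)δ, up to an additive constant. To every index k belongs one solution of each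
intermediate system: the eigenfunction φ_{k-j} while j ≤ k, and the pseudo virtual state with v =
j-1-k once k < j (`ladder`). The transformation matches these solutions up to non-zero factors
(`darboux_ladder`), except at k = j, where ψ is annihilated and its reciprocal is the new solution.

Crum's formula W[ψ, f₁, …] = ψ W[Df₁, …] (`wronskian_cons`) deletes ψ from the seeds if it is there.
The inverse formula (`wronskian_inv_cons`) adds the seed 1/ψ if ψ is not there. In both cases the
Wronskian changes by a non-zero constant and by the same factor exp w(μ+jδ)
(`wronskian_seedIdx_succ`). After N+1 rungs the index set D̄ has become its complement, that is, the
seeds φ̃_d at λ, so the two Wronskians differ by c · exp(∑ w) (`wronskian_seedsKA`). The exponential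
cancels in the quotients. In the potentials its second logarithmic derivative is what the telescoped
shape invariance relation supplies (`U_barParam`). The classical systems H, L, J are instances up to
normalization, by the backward shift relations of their polynomials.

Singularities. Duality turns the question into one about zeros of Wronskians of bound states, and
the sign condition is then the theorem of Krein and Adler.

Sufficiency, for an even number of states (`wronskian_ne_zero_of_even`): a zero at x gives a
combination f of the φ_e vanishing at x to the order of the number of seeds. Split ∏ (H - ε_e) into
two halves P₁(H), P₂(H). Integrating by parts on the part of the interval to the right of x, ∫
P₁(H)f · P₂(H)f = 0, while by Parseval the integral is a sum of terms ∏ (ε_n - ε_e) A_n² / ‖φ_n‖² ≥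
0, where A_n is the integral of f φ_n over that part. Hence f cut off at x is a finite combination
of the φ_e, which forces f = 0. For an odd number of states the condition at m = 0 forces 0 ∈ D̄,
and one rung of the ladder removes the ground state.

Necessity (`prod_nonneg_of_wronskian_ne_zero`): with Ψ the Crum transform of φ_m, the function Ψ² -
∏ (ε_m - ε_e) φ_m² has a meromorphic primitive that tends to zero at both ends
(`exists_boundary_form`). If the Wronskian has no zero, the integrand is continuous, so its integral
over the interval vanishes and the product cannot be negative. The end behaviour is controlled by
l'Hôpital's rule (`EndGauge`).

Completeness of the bound states is the uniqueness of a moment problem with exponential decay.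
Smoothness of the potential is equivalent to the absence of zeros because (log|W|)'' cannot stay
bounded next to a zero of W. -/

/-- The Wronskian of a family indexed by `Fin n`. -/
def wr {n : ℕ} (f : Fin n → ℝ → ℝ) (x : ℝ) : ℝ :=
  (Matrix.of fun j k : Fin n => iteratedDeriv (j : ℕ) (f k) x).det

theorem wronskian_eq_wr {l : List (ℝ → ℝ)} {n : ℕ} {f : Fin n → ℝ → ℝ} (h : l = List.ofFn f)
    (x : ℝ) : wronskian l x = wr f x := by
  have hn : l.length = n := by simp [h]
  subst hn
  have : f = l.get := by
    funext i
    have h2 : l[(i : ℕ)]? = (List.ofFn f)[(i : ℕ)]? := by rw [← h]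
    rw [List.getElem?_eq_getElem i.2, List.getElem?_eq_getElem (by simp)] at h2
    simpa using h2.symm
  rw [this]; rfl

theorem _root_.ContDiffAt.deriv_infty {f : ℝ → ℝ} {x : ℝ} (h : ContDiffAt ℝ ∞ f x) :
    ContDiffAt ℝ ∞ (deriv f) x :=
  h.derivWithin (by simp)

theorem _root_.ContDiffAt.eventually_infty {f : ℝ → ℝ} {x : ℝ} (h : ContDiffAt ℝ ∞ f x) :
    ∀ᶠ y in 𝓝 x, ∀ n : ℕ, n ≤ 2 → ContDiffAt ℝ n f y := by
  have h2 : ContDiffAt ℝ (2 : ℕ) f x := contDiffAt_infty.1 h 2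
  filter_upwards [h2.eventually (by simp)] with y hy n hn
  exact hy.of_le (by exact_mod_cast hn)

theorem _root_.ContDiffAt.eventually_differentiableAt {f : ℝ → ℝ} {x : ℝ} (h : ContDiffAt ℝ ∞ f x) :
    ∀ᶠ y in 𝓝 x, DifferentiableAt ℝ f y := by
  filter_upwards [h.eventually_infty] with y hy
  exact (hy 1 (by norm_num)).differentiableAt (by simp)

theorem _root_.ContDiffAt.diff {f : ℝ → ℝ} {x : ℝ} (h : ContDiffAt ℝ ∞ f x) : DifferentiableAt ℝ f x :=
  h.differentiableAt (by simp)

theorem _root_.ContDiffAt.iteratedDeriv_infty {f : ℝ → ℝ} {x : ℝ} (h : ContDiffAt ℝ ∞ f x) (n : ℕ) :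
    ContDiffAt ℝ ∞ (iteratedDeriv n f) x := by
  induction n with
  | zero => simpa using h
  | succ n ih => rw [iteratedDeriv_succ]; exact ih.deriv_infty

/-- By Leibniz' rule the Wronskian matrix of the products is `B` times that of the `f k`, where `B`
is lower triangular with `h x` on the diagonal. -/
theorem wr_mul {n : ℕ} {f : Fin n → ℝ → ℝ} {h : ℝ → ℝ} {x : ℝ} (hh : ContDiffAt ℝ ∞ h x)
    (hf : ∀ k, ContDiffAt ℝ ∞ (f k) x) : wr (fun k y => h y * f k y) x = h x ^ n * wr f x := by
  let B : Matrix (Fin n) (Fin n) ℝ := Matrix.of fun j i =>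
    if i ≤ j then ((j : ℕ).choose i : ℝ) * iteratedDeriv ((j : ℕ) - i) h x else 0
  have hB : B.det = h x ^ n := by
    rw [Matrix.det_of_isLowerTriangular]
    · simp [B]
    · intro i j hij
      have : ¬ (j ≤ i) := not_le.2 hij
      simp [B, this]
  unfold wr
  rw [← hB, ← Matrix.det_mul]
  congr 1
  ext j k
  have h1 : ContDiffAt ℝ (j : ℕ) h x := hh.of_le (by exact_mod_cast le_top)
  have h2 : ContDiffAt ℝ (j : ℕ) (f k) x := (hf k).of_le (by exact_mod_cast le_top)
  have e : (fun y => h y * f k y) = f k * h := by funext y; simp [mul_comm]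
  simp only [Matrix.of_apply, Matrix.mul_apply, e]
  rw [iteratedDeriv_mul h2 h1]
  have : ∑ i : Fin n, B j i * iteratedDeriv (i : ℕ) (f k) x =
      ∑ i ∈ Finset.range n, (if i ≤ j then ((j : ℕ).choose i : ℝ) *
        iteratedDeriv ((j : ℕ) - i) h x else 0) * iteratedDeriv i (f k) x := by
    rw [Finset.sum_range]
    rfl
  rw [this]
  have hsub : Finset.range ((j : ℕ) + 1) ⊆ Finset.range n := by
    intro i hi; simp at hi ⊢; omega
  rw [← Finset.sum_subset hsub]
  · refine Finset.sum_congr rfl fun i hi => ?_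
    have : i ≤ (j : ℕ) := by simp at hi; omega
    rw [if_pos this]; ring
  · intro i _ hi
    have : ¬ i ≤ (j : ℕ) := by simp at hi; omega
    rw [if_neg this, zero_mul]

theorem wr_congr {n : ℕ} {f g : Fin n → ℝ → ℝ} {x : ℝ} (h : ∀ k, f k =ᶠ[𝓝 x] g k) :
    wr f x = wr g x := by
  unfold wr
  congr 1
  ext j k
  exact (h k).iteratedDeriv_eq _

/-- The first column is (1, 0, …, 0), so the determinant reduces to a single minor, whose entries
are shifted by one derivative. -/
theorem wr_cons_one {n : ℕ} (f : Fin n → ℝ → ℝ) (x : ℝ) :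
    wr (Fin.cons (fun _ => 1) f : Fin (n + 1) → ℝ → ℝ) x = wr (fun k => deriv (f k)) x := by
  unfold wr
  rw [Matrix.det_succ_column_zero, Finset.sum_eq_single 0]
  · simp only [Fin.val_zero, pow_zero, one_mul, Matrix.of_apply, Fin.cons_zero, iteratedDeriv_zero]
    congr 1
    ext j k
    simp [Matrix.submatrix, iteratedDeriv_succ']
  · intro i _ hi
    have : (i : ℕ) ≠ 0 := fun h => hi (Fin.ext h)
    simp [iteratedDeriv_const, this]
  · simp

theorem wr_smul {n : ℕ} (c : Fin n → ℝ) (f : Fin n → ℝ → ℝ) (x : ℝ) :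
    wr (fun k y => c k * f k y) x = (∏ k, c k) * wr f x := by
  unfold wr
  rw [← Matrix.det_mul_row]
  congr 1
  ext j k
  simp

/-! ### Wronskians of lists -/

theorem wronskian_map {α : Type*} (l : List α) (F : α → ℝ → ℝ) (x : ℝ) :
    wronskian (l.map F) x = wr (fun k : Fin l.length => F (l.get k)) x :=
  wronskian_eq_wr (by
    conv_lhs => rw [← List.ofFn_get l]
    rw [List.map_ofFn]; rfl) x

theorem wronskian_map_congr {α : Type*} {l : List α} {F G : α → ℝ → ℝ} {x : ℝ}
    (h : ∀ a ∈ l, F a =ᶠ[𝓝 x] G a) : wronskian (l.map F) x = wronskian (l.map G) x := by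
  rw [wronskian_map, wronskian_map]
  exact wr_congr fun k => h _ (List.get_mem _ _)

@[simp]
theorem wronskian_nil (x : ℝ) : wronskian [] x = 1 := by
  simp [wronskian]

@[simp]
theorem wronskian_singleton (f : ℝ → ℝ) (x : ℝ) : wronskian [f] x = f x := by
  rw [wronskian_eq_wr (f := fun _ : Fin 1 => f) (by simp)]
  simp [wr]

theorem wronskian_map_smul {α : Type*} (l : List α) (c : α → ℝ) (F : α → ℝ → ℝ) (x : ℝ) :
    wronskian (l.map fun a y => c a * F a y) x = (l.map c).prod * wronskian (l.map F) x := by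
  rw [wronskian_map, wronskian_map, wr_smul (fun k => c (l.get k)) (fun k => F (l.get k))]
  congr 1
  rw [← List.prod_ofFn]
  congr 1
  conv_rhs => rw [← List.ofFn_get l]
  rw [List.map_ofFn]; rfl

/-- The functions `y ↦ f' - (ψ'/ψ) f`, the Darboux transform of `f` by `ψ`. -/
def darboux (ψ f : ℝ → ℝ) (x : ℝ) : ℝ := deriv f x - deriv ψ x / ψ x * f x

/-- The quotient rule in the form ψ (f/ψ)' = f' - (ψ'/ψ) f. An identity of germs is needed because
the Wronskian differentiates it further. -/
theorem darboux_eventuallyEq {ψ f : ℝ → ℝ} {x : ℝ} (hψ : ContDiffAt ℝ ∞ ψ x)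
    (hf : ContDiffAt ℝ ∞ f x) (h0 : ψ x ≠ 0) :
    (fun y => ψ y * deriv (fun z => (ψ z)⁻¹ * f z) y) =ᶠ[𝓝 x] darboux ψ f := by
  filter_upwards [hψ.eventually_differentiableAt, hf.eventually_differentiableAt,
    hψ.continuousAt.eventually_ne h0] with y h1 h2 h3
  have := ((h1.hasDerivAt.inv h3).mul h2.hasDerivAt).deriv
  simp only [Pi.mul_def, Pi.inv_apply] at this
  rw [this, darboux]
  field_simp
  ring

theorem contDiffAt_darboux {ψ f : ℝ → ℝ} {x : ℝ} (hψ : ContDiffAt ℝ ∞ ψ x)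
    (hf : ContDiffAt ℝ ∞ f x) (h0 : ψ x ≠ 0) : ContDiffAt ℝ ∞ (darboux ψ f) x := by
  unfold darboux
  exact hf.deriv_infty.sub ((hψ.deriv_infty.div hψ h0).mul hf)

/-- Crum's reduction: `W[ψ, f₁, …, f_m] = ψ W[D f₁, …, D f_m]`. -/
theorem wronskian_cons {ψ : ℝ → ℝ} {l : List (ℝ → ℝ)} {x : ℝ} (hψ : ContDiffAt ℝ ∞ ψ x)
    (hl : ∀ f ∈ l, ContDiffAt ℝ ∞ f x) (h0 : ψ x ≠ 0) :
    wronskian (ψ :: l) x = ψ x * wronskian (l.map (darboux ψ)) x := by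
  set g : Fin l.length → ℝ → ℝ := fun k => l.get k with hg
  have hgs : ∀ k, ContDiffAt ℝ ∞ (g k) x := fun k => hl _ (List.get_mem _ _)
  have hinv : ContDiffAt ℝ ∞ (fun y => (ψ y)⁻¹) x := hψ.inv h0
  have e1 : wronskian (ψ :: l) x = wr (Fin.cons ψ g : Fin (l.length + 1) → ℝ → ℝ) x :=
    wronskian_eq_wr (by rw [List.ofFn_cons, hg]; simp) x
  -- Factoring out ψ turns the first function into the constant 1.
  have e2 : wr (Fin.cons ψ g : Fin (l.length + 1) → ℝ → ℝ) x =
      wr (fun k y => ψ y * (Fin.cons (fun _ => 1) (fun k z => (ψ z)⁻¹ * g k z) :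
        Fin (l.length + 1) → ℝ → ℝ) k y) x := by
    refine wr_congr fun k => ?_
    filter_upwards [hψ.continuousAt.eventually_ne h0] with y hy
    refine Fin.cases ?_ (fun k => ?_) k
    · simp
    · simp [mul_inv_cancel_left₀ hy]
  rw [e1, e2, wr_mul hψ, wr_cons_one, wronskian_map]
  · have := wr_mul (n := l.length) (f := fun k => deriv fun z => (ψ z)⁻¹ * g k z) hψ
      (fun k => (hinv.mul (hgs k)).deriv_infty)
    -- Of the m + 1 factors ψ, m go back inside the Wronskian of the derivatives (f_k/ψ)' and one
    -- remains in front.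
    rw [pow_succ', mul_assoc, ← this]
    congr 1
    exact wr_congr fun k => darboux_eventuallyEq hψ (hgs k) h0
  · intro k
    refine Fin.cases ?_ (fun k => ?_) k
    · simpa using contDiffAt_const
    · simpa using hinv.mul (hgs k)

/-- Expresses a permutation of lists as a bijection of positions, which is what the permutation rule
for determinant columns needs. -/
theorem _root_.List.Perm.exists_equiv_get {α : Type*} {l l' : List α} (h : l.Perm l') :
    ∃ σ : Fin l.length ≃ Fin l'.length, ∀ i, l.get i = l'.get (σ i) := by
  induction h with
  | nil => exact ⟨Equiv.refl _, fun i => i.elim0⟩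
  | @cons a l₁ l₂ _ ih =>
    obtain ⟨σ, hσ⟩ := ih
    refine ⟨(finSuccEquiv _).trans ((Equiv.optionCongr σ).trans (finSuccEquiv _).symm), fun i => ?_⟩
    refine Fin.cases ?_ (fun i => ?_) i
    · simp
    · have := hσ i
      simp only [List.get_eq_getElem] at this
      simp [this]
  | @swap a b l =>
    refine ⟨Equiv.swap (⟨0, by simp⟩ : Fin (l.length + 2)) ⟨1, by simp⟩, fun i => ?_⟩
    rcases i with ⟨_ | _ | i, hi⟩
    · simp
    · simp
    · rw [Equiv.swap_apply_of_ne_of_ne (by simp) (by simp)]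
      simp
  | trans _ _ ih₁ ih₂ =>
    obtain ⟨σ, hσ⟩ := ih₁
    obtain ⟨τ, hτ⟩ := ih₂
    exact ⟨σ.trans τ, fun i => by rw [hσ, hτ]; rfl⟩

/-- A permutation changes the Wronskian by a constant sign. -/
theorem wronskian_perm {l l' : List (ℝ → ℝ)} (h : l.Perm l') :
    ∃ c : ℝ, c ≠ 0 ∧ ∀ x, wronskian l x = c * wronskian l' x := by
  obtain ⟨σ, hσ⟩ := h.exists_equiv_get
  have hlen := h.length_eq
  let τ : Equiv.Perm (Fin l.length) := σ.trans (finCongr hlen.symm)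
  refine ⟨((Equiv.Perm.sign τ : ℤ) : ℝ), by exact_mod_cast (Equiv.Perm.sign τ).ne_zero, fun x => ?_⟩
  have e1 : wronskian l' x = wr (fun k : Fin l.length => l'.get (finCongr hlen k)) x := by
    refine wronskian_eq_wr ?_ x
    apply List.ext_get (by simp [hlen])
    intro n h1 h2
    simp [finCongr]
  rw [e1]
  have := Matrix.det_permute' τ
    (Matrix.of fun j k : Fin l.length => iteratedDeriv (j : ℕ) (l'.get (finCongr hlen k)) x)
  unfold wr
  rw [← this]
  unfold wronskian
  congr 1
  ext j k
  simp only [Matrix.of_apply, Matrix.submatrix_apply, id, hσ]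
  congr 2

theorem contDiffAt_wronskian {l : List (ℝ → ℝ)} {x : ℝ} (hl : ∀ f ∈ l, ContDiffAt ℝ ∞ f x) :
    ContDiffAt ℝ ∞ (wronskian l) x := by
  unfold wronskian
  simp only [Matrix.det_apply, Matrix.of_apply]
  refine ContDiffAt.sum fun σ _ => ContDiffAt.const_smul _ ?_
  refine contDiffAt_prod fun i _ => ?_
  exact (hl _ (List.get_mem _ _)).iteratedDeriv_infty _

end

section

open Filter Set Topology
open scoped ContDiff

/-! ### Darboux transformations of solutions of Schrödinger equations -/

/-- `f` is a smooth solution of `-f'' + U f = e f` on `I`. -/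
structure SolOn (I : Set ℝ) (U : ℝ → ℝ) (e : ℝ) (f : ℝ → ℝ) : Prop where
  smooth : ∀ x ∈ I, ContDiffAt ℝ ∞ f x
  eq : ∀ x ∈ I, deriv (deriv f) x = (U x - e) * f x

theorem SolOn.mono {I J : Set ℝ} {U : ℝ → ℝ} {e : ℝ} {f : ℝ → ℝ} (h : SolOn I U e f)
    (hJ : J ⊆ I) : SolOn J U e f :=
  ⟨fun x hx => h.smooth x (hJ hx), fun x hx => h.eq x (hJ hx)⟩

theorem SolOn.hasDerivAt {I : Set ℝ} {U : ℝ → ℝ} {e : ℝ} {f : ℝ → ℝ} (h : SolOn I U e f)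
    {x : ℝ} (hx : x ∈ I) : HasDerivAt f (deriv f x) x :=
  (h.smooth x hx).diff.hasDerivAt

theorem SolOn.hasDerivAt_deriv {I : Set ℝ} {U : ℝ → ℝ} {e : ℝ} {f : ℝ → ℝ} (h : SolOn I U e f)
    {x : ℝ} (hx : x ∈ I) : HasDerivAt (deriv f) ((U x - e) * f x) x := by
  rw [← h.eq x hx]
  exact (h.smooth x hx).deriv_infty.diff.hasDerivAt

theorem SolOn.congr {I : Set ℝ} (hI : IsOpen I) {U V : ℝ → ℝ} {e : ℝ} {f g : ℝ → ℝ}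
    (h : SolOn I U e f) (hfg : ∀ x ∈ I, g x = f x) (hUV : ∀ x ∈ I, V x = U x) : SolOn I V e g := by
  have hE : ∀ x ∈ I, g =ᶠ[𝓝 x] f := fun x hx => by
    filter_upwards [hI.mem_nhds hx] with y hy using hfg y hy
  exact ⟨fun x hx => (h.smooth x hx).congr_of_eventuallyEq (hE x hx), fun x hx => by
    rw [(hE x hx).deriv.deriv_eq, h.eq x hx, hfg x hx, hUV x hx]⟩

theorem SolOn.const_mul {I : Set ℝ} {U : ℝ → ℝ} {e : ℝ} {f : ℝ → ℝ} (h : SolOn I U e f) (c : ℝ) :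
    SolOn I U e (fun x => c * f x) := by
  refine ⟨fun x hx => contDiffAt_const.mul (h.smooth x hx), fun x hx => ?_⟩
  have e1 : deriv (fun x => c * f x) = fun x => c * deriv f x := by
    funext y; exact deriv_const_mul_field c
  rw [e1, deriv_const_mul_field c, h.eq x hx]
  ring

/-- The potential `2 (ψ'/ψ)² + 2 e₀ - U = U - 2 (log ψ)''` obtained by a Darboux transformation. -/
def darbouxU (U : ℝ → ℝ) (e₀ : ℝ) (ψ : ℝ → ℝ) (x : ℝ) : ℝ :=
  2 * (deriv ψ x / ψ x) ^ 2 + 2 * e₀ - U x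

section

variable {I : Set ℝ} {U : ℝ → ℝ} {e₀ e e' : ℝ} {ψ y z : ℝ → ℝ}

theorem hasDerivAt_logDeriv (hψ : SolOn I U e₀ ψ) {x : ℝ} (hx : x ∈ I) (h0 : ψ x ≠ 0) :
    HasDerivAt (fun t => deriv ψ t / ψ t) (U x - e₀ - (deriv ψ x / ψ x) ^ 2) x := by
  have h := (hψ.hasDerivAt_deriv hx).div (hψ.hasDerivAt hx) h0
  have e : ((U x - e₀) * ψ x * ψ x - deriv ψ x * deriv ψ x) / ψ x ^ 2 =
      U x - e₀ - (deriv ψ x / ψ x) ^ 2 := by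
    field_simp
  rw [e] at h
  exact h

/-- The factorization (d/dx + ψ'/ψ)(d/dx - ψ'/ψ) y = (e₀ - e) y, solved for the derivative of the
transform. -/
theorem hasDerivAt_darboux (hψ : SolOn I U e₀ ψ) (hy : SolOn I U e y) {x : ℝ} (hx : x ∈ I)
    (h0 : ψ x ≠ 0) : HasDerivAt (darboux ψ y)
      ((e₀ - e) * y x - deriv ψ x / ψ x * darboux ψ y x) x := by
  have h := (hy.hasDerivAt_deriv hx).sub ((hasDerivAt_logDeriv hψ hx h0).mul (hy.hasDerivAt hx))
  refine h.congr_deriv ?_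
  simp only [darboux]
  ring

/-- The intertwining property: differentiating the first order relation `hasDerivAt_darboux` once
more gives the equation with the new potential at the unchanged energy. -/
theorem SolOn.darboux (hI : IsOpen I) (hψ : SolOn I U e₀ ψ) (h0 : ∀ x ∈ I, ψ x ≠ 0)
    (hy : SolOn I U e y) : SolOn I (darbouxU U e₀ ψ) e (darboux ψ y) := by
  refine ⟨fun x hx => contDiffAt_darboux (hψ.smooth x hx) (hy.smooth x hx) (h0 x hx),
    fun x hx => ?_⟩
  have hE : deriv (Duality.darboux ψ y) =ᶠ[𝓝 x]
      fun t => (e₀ - e) * y t - deriv ψ t / ψ t * Duality.darboux ψ y t := by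
    filter_upwards [hI.mem_nhds hx] with t ht
    exact (hasDerivAt_darboux hψ hy ht (h0 t ht)).deriv
  rw [hE.deriv_eq]
  have := ((hy.hasDerivAt hx).const_mul (e₀ - e)).sub
    ((hasDerivAt_logDeriv hψ hx (h0 x hx)).mul (hasDerivAt_darboux hψ hy hx (h0 x hx)))
  refine this.deriv.trans ?_
  simp only [darbouxU, Duality.darboux]
  have := h0 x hx
  field_simp
  ring

theorem deriv_inv_div (hψ : SolOn I U e₀ ψ) {x : ℝ} (hx : x ∈ I) (h0 : ψ x ≠ 0) :
    deriv (fun t => (ψ t)⁻¹) x / (ψ x)⁻¹ = -(deriv ψ x / ψ x) := by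
  have := ((hψ.hasDerivAt hx).inv h0).deriv
  simp only [Pi.inv_def] at this
  rw [this]
  field_simp

/-- The function 1/ψ is annihilated by d/dx + ψ'/ψ, a right factor of the transformed operator minus
e₀. -/
theorem SolOn.inv (hI : IsOpen I) (hψ : SolOn I U e₀ ψ) (h0 : ∀ x ∈ I, ψ x ≠ 0) :
    SolOn I (darbouxU U e₀ ψ) e₀ (fun t => (ψ t)⁻¹) := by
  refine ⟨fun x hx => (hψ.smooth x hx).inv (h0 x hx), fun x hx => ?_⟩
  have hE : deriv (fun t => (ψ t)⁻¹) =ᶠ[𝓝 x] fun t => -(deriv ψ t / ψ t * (ψ t)⁻¹) := by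
    filter_upwards [hI.mem_nhds hx] with t ht
    have h1 := deriv_inv_div hψ ht (h0 t ht)
    rw [div_eq_iff (inv_ne_zero (h0 t ht))] at h1
    rw [h1, neg_mul]
  rw [hE.deriv_eq]
  refine ((hasDerivAt_logDeriv hψ hx (h0 x hx)).mul
    ((hψ.hasDerivAt hx).inv (h0 x hx))).neg.deriv.trans ?_
  have := h0 x hx
  simp only [darbouxU, Pi.inv_apply]
  field_simp
  ring

/-- The Darboux transformation by 1/ψ is d/dx + ψ'/ψ, so this composition is the factorized operator
acting on y. It undoes the transformation up to a constant. -/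
theorem darboux_inv_darboux (hψ : SolOn I U e₀ ψ) (hy : SolOn I U e y) {x : ℝ} (hx : x ∈ I)
    (h0 : ψ x ≠ 0) : darboux (fun t => (ψ t)⁻¹) (darboux ψ y) x = (e₀ - e) * y x := by
  rw [darboux, (hasDerivAt_darboux hψ hy hx h0).deriv, deriv_inv_div hψ hx h0]
  ring

/-- The Darboux transformation does not annihilate a solution with a different energy. -/
theorem darboux_not_eqOn_zero (hI : IsOpen I) (hψ : SolOn I U e₀ ψ) (h0 : ∀ x ∈ I, ψ x ≠ 0)
    (hy : SolOn I U e y) (hne : e ≠ e₀) (hnv : ∃ x ∈ I, y x ≠ 0) :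
    ∃ x ∈ I, darboux ψ y x ≠ 0 := by
  obtain ⟨x, hx, hyx⟩ := hnv
  by_contra! h
  have hE : darboux ψ y =ᶠ[𝓝 x] fun _ => 0 := by
    filter_upwards [hI.mem_nhds hx] with t ht using h t ht
  have := darboux_inv_darboux hψ hy hx (h0 x hx)
  rw [darboux, hE.deriv_eq, h x hx] at this
  simp at this
  rcases this with h | h
  · exact hne (by linarith)
  · exact hyx h

end

/-- The inverse of Crum's reduction: `W[1/ψ, D f₁, …, D f_m] = ψ⁻¹ ∏ (e₀ - e_k) W[f₁, …, f_m]`. -/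
theorem wronskian_inv_cons {α : Type*} {I : Set ℝ} (hI : IsOpen I) {U : ℝ → ℝ} {e₀ : ℝ}
    {ψ : ℝ → ℝ} (hψ : SolOn I U e₀ ψ) (h0 : ∀ x ∈ I, ψ x ≠ 0) {l : List α} {F : α → ℝ → ℝ}
    {ε : α → ℝ} (hF : ∀ a ∈ l, SolOn I U (ε a) (F a)) {x : ℝ} (hx : x ∈ I) :
    wronskian ((fun t => (ψ t)⁻¹) :: l.map fun a => darboux ψ (F a)) x =
      (ψ x)⁻¹ * ((l.map fun a => e₀ - ε a).prod * wronskian (l.map F) x) := by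
  have hinv : ContDiffAt ℝ ∞ (fun t => (ψ t)⁻¹) x := (hψ.smooth x hx).inv (h0 x hx)
  rw [wronskian_cons hinv _ (inv_ne_zero (h0 x hx)), List.map_map, ← wronskian_map_smul]
  · congr 1
    refine wronskian_map_congr fun a ha => ?_
    filter_upwards [hI.mem_nhds hx] with t ht
    exact darboux_inv_darboux hψ (hF a ha) ht (h0 t ht)
  · intro f hf
    obtain ⟨a, ha, rfl⟩ := List.mem_map.1 hf
    exact contDiffAt_darboux (hψ.smooth x hx) ((hF a ha).smooth x hx) (h0 x hx)

/-- The Wronskian of solutions with distinct energies, none of which vanishes on an interval,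
does not vanish on an interval. -/
theorem exists_wronskian_ne_zero {α : Type*} {l : List α} :
    ∀ {I : Set ℝ} {U : ℝ → ℝ} {F : α → ℝ → ℝ} {ε : α → ℝ}, IsOpen I → I.Nonempty →
      (∀ a ∈ l, SolOn I U (ε a) (F a)) → l.Pairwise (fun a b => ε a ≠ ε b) →
      (∀ a ∈ l, ∀ J ⊆ I, IsOpen J → J.Nonempty → ∃ x ∈ J, F a x ≠ 0) →
      ∃ x ∈ I, wronskian (l.map F) x ≠ 0 := by
  induction l with
  | nil =>
    intro I U F ε _ hne _ _ _
    obtain ⟨x, hx⟩ := hne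
    exact ⟨x, hx, by simp⟩
  | cons a l ih =>
    intro I U F ε hI hne hF hε hnv
    obtain ⟨x₀, hx₀, hax₀⟩ := hnv a (by simp) I le_rfl hI hne
    have hFa := hF a (by simp)
    have hcont : ContinuousOn (F a) I := fun x hx =>
      (hFa.smooth x hx).continuousAt.continuousWithinAt
    -- Crum's reduction needs a first seed without zeros; it suffices to work on the open set where
    -- that seed does not vanish. The transformed functions there keep their distinct energies.
    set J : Set ℝ := I ∩ F a ⁻¹' {0}ᶜ with hJ
    have hJo : IsOpen J := hcont.isOpen_inter_preimage hI isOpen_compl_singleton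
    have hJI : J ⊆ I := inter_subset_left
    have h0 : ∀ x ∈ J, F a x ≠ 0 := fun x hx => hx.2
    rw [List.pairwise_cons] at hε
    obtain ⟨x, hx, hW⟩ := ih (F := fun b => darboux (F a) (F b)) (ε := ε) hJo ⟨x₀, hx₀, hax₀⟩
      (fun b hb => (hFa.mono hJI).darboux hJo h0 ((hF b (by simp [hb])).mono hJI)) hε.2
      (fun b hb K hK hKo hKne => by
        have hKI := hK.trans hJI
        exact darboux_not_eqOn_zero hKo (hFa.mono hKI) (fun x hx => h0 x (hK hx))
          ((hF b (by simp [hb])).mono hKI) (hε.1 b hb).symm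
          (hnv b (by simp [hb]) K hKI hKo hKne))
    refine ⟨x, hJI hx, ?_⟩
    rw [List.map_cons, wronskian_cons (hFa.smooth x (hJI hx)) _ (h0 x hx), List.map_map]
    · exact mul_ne_zero (h0 x hx) hW
    · intro f hf
      obtain ⟨b, hb, rfl⟩ := List.mem_map.1 hf
      exact (hF b (by simp [hb])).smooth x (hJI hx)

end

section

open Filter Set Topology
open scoped ContDiff

/-! ### Shape-invariant systems -/

namespace ShapeInvariantSystem

variable {P : Type*} [AddCommGroup P] (S : ShapeInvariantSystem P) {lam : P}

theorem contDiffAt_w (hlam : lam ∈ S.params) {x : ℝ} (hx : x ∈ S.dom) :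
    ContDiffAt ℝ ∞ (S.w lam) x :=
  (S.contDiffOn_w lam hlam).contDiffAt (S.isOpen_dom.mem_nhds hx)

theorem hasDerivAt_exp_w (hlam : lam ∈ S.params) {x : ℝ} (hx : x ∈ S.dom) :
    HasDerivAt (fun t => Real.exp (S.w lam t)) (Real.exp (S.w lam x) * deriv (S.w lam) x) x :=
  (S.contDiffAt_w hlam hx).diff.hasDerivAt.exp

theorem deriv_exp_w_div (hlam : lam ∈ S.params) {x : ℝ} (hx : x ∈ S.dom) :
    deriv (fun t => Real.exp (S.w lam t)) x / Real.exp (S.w lam x) = deriv (S.w lam) x := by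
  rw [(S.hasDerivAt_exp_w hlam hx).deriv, mul_div_cancel_left₀ _ (Real.exp_ne_zero _)]

theorem solOn_exp_w (hlam : lam ∈ S.params) :
    SolOn S.dom (S.U lam) 0 (fun t => Real.exp (S.w lam t)) := by
  refine ⟨fun x hx => (S.contDiffAt_w hlam hx).exp, fun x hx => ?_⟩
  have hE : deriv (fun t => Real.exp (S.w lam t)) =ᶠ[𝓝 x]
      fun t => Real.exp (S.w lam t) * deriv (S.w lam) t := by
    filter_upwards [S.isOpen_dom.mem_nhds hx] with t ht using (S.hasDerivAt_exp_w hlam ht).deriv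
  rw [hE.deriv_eq]
  refine ((S.hasDerivAt_exp_w hlam hx).mul
    (S.contDiffAt_w hlam hx).deriv_infty.diff.hasDerivAt).deriv.trans ?_
  simp only [U]
  ring

theorem darboux_exp_w (hlam : lam ∈ S.params) (f : ℝ → ℝ) {x : ℝ} (hx : x ∈ S.dom) :
    darboux (fun t => Real.exp (S.w lam t)) f x = S.opA lam f x := by
  rw [darboux, S.deriv_exp_w_div hlam hx, opA]

theorem darboux_inv_exp_w (hlam : lam ∈ S.params) (f : ℝ → ℝ) {x : ℝ} (hx : x ∈ S.dom) :
    darboux (fun t => (Real.exp (S.w lam t))⁻¹) f x = -S.opAdag lam f x := by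
  rw [darboux, deriv_inv_div (S.solOn_exp_w hlam) hx (Real.exp_ne_zero _),
    S.deriv_exp_w_div hlam hx, opAdag]
  ring

/-- This is where shape invariance enters: the ground state Darboux transformation of U(λ) is U(λ+δ)
up to the constant `E₁`. -/
theorem darbouxU_exp_w (hlam : lam ∈ S.params) (hlam' : lam + S.shift ∈ S.params) {x : ℝ}
    (hx : x ∈ S.dom) : darbouxU (S.U lam) 0 (fun t => Real.exp (S.w lam t)) x =
      S.U (lam + S.shift) x + S.E₁ lam := by
  have := S.shape_invariance lam hlam hlam' x hx
  rw [darbouxU, S.deriv_exp_w_div hlam hx, U, U]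
  linarith

theorem solOn_shift {V : ℝ → ℝ} {c e e' : ℝ} {f : ℝ → ℝ} {I : Set ℝ} {U : ℝ → ℝ}
    (h : SolOn I V e f) (hV : ∀ x ∈ I, V x = U x + c) (he : e' = e - c) : SolOn I U e' f :=
  ⟨h.smooth, fun x hx => by rw [h.eq x hx, hV x hx, he]; ring⟩

theorem solOn_opA (hlam : lam ∈ S.params) (hlam' : lam + S.shift ∈ S.params) {e : ℝ} {f : ℝ → ℝ}
    (hf : SolOn S.dom (S.U lam) e f) :
    SolOn S.dom (S.U (lam + S.shift)) (e - S.E₁ lam) (S.opA lam f) := by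
  refine solOn_shift ((SolOn.darboux S.isOpen_dom (S.solOn_exp_w hlam)
    (fun _ _ => Real.exp_ne_zero _) hf).congr S.isOpen_dom
      (fun x hx => (S.darboux_exp_w hlam f hx).symm) fun _ _ => rfl)
    (fun x hx => S.darbouxU_exp_w hlam hlam' hx) rfl

theorem solOn_inv_exp_w (hlam : lam ∈ S.params) (hlam' : lam + S.shift ∈ S.params) :
    SolOn S.dom (S.U (lam + S.shift)) (-S.E₁ lam) (fun t => (Real.exp (S.w lam t))⁻¹) :=
  solOn_shift (SolOn.inv S.isOpen_dom (S.solOn_exp_w hlam) fun _ _ => Real.exp_ne_zero _)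
    (fun x hx => S.darbouxU_exp_w hlam hlam' hx) (by ring)

theorem solOn_opAdag_aux (hlam : lam ∈ S.params) (hlam' : lam + S.shift ∈ S.params) {e : ℝ}
    {f : ℝ → ℝ} (hf : SolOn S.dom (S.U (lam + S.shift)) e f) :
    SolOn S.dom (darbouxU (S.U lam) 0 (fun t => Real.exp (S.w lam t))) (e + S.E₁ lam) f :=
  solOn_shift hf (c := -S.E₁ lam) (fun x hx => by rw [S.darbouxU_exp_w hlam hlam' hx]; ring)
    (by ring)

/-- The adjoint is minus the Darboux transformation by the reciprocal ground state, and transforming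
back with it restores the original potential. -/
theorem solOn_opAdag (hlam : lam ∈ S.params) (hlam' : lam + S.shift ∈ S.params) {e : ℝ}
    {f : ℝ → ℝ} (hf : SolOn S.dom (S.U (lam + S.shift)) e f) :
    SolOn S.dom (S.U lam) (e + S.E₁ lam) (S.opAdag lam f) := by
  have h := SolOn.darboux S.isOpen_dom (SolOn.inv S.isOpen_dom (S.solOn_exp_w hlam)
    fun _ _ => Real.exp_ne_zero _) (fun _ _ => inv_ne_zero (Real.exp_ne_zero _))
    (S.solOn_opAdag_aux hlam hlam' hf)
  refine (h.const_mul (-1)).congr S.isOpen_dom (fun x hx => ?_) fun x hx => ?_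
  · rw [S.darboux_inv_exp_w hlam f hx]; ring
  · rw [darbouxU, deriv_inv_div (S.solOn_exp_w hlam) hx (Real.exp_ne_zero _), darbouxU]
    ring

/-- The factorization identity at the ground state, read on the transformed side: transforming by
1/ψ and then by ψ multiplies by a difference of energies. -/
theorem opA_opAdag (hlam : lam ∈ S.params) (hlam' : lam + S.shift ∈ S.params) {e : ℝ}
    {f : ℝ → ℝ} (hf : SolOn S.dom (S.U (lam + S.shift)) e f) {x : ℝ} (hx : x ∈ S.dom) :
    S.opA lam (S.opAdag lam f) x = (e + S.E₁ lam) * f x := by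
  have h := darboux_inv_darboux (SolOn.inv S.isOpen_dom (S.solOn_exp_w hlam)
    fun _ _ => Real.exp_ne_zero _) (S.solOn_opAdag_aux hlam hlam' hf) hx
    (inv_ne_zero (Real.exp_ne_zero _))
  simp only [inv_inv] at h
  rw [S.darboux_exp_w hlam _ hx] at h
  have hE : darboux (fun t => (Real.exp (S.w lam t))⁻¹) f =ᶠ[𝓝 x]
      fun t => -S.opAdag lam f t := by
    filter_upwards [S.isOpen_dom.mem_nhds hx] with t ht using S.darboux_inv_exp_w hlam f ht
  rw [opA, hE.deriv_eq, hE.eq_of_nhds] at h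
  rw [opA]
  have h3 : deriv (fun t => -S.opAdag lam f t) x = -deriv (S.opAdag lam f) x := deriv.fun_neg
  rw [h3] at h
  linarith

theorem E_natCast (n : ℕ) (lam : P) :
    S.E n lam = ∑ s ∈ Finset.range n, S.E₁ (lam + s • S.shift) := rfl

theorem E_neg (n : ℕ) (lam : P) :
    S.E (-(n : ℤ) - 1) lam = -∑ s ∈ Finset.range (n + 1), S.E₁ (lam - (s + 1) • S.shift) := by
  have : (-(n : ℤ) - 1) = Int.negSucc n := by rw [Int.negSucc_eq]; ring
  rw [this]; rfl

theorem E_succ (n : ℕ) (lam : P) :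
    S.E ((n + 1 : ℕ) : ℤ) lam = S.E n (lam + S.shift) + S.E₁ lam := by
  rw [E_natCast, E_natCast, Finset.sum_range_succ']
  simp [succ_nsmul', add_assoc]

theorem E_neg_succ (n : ℕ) (lam : P) :
    S.E (-((n + 1 : ℕ) : ℤ) - 1) lam =
      S.E (-(n : ℤ) - 1) (lam - S.shift) - S.E₁ (lam - S.shift) := by
  have h : ∀ s : ℕ, lam - (s + 1 + 1) • S.shift = lam - S.shift - (s + 1) • S.shift := fun s => by
    rw [succ_nsmul S.shift (s + 1)]
    abel
  rw [E_neg, E_neg, Finset.sum_range_succ']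
  simp only [h, zero_add, one_smul]
  ring

theorem solOn_phi (n : ℕ) : ∀ {lam : P}, (∀ k ≤ n, lam + k • S.shift ∈ S.params) →
    SolOn S.dom (S.U lam) (S.E n lam) (S.phi n lam) := by
  induction n with
  | zero =>
    intro lam h
    have h0 := h 0 le_rfl
    rw [zero_smul, add_zero] at h0
    exact S.solOn_exp_w h0
  | succ n ih =>
    intro lam h
    have h0 := h 0 (Nat.zero_le _)
    have h1 := h 1 (by omega)
    rw [zero_smul, add_zero] at h0
    rw [one_smul] at h1
    have := ih (lam := lam + S.shift) fun k hk => by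
      have := h (k + 1) (by omega)
      rwa [succ_nsmul', ← add_assoc] at this
    rw [E_succ]
    exact S.solOn_opAdag h0 h1 this

/-- The lowering relation: `phi` is built by raising, and A A† acts on an eigenfunction as a scalar.
-/
theorem opA_phi (n : ℕ) {lam : P} (h : ∀ k ≤ n + 1, lam + k • S.shift ∈ S.params) {x : ℝ}
    (hx : x ∈ S.dom) :
    S.opA lam (S.phi (n + 1) lam) x = S.E ((n + 1 : ℕ) : ℤ) lam * S.phi n (lam + S.shift) x := by
  have h0 := h 0 (Nat.zero_le _)
  have h1 := h 1 (by omega)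
  rw [zero_smul, add_zero] at h0
  rw [one_smul] at h1
  have := S.solOn_phi n (lam := lam + S.shift) fun k hk => by
      have := h (k + 1) (by omega)
      rwa [succ_nsmul', ← add_assoc] at this
  rw [E_succ]
  exact S.opA_opAdag h0 h1 this hx

theorem solOn_pv (v : ℕ) : ∀ {lam : P}, lam ∈ S.params →
    (∀ k ≤ v, lam - (k + 1) • S.shift ∈ S.params) →
    SolOn S.dom (S.U lam) (S.E (-(v : ℤ) - 1) lam) (S.pv v lam) := by
  induction v with
  | zero =>
    intro lam hl h
    have h0 := h 0 le_rfl
    rw [zero_add, one_smul] at h0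
    have := S.solOn_inv_exp_w h0 (by rwa [sub_add_cancel])
    rw [sub_add_cancel] at this
    rw [E_neg]
    simpa [pv] using this
  | succ v ih =>
    intro lam hl h
    have h0 := h 0 (by omega)
    rw [zero_add, one_smul] at h0
    have := ih (lam := lam - S.shift) h0 fun k hk => by
      have := h (k + 1) (by omega)
      rwa [succ_nsmul', ← sub_sub] at this
    have := S.solOn_opA h0 (by rwa [sub_add_cancel]) this
    rw [sub_add_cancel] at this
    rw [E_neg_succ]
    exact this

theorem E_pos {n : ℕ} (hn : 0 < n) {lam : P} (h : ∀ k ≤ n, lam + k • S.shift ∈ S.params) :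
    0 < S.E n lam := by
  rw [E_natCast]
  refine Finset.sum_pos (fun s hs => ?_) (by simp; omega)
  have hs := Finset.mem_range.1 hs
  refine S.E₁_pos _ (h s hs.le) ?_
  have := h (s + 1) hs
  rwa [succ_nsmul, ← add_assoc] at this

/-- The eigenfunctions do not vanish on intervals. -/
theorem exists_phi_ne_zero (n : ℕ) : ∀ {lam : P}, (∀ k ≤ n, lam + k • S.shift ∈ S.params) →
    ∀ J ⊆ S.dom, IsOpen J → J.Nonempty → ∃ x ∈ J, S.phi n lam x ≠ 0 := by
  induction n with
  | zero =>
    intro lam _ J _ _ hne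
    obtain ⟨x, hx⟩ := hne
    exact ⟨x, hx, Real.exp_ne_zero _⟩
  | succ n ih =>
    intro lam h J hJ hJo hne
    obtain ⟨x, hx, hx0⟩ := ih (lam := lam + S.shift) (fun k hk => by
      have := h (k + 1) (by omega)
      rwa [succ_nsmul', ← add_assoc] at this) J hJ hJo hne
    by_contra! hz
    have hE : S.phi (n + 1) lam =ᶠ[𝓝 x] fun _ => 0 := by
      filter_upwards [hJo.mem_nhds hx] with t ht using hz t ht
    -- Lowering a function that vanishes near x would give a non-zero multiple of φ_n(x), since the
    -- energy is positive.
    have h1 := S.opA_phi n h (hJ hx)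
    rw [opA, hE.deriv_eq, hz x hx] at h1
    have h2 := (S.E_pos (Nat.succ_pos n) h).ne'
    simp only [deriv_const, mul_zero, sub_zero] at h1
    rcases mul_eq_zero.1 h1.symm with h | h
    · exact h2 h
    · exact hx0 h

end ShapeInvariantSystem

end

section

open Filter Set Topology
open scoped ContDiff

namespace ShapeInvariantSystem

variable {P : Type*} [AddCommGroup P] (S : ShapeInvariantSystem P) {μ : P} {K : ℕ}

/-! ### The ladder of systems between `μ` and `μ + K δ` -/

/-- The solution with index `k` of the system at `μ + j δ`: an eigenfunction for `j ≤ k`, a pseudo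
virtual state wavefunction for `k < j`. -/
def ladder (μ : P) (j k : ℕ) : ℝ → ℝ :=
  if k < j then S.pv (j - 1 - k) (μ + j • S.shift) else S.phi (k - j) (μ + j • S.shift)

theorem E_add (j n : ℕ) (μ : P) :
    S.E ((j + n : ℕ) : ℤ) μ = S.E j μ + S.E n (μ + j • S.shift) := by
  rw [E_natCast, E_natCast, E_natCast, Finset.sum_range_add]
  simp [add_smul, add_assoc]

/-- Both sides are minus the same sum of `E₁` over the rungs k, …, k + v, taken in opposite orders;
hence the reflection of the sum. -/
theorem E_neg_add (k v : ℕ) (μ : P) :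
    S.E (-(v : ℤ) - 1) (μ + (k + (v + 1)) • S.shift) =
      S.E k μ - S.E ((k + (v + 1) : ℕ) : ℤ) μ := by
  rw [E_add, E_neg, E_natCast _ (v + 1), ← Finset.sum_range_reflect]
  rw [sub_add_cancel_left, neg_inj]
  refine Finset.sum_congr rfl fun s hs => ?_
  have hs := Finset.mem_range.1 hs
  congr 1
  obtain ⟨t, rfl⟩ : ∃ t, v = s + t := ⟨v - s, by omega⟩
  have : s + t + 1 - 1 - s = t := by omega
  rw [this]
  simp only [add_smul, one_smul]
  abel

variable {S}

/-- The energy has the single form E(k) - E(j) on both sides of j = k, so eigenfunctions and pseudo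
virtual states need not be distinguished afterwards. -/
theorem solOn_ladder (hK : ∀ k ≤ K, μ + k • S.shift ∈ S.params) {j k : ℕ} (hj : j ≤ K)
    (hk : k ≤ K) :
    SolOn S.dom (S.U (μ + j • S.shift)) (S.E k μ - S.E j μ) (S.ladder μ j k) := by
  unfold ladder
  split_ifs with h
  · obtain ⟨v, rfl⟩ : ∃ v, j = k + (v + 1) := ⟨j - k - 1, by omega⟩
    have e : k + (v + 1) - 1 - k = v := by omega
    rw [e, ← E_neg_add]
    refine S.solOn_pv v (hK _ hj) fun i hi => ?_
    have := hK (k + (v - i)) (by omega)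
    convert this using 1
    obtain ⟨t, rfl⟩ : ∃ t, v = i + t := ⟨v - i, by omega⟩
    rw [Nat.add_sub_cancel_left]
    simp only [add_smul, one_smul]
    abel
  · obtain ⟨n, rfl⟩ : ∃ n, k = j + n := ⟨k - j, by omega⟩
    rw [E_add, add_sub_cancel_left, Nat.add_sub_cancel_left]
    refine S.solOn_phi n fun i hi => ?_
    have := hK (j + i) (by omega)
    rwa [add_smul, ← add_assoc] at this

theorem E_strictMono (hK : ∀ k ≤ K, μ + k • S.shift ∈ S.params) {j k : ℕ} (hjk : j < k)
    (hk : k ≤ K) : S.E j μ < S.E k μ := by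
  obtain ⟨n, rfl⟩ : ∃ n, k = j + n := ⟨k - j, by omega⟩
  rw [E_add]
  have := S.E_pos (n := n) (by omega) (lam := μ + j • S.shift) fun i hi => by
    have := hK (j + i) (by omega)
    rwa [add_smul, ← add_assoc] at this
  linarith

theorem E_ne (hK : ∀ k ≤ K, μ + k • S.shift ∈ S.params) {j k : ℕ} (hjk : j ≠ k)
    (hj : j ≤ K) (hk : k ≤ K) : S.E j μ ≠ S.E k μ := by
  rcases lt_or_gt_of_ne hjk with h | h
  · exact (E_strictMono hK h hk).ne
  · exact (E_strictMono hK h hj).ne'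

/-- For k < j the transform is the recursive definition of `pv`, with factor 1. For k > j it is the
lowering relation, with factor E(k) - E(j), non-zero because the energies are strictly increasing.
-/
theorem darboux_ladder (hK : ∀ k ≤ K, μ + k • S.shift ∈ S.params) {j : ℕ} (hj : j + 1 ≤ K) :
    ∃ c : ℕ → ℝ, (∀ k ≤ K, k ≠ j → c k ≠ 0) ∧ ∀ k ≤ K, k ≠ j → ∀ x ∈ S.dom,
      darboux (fun t => Real.exp (S.w (μ + j • S.shift) t)) (S.ladder μ j k) x =
        c k * S.ladder μ (j + 1) k x := by
  refine ⟨fun k => if k < j then 1 else S.E k μ - S.E j μ, fun k hk hkj => ?_,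
    fun k hk hkj x hx => ?_⟩
  · dsimp only
    split_ifs
    · exact one_ne_zero
    · exact sub_ne_zero.2 (E_ne hK hkj hk (by omega))
  · rw [S.darboux_exp_w (hK j (by omega)) _ hx]
    dsimp only
    rcases lt_or_gt_of_ne hkj with h | h
    · have e : j + 1 - 1 - k = (j - 1 - k) + 1 := by omega
      have e' : μ + (j + 1) • S.shift - S.shift = μ + j • S.shift := by
        rw [succ_nsmul]; abel
      rw [if_pos h, one_mul, ladder, ladder, if_pos h, if_pos (by omega), e, pv, e']
    · obtain ⟨n, rfl⟩ : ∃ n, k = j + (n + 1) := ⟨k - j - 1, by omega⟩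
      have e : j + (n + 1) - j = n + 1 := by omega
      have e' : j + (n + 1) - (j + 1) = n := by omega
      rw [if_neg (by omega), ladder, ladder, if_neg (by omega), if_neg (by omega), e, e', E_add,
        add_sub_cancel_left, succ_nsmul, ← add_assoc]
      refine S.opA_phi n (fun i hi => ?_) hx
      have := hK (j + i) (by omega)
      rwa [add_smul, ← add_assoc] at this

theorem ladder_self (μ : P) (j : ℕ) :
    S.ladder μ j j = fun t => Real.exp (S.w (μ + j • S.shift) t) := by
  rw [ladder, if_neg (lt_irrefl j), Nat.sub_self]; rfl

theorem ladder_succ_self (μ : P) (j : ℕ) :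
    S.ladder μ (j + 1) j = fun t => (Real.exp (S.w (μ + j • S.shift) t))⁻¹ := by
  have e' : μ + (j + 1) • S.shift - S.shift = μ + j • S.shift := by
    rw [succ_nsmul]; abel
  rw [ladder, if_pos (Nat.lt_succ_self j), Nat.add_sub_cancel, Nat.sub_self, pv, e']

theorem wronskian_ladder_congr (hK : ∀ k ≤ K, μ + k • S.shift ∈ S.params) {j : ℕ} (hj : j + 1 ≤ K)
    {r : List ℕ} (hr : ∀ k ∈ r, k ≤ K ∧ k ≠ j) : ∃ c : ℝ, c ≠ 0 ∧ ∀ x ∈ S.dom,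
      wronskian (r.map fun k => darboux (fun t => Real.exp (S.w (μ + j • S.shift) t))
        (S.ladder μ j k)) x = c * wronskian (r.map (S.ladder μ (j + 1))) x := by
  obtain ⟨c, hc0, hc⟩ := darboux_ladder hK hj
  refine ⟨(r.map c).prod, ?_, fun x hx => ?_⟩
  · rw [Ne, List.prod_eq_zero_iff, List.mem_map]
    rintro ⟨k, hk, h⟩
    exact hc0 k (hr k hk).1 (hr k hk).2 h
  · rw [← wronskian_map_smul]
    refine wronskian_map_congr fun k hk => ?_
    filter_upwards [S.isOpen_dom.mem_nhds hx] with t ht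
    exact hc k (hr k hk).1 (hr k hk).2 t ht

/-- The ground state of rung j is among the seeds: Crum's reduction removes it. -/
theorem wronskian_ladder_cons (hK : ∀ k ≤ K, μ + k • S.shift ∈ S.params) {j : ℕ}
    (hj : j + 1 ≤ K) {r : List ℕ} (hr : ∀ k ∈ r, k ≤ K ∧ k ≠ j) : ∃ c : ℝ, c ≠ 0 ∧
      ∀ x ∈ S.dom, wronskian ((j :: r).map (S.ladder μ j)) x =
        c * Real.exp (S.w (μ + j • S.shift) x) * wronskian (r.map (S.ladder μ (j + 1))) x := by
  obtain ⟨c, hc0, hc⟩ := wronskian_ladder_congr hK hj hr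
  refine ⟨c, hc0, fun x hx => ?_⟩
  have h1 := (S.solOn_exp_w (hK j (by omega))).smooth x hx
  rw [List.map_cons, ladder_self, wronskian_cons h1 _ (Real.exp_ne_zero _), List.map_map]
  · rw [mul_comm c, mul_assoc, ← hc x hx]; rfl
  · intro f hf
    obtain ⟨k, hk, rfl⟩ := List.mem_map.1 hf
    exact (solOn_ladder hK (by omega) (hr k hk).1).smooth x hx

/-- The ground state of rung j is not among the seeds: the inverse reduction produces its
reciprocal, which is the solution with index j on the next rung. The extra factors E(k) - E(j) do
not vanish as k ≠ j. -/
theorem wronskian_ladder_succ_cons (hK : ∀ k ≤ K, μ + k • S.shift ∈ S.params) {j : ℕ}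
    (hj : j + 1 ≤ K) {r : List ℕ} (hr : ∀ k ∈ r, k ≤ K ∧ k ≠ j) : ∃ c : ℝ, c ≠ 0 ∧
      ∀ x ∈ S.dom, wronskian (r.map (S.ladder μ j)) x =
        c * Real.exp (S.w (μ + j • S.shift) x) *
          wronskian ((j :: r).map (S.ladder μ (j + 1))) x := by
  obtain ⟨c, hc0, hc⟩ := darboux_ladder hK hj
  -- The reciprocal ground state equals the new ladder function exactly, so its factor is 1; the
  -- others carry the constants of `darboux_ladder`.
  have hprod : ((j :: r).map fun k => if k = j then 1 else c k).prod ≠ 0 := by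
    rw [Ne, List.prod_eq_zero_iff, List.mem_map]
    rintro ⟨k, hk, h⟩
    by_cases hkj : k = j
    · simp [hkj] at h
    · rw [if_neg hkj] at h
      exact hc0 k (hr k ((List.mem_cons.1 hk).resolve_left hkj)).1 hkj h
  have hE : ((r.map fun k : ℕ => 0 - (S.E k μ - S.E j μ)).prod) ≠ 0 := by
    rw [Ne, List.prod_eq_zero_iff, List.mem_map]
    rintro ⟨k, hk, h⟩
    exact E_ne hK (hr k hk).2 (hr k hk).1 (by omega) (by linarith)
  refine ⟨(((j :: r).map fun k => if k = j then 1 else c k).prod) /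
    ((r.map fun k : ℕ => 0 - (S.E k μ - S.E j μ)).prod), div_ne_zero hprod hE, fun x hx => ?_⟩
  have key := wronskian_inv_cons S.isOpen_dom (S.solOn_exp_w (hK j (by omega)))
    (fun _ _ => Real.exp_ne_zero _) (l := r) (F := S.ladder μ j)
    (ε := fun k : ℕ => S.E k μ - S.E j μ) (fun k hk => solOn_ladder hK (by omega) (hr k hk).1) hx
  have e1 : wronskian ((fun t => (Real.exp (S.w (μ + j • S.shift) t))⁻¹) :: r.map fun k =>
      darboux (fun t => Real.exp (S.w (μ + j • S.shift) t)) (S.ladder μ j k)) x =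
      ((j :: r).map fun k => if k = j then 1 else c k).prod *
        wronskian ((j :: r).map (S.ladder μ (j + 1))) x := by
    rw [← wronskian_map_smul]
    have : ((fun t => (Real.exp (S.w (μ + j • S.shift) t))⁻¹) :: r.map fun k =>
        darboux (fun t => Real.exp (S.w (μ + j • S.shift) t)) (S.ladder μ j k)) =
        (j :: r).map fun k => if k = j then fun t => (Real.exp (S.w (μ + j • S.shift) t))⁻¹ else
          darboux (fun t => Real.exp (S.w (μ + j • S.shift) t)) (S.ladder μ j k) := by
      rw [List.map_cons, if_pos rfl]
      congr 1
      refine List.map_congr_left fun k hk => ?_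
      rw [if_neg (hr k hk).2]
    rw [this]
    refine wronskian_map_congr fun k hk => ?_
    filter_upwards [S.isOpen_dom.mem_nhds hx] with t ht
    by_cases hkj : k = j
    · subst hkj
      simp [ladder_succ_self]
    · rw [if_neg hkj, if_neg hkj]
      have := hr k ((List.mem_cons.1 hk).resolve_left hkj)
      exact hc k this.1 this.2 t ht
  rw [e1] at key
  have hx0 := Real.exp_ne_zero (S.w (μ + j • S.shift) x)
  field_simp
  field_simp at key
  linarith

/-- The indices of the seeds at `μ + j δ` attached to the index set `E`. -/
def seedIdx (E : List ℕ) (j : ℕ) : List ℕ :=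
  (List.range j).filter (fun m => m ∉ E) ++ E.filter (fun m => j ≤ m)

theorem seedIdx_succ_of_mem {E : List ℕ} (hE : E.Nodup) {j : ℕ} (hj : j ∈ E) :
    (seedIdx E j).Perm (j :: seedIdx E (j + 1)) := by
  refine (List.perm_ext_iff_of_nodup ?_ ?_).2 fun a => ?_
  · refine List.Nodup.append (List.nodup_range.filter _) (hE.filter _) fun a h1 h2 => ?_
    simp at h1 h2; omega
  · refine List.nodup_cons.2 ⟨by simp [seedIdx, hj], ?_⟩
    refine List.Nodup.append (List.nodup_range.filter _) (hE.filter _) fun a h1 h2 => ?_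
    simp at h1 h2; omega
  · by_cases ha : a = j
    · simp [seedIdx, ha, hj]
    · simp only [seedIdx, List.mem_append, List.mem_filter, List.mem_range, List.mem_cons, ha,
        false_or, decide_eq_true_eq, decide_not, Bool.not_eq_true', decide_eq_false_iff_not]
      constructor
      · rintro (h | h)
        · exact Or.inl ⟨by omega, h.2⟩
        · exact Or.inr ⟨h.1, by omega⟩
      · rintro (h | h)
        · exact Or.inl ⟨by omega, h.2⟩
        · exact Or.inr ⟨h.1, by omega⟩

theorem seedIdx_succ_of_notMem {E : List ℕ} (hE : E.Nodup) {j : ℕ} (hj : j ∉ E) :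
    (seedIdx E (j + 1)).Perm (j :: seedIdx E j) := by
  refine (List.perm_ext_iff_of_nodup ?_ ?_).2 fun a => ?_
  · refine List.Nodup.append (List.nodup_range.filter _) (hE.filter _) fun a h1 h2 => ?_
    simp at h1 h2; omega
  · refine List.nodup_cons.2 ⟨by simp [seedIdx, hj], ?_⟩
    refine List.Nodup.append (List.nodup_range.filter _) (hE.filter _) fun a h1 h2 => ?_
    simp at h1 h2; omega
  · by_cases ha : a = j
    · simp [seedIdx, ha, hj]
    · simp only [seedIdx, List.mem_append, List.mem_filter, List.mem_range, List.mem_cons, ha,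
        false_or, decide_eq_true_eq, decide_not, Bool.not_eq_true', decide_eq_false_iff_not]
      constructor
      · rintro (h | h)
        · exact Or.inl ⟨by omega, h.2⟩
        · exact Or.inr ⟨h.1, by omega⟩
      · rintro (h | h)
        · exact Or.inl ⟨by omega, h.2⟩
        · exact Or.inr ⟨h.1, by omega⟩

theorem seedIdx_le {E : List ℕ} (hE : ∀ e ∈ E, e ≤ K) {j : ℕ} (hj : j ≤ K + 1) :
    ∀ k ∈ seedIdx E j, k ≤ K := by
  intro k hk
  simp only [seedIdx, List.mem_append, List.mem_filter, List.mem_range] at hk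
  rcases hk with h | h
  · omega
  · exact hE k h.1

/-- One rung. Passing from j to j + 1 toggles the membership of j in the seed set, and both toggles
cost the same exponential factor. Reordering the seeds costs only a sign. -/
theorem wronskian_seedIdx_succ (hK : ∀ k ≤ K, μ + k • S.shift ∈ S.params) {E : List ℕ}
    (hE : E.Nodup) (hEK : ∀ e ∈ E, e ≤ K) {j : ℕ} (hj : j + 1 ≤ K) : ∃ c : ℝ, c ≠ 0 ∧
      ∀ x ∈ S.dom, wronskian ((seedIdx E j).map (S.ladder μ j)) x =
        c * Real.exp (S.w (μ + j • S.shift) x) *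
          wronskian ((seedIdx E (j + 1)).map (S.ladder μ (j + 1))) x := by
  by_cases hjE : j ∈ E
  · have hp := seedIdx_succ_of_mem hE hjE
    obtain ⟨c, hc0, hc⟩ := wronskian_perm (hp.map (S.ladder μ j))
    obtain ⟨c', hc0', hc'⟩ := wronskian_ladder_cons hK hj (r := seedIdx E (j + 1)) fun k hk =>
      ⟨seedIdx_le hEK (by omega) k hk, by rintro rfl; simp [seedIdx, hjE] at hk⟩
    refine ⟨c * c', mul_ne_zero hc0 hc0', fun x hx => ?_⟩
    rw [hc, hc' x hx]; ring
  · have hp := seedIdx_succ_of_notMem hE hjE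
    obtain ⟨c, hc0, hc⟩ := wronskian_perm (hp.symm.map (S.ladder μ (j + 1)))
    obtain ⟨c', hc0', hc'⟩ := wronskian_ladder_succ_cons hK hj (r := seedIdx E j) fun k hk =>
      ⟨seedIdx_le hEK (by omega) k hk, by rintro rfl; simp [seedIdx, hjE] at hk⟩
    refine ⟨c' * c, mul_ne_zero hc0' hc0, fun x hx => ?_⟩
    rw [hc' x hx, hc]; ring

theorem wronskian_seedIdx (hK : ∀ k ≤ K, μ + k • S.shift ∈ S.params) {E : List ℕ}
    (hE : E.Nodup) (hEK : ∀ e ∈ E, e ≤ K) {j : ℕ} (hj : j ≤ K) : ∃ c : ℝ, c ≠ 0 ∧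
      ∀ x ∈ S.dom, wronskian (E.map (S.ladder μ 0)) x =
        c * Real.exp (∑ i ∈ Finset.range j, S.w (μ + i • S.shift) x) *
          wronskian ((seedIdx E j).map (S.ladder μ j)) x := by
  induction j with
  | zero => exact ⟨1, one_ne_zero, fun x _ => by simp [seedIdx]⟩
  | succ j ih =>
    obtain ⟨c, hc0, hc⟩ := ih (by omega)
    obtain ⟨c', hc0', hc'⟩ := wronskian_seedIdx_succ hK hE hEK hj
    refine ⟨c * c', mul_ne_zero hc0 hc0', fun x hx => ?_⟩
    rw [hc x hx, hc' x hx, Finset.sum_range_succ, Real.exp_add]; ring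

end ShapeInvariantSystem

end

/-! ### The duality for shape-invariant systems, from the two ends of the ladder -/

section

open Filter Set Topology
open scoped ContDiff

theorem barD_nodup (N : ℕ) (d : List ℕ) : (barD N d).Nodup := List.nodup_range.filter _

theorem mem_barD {N : ℕ} {d : List ℕ} {m : ℕ} :
    m ∈ barD N d ↔ m ≤ N ∧ ∀ v ∈ d, N - v ≠ m := by
  simp [barD]

/-- Complementing twice in {0, …, N} returns the reflected indices N - v; d and this list may be
ordered differently, so only a permutation results. -/
theorem filter_notMem_barD_perm {N : ℕ} {d : List ℕ} (hd : d.Nodup) (hN : ∀ v ∈ d, v ≤ N) :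
    ((List.range (N + 1)).filter fun m => m ∉ barD N d).Perm (d.map fun v => N - v) := by
  refine (List.perm_ext_iff_of_nodup (List.nodup_range.filter _) ?_).2 fun a => ?_
  · refine List.Nodup.map_on (fun x hx y hy h => ?_) hd
    have := hN x hx
    have := hN y hy
    omega
  · simp only [List.mem_filter, List.mem_range, decide_eq_true_eq, mem_barD, List.mem_map,
      not_and, not_forall, not_not]
    constructor
    · rintro ⟨h1, h2⟩
      obtain ⟨v, hv, h⟩ := h2 (by omega)
      exact ⟨v, hv, h⟩
    · rintro ⟨v, hv, rfl⟩
      exact ⟨by omega, fun _ => ⟨v, hv, rfl⟩⟩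

namespace ShapeInvariantSystem

variable {P : Type*} [AddCommGroup P] {S : ShapeInvariantSystem P} {N : ℕ} {lam : P}

theorem barParam_add (S : ShapeInvariantSystem P) (N : ℕ) (lam : P) :
    S.toModel.barParam N lam + (N + 1) • S.shift = lam :=
  sub_add_cancel _ _

theorem ladder_zero (μ : P) (k : ℕ) : S.ladder μ 0 k = S.phi k μ := by
  simp [ladder]

theorem ladder_top_pv {v : ℕ} (hv : v ≤ N) :
    S.ladder (S.toModel.barParam N lam) (N + 1) (N - v) = S.pv v lam := by
  have e : N + 1 - 1 - (N - v) = v := by omega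
  rw [ladder, if_pos (by omega), e, barParam_add]

theorem ladder_top_phi (n : ℕ) :
    S.ladder (S.toModel.barParam N lam) (N + 1) (N + 1 + n) = S.phi n lam := by
  rw [ladder, if_neg (by omega), Nat.add_sub_cancel_left, barParam_add]

/-- The sum of the prepotentials between the two systems. -/
def sumW (S : ShapeInvariantSystem P) (N : ℕ) (lam : P) (x : ℝ) : ℝ :=
  ∑ i ∈ Finset.range (N + 1), S.w (S.toModel.barParam N lam + i • S.shift) x

/-- The core of the duality: the ladder is climbed through all N + 1 rungs, starting from the seed
set D̄. -/
theorem wronskian_seedsKA {d : List ℕ} (hd : d.Nodup) (hN : ∀ v ∈ d, v ≤ N)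
    (hK : ∀ k ≤ N + 1, S.toModel.barParam N lam + k • S.shift ∈ S.params) :
    ∃ c : ℝ, c ≠ 0 ∧ ∀ x ∈ S.dom, wronskian (S.toModel.seedsKA N lam d) x =
      c * Real.exp (S.sumW N lam x) * wronskian (S.toModel.seedsDP lam d) x := by
  set μ := S.toModel.barParam N lam with hμ
  have hlt : ∀ e ∈ barD N d, e ≤ N := fun e he => (mem_barD.1 he).1
  obtain ⟨c, hc0, hc⟩ := wronskian_seedIdx hK (barD_nodup N d)
    (fun e he => (hlt e he).trans (Nat.le_succ _)) (le_refl (N + 1))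
  -- All elements of D̄ are at most N, so none survives at the top and only the complement is left.
  have hidx : seedIdx (barD N d) (N + 1) = (List.range (N + 1)).filter fun m => m ∉ barD N d := by
    rw [seedIdx, List.append_right_eq_self, List.filter_eq_nil_iff]
    intro e he
    have := hlt e he
    simp; omega
  obtain ⟨c', hc0', hc'⟩ :=
    wronskian_perm ((filter_notMem_barD_perm hd hN).map (S.ladder μ (N + 1)))
  refine ⟨c * c', mul_ne_zero hc0 hc0', fun x hx => ?_⟩
  have e1 : (barD N d).map (S.ladder μ 0) = S.toModel.seedsKA N lam d :=
    List.map_congr_left fun k _ => ladder_zero μ k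
  have e2 : (d.map fun v => N - v).map (S.ladder μ (N + 1)) = S.toModel.seedsDP lam d := by
    rw [List.map_map]
    exact List.map_congr_left fun v hv => ladder_top_pv (hN v hv)
  rw [← e1, hc x hx, hidx, hc', e2, sumW]
  ring

/-- The additional index N + 1 + n is never passed by the ladder: it stays in the seed set and
arrives at the top as the eigenfunction φ_n, with the same exponential factor. -/
theorem wronskian_eigKA {d : List ℕ} {n : ℕ} (hd : d.Nodup) (hN : ∀ v ∈ d, v ≤ N)
    (hK : ∀ k ≤ N + 1 + n, S.toModel.barParam N lam + k • S.shift ∈ S.params) :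
    ∃ c : ℝ, c ≠ 0 ∧ ∀ x ∈ S.dom, wronskian (S.toModel.seedsKA N lam d ++
        [S.phi (N + 1 + n) (S.toModel.barParam N lam)]) x =
      c * Real.exp (S.sumW N lam x) * wronskian (S.toModel.seedsDP lam d ++ [S.phi n lam]) x := by
  set μ := S.toModel.barParam N lam with hμ
  have hlt : ∀ e ∈ barD N d, e ≤ N := fun e he => (mem_barD.1 he).1
  have hnd : (barD N d ++ [N + 1 + n]).Nodup := by
    refine List.Nodup.append (barD_nodup N d) (List.nodup_singleton _) fun a h1 h2 => ?_
    have := hlt a h1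
    simp at h2; omega
  obtain ⟨c, hc0, hc⟩ := wronskian_seedIdx hK hnd (fun e he => by
    rcases List.mem_append.1 he with h | h
    · exact (hlt e h).trans (by omega)
    · simp at h; omega) (j := N + 1) (by omega)
  have hidx : seedIdx (barD N d ++ [N + 1 + n]) (N + 1) =
      ((List.range (N + 1)).filter fun m => m ∉ barD N d) ++ [N + 1 + n] := by
    rw [seedIdx, List.filter_append]
    have h1 : (barD N d).filter (fun m => N + 1 ≤ m) = [] := by
      rw [List.filter_eq_nil_iff]
      intro e he
      have := hlt e he
      simp; omega
    have h2 : [N + 1 + n].filter (fun m => N + 1 ≤ m) = [N + 1 + n] := by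
      simp; omega
    rw [h1, h2, List.nil_append]
    congr 1
    refine List.filter_congr fun m hm => ?_
    have := List.mem_range.1 hm
    have : m ≠ N + 1 + n := by omega
    simp [this]
  obtain ⟨c', hc0', hc'⟩ := wronskian_perm
    (((filter_notMem_barD_perm hd hN).append_right [N + 1 + n]).map (S.ladder μ (N + 1)))
  refine ⟨c * c', mul_ne_zero hc0 hc0', fun x hx => ?_⟩
  have e1 : (barD N d ++ [N + 1 + n]).map (S.ladder μ 0) =
      S.toModel.seedsKA N lam d ++ [S.phi (N + 1 + n) μ] := by
    rw [List.map_append, List.map_singleton, ladder_zero]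
    congr 1
    exact List.map_congr_left fun k _ => ladder_zero μ k
  have e2 : ((d.map fun v => N - v) ++ [N + 1 + n]).map (S.ladder μ (N + 1)) =
      S.toModel.seedsDP lam d ++ [S.phi n lam] := by
    rw [List.map_append, List.map_singleton, ladder_top_phi, List.map_map]
    congr 1
    exact List.map_congr_left fun v hv => ladder_top_pv (hN v hv)
  rw [← e1, hc x hx, hidx, hc', e2, sumW]
  ring

theorem propOn_ratio {s : Set ℝ} {W₁ W₂ V₁ V₂ G : ℝ → ℝ} {c₁ c₂ : ℝ} (h₁ : c₁ ≠ 0) (h₂ : c₂ ≠ 0)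
    (hW : ∀ x ∈ s, W₁ x = c₁ * Real.exp (G x) * V₁ x)
    (hV : ∀ x ∈ s, W₂ x = c₂ * Real.exp (G x) * V₂ x) :
    PropOn s (fun x => V₁ x / V₂ x) (fun x => W₁ x / W₂ x) := by
  refine ⟨c₂ / c₁, div_ne_zero h₂ h₁, fun x hx => ?_⟩
  dsimp only
  rw [hW x hx, hV x hx]
  have := Real.exp_ne_zero (G x)
  -- Where the denominator vanishes both quotients are 0 by the convention for division by zero.
  by_cases h0 : V₂ x = 0
  · simp [h0]
  · field_simp

theorem contDiffAt_seedsDP {d : List ℕ} (hN : ∀ v ∈ d, v ≤ N)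
    (hK : ∀ k ≤ N + 1, S.toModel.barParam N lam + k • S.shift ∈ S.params) {x : ℝ}
    (hx : x ∈ S.dom) : ∀ f ∈ S.toModel.seedsDP lam d, ContDiffAt ℝ ∞ f x := by
  intro f hf
  obtain ⟨v, hv, rfl⟩ := List.mem_map.1 hf
  have hv := hN v hv
  have := (solOn_ladder hK (le_refl (N + 1)) (k := N - v) (by omega)).smooth x hx
  rwa [ladder_top_pv hv] at this

theorem iteratedDeriv_two (f : ℝ → ℝ) : iteratedDeriv 2 f = deriv (deriv f) := by
  rw [iteratedDeriv_succ, iteratedDeriv_one]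

@[simp]
theorem E_zero (lam : P) : S.E 0 lam = 0 := by
  change ∑ s ∈ Finset.range 0, _ = _
  simp

theorem U_barParam (hK : ∀ k ≤ N + 1, S.toModel.barParam N lam + k • S.shift ∈ S.params) {x : ℝ}
    (hx : x ∈ S.dom) : S.U lam x - S.E (-(N : ℤ) - 1) lam =
      S.U (S.toModel.barParam N lam) x - 2 * ∑ i ∈ Finset.range (N + 1),
        deriv (deriv (S.w (S.toModel.barParam N lam + i • S.shift))) x := by
  set μ := S.toModel.barParam N lam with hμ
  -- Each use of shape invariance exchanges an energy step for -2w''; summed from the bottom of the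
  -- ladder these telescope.
  have key : ∀ j ≤ N + 1, S.U (μ + j • S.shift) x + S.E j μ =
      S.U μ x - 2 * ∑ i ∈ Finset.range j, deriv (deriv (S.w (μ + i • S.shift))) x := by
    intro j
    induction j with
    | zero => intro _; simp
    | succ j ih =>
      intro hj
      have h1 := S.shape_invariance (μ + j • S.shift) (hK j (by omega))
        (by have := hK (j + 1) hj; rwa [succ_nsmul, ← add_assoc] at this) x hx
      have h2 := ih (by omega)
      rw [Finset.sum_range_succ, mul_add, ← sub_sub, ← h2, E_natCast, E_natCast,
        Finset.sum_range_succ]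
      simp only [U] at *
      rw [succ_nsmul, ← add_assoc μ]
      linarith
  have h := key (N + 1) le_rfl
  have hE := S.E_neg_add 0 N μ
  rw [zero_add, hμ, barParam_add] at hE
  rw [hμ, barParam_add, ← hμ] at h
  rw [← h, hE, ← hμ]
  simp

theorem potential_eq {d : List ℕ} (hd : d.Nodup) (hN : ∀ v ∈ d, v ≤ N)
    (hK : ∀ k ≤ N + 1, S.toModel.barParam N lam + k • S.shift ∈ S.params) {x : ℝ}
    (hx : x ∈ S.toModel.regularSet lam d) :
    S.toModel.potDP lam d x - S.E (-(N : ℤ) - 1) lam = S.toModel.potKA N lam d x := by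
  obtain ⟨hxd, hx0⟩ := hx
  have hxd : x ∈ S.dom := hxd
  obtain ⟨c, hc0, hc⟩ := wronskian_seedsKA hd hN hK
  set V := wronskian (S.toModel.seedsDP lam d) with hV
  have hVs : ContDiffAt ℝ ∞ V x := contDiffAt_wronskian (contDiffAt_seedsDP hN hK hxd)
  have hlog : ContDiffAt ℝ ∞ (fun y => Real.log |V y|) x := by
    simp only [Real.log_abs]
    exact hVs.log hx0
  have hw : ∀ i ∈ Finset.range (N + 1),
      ContDiffAt ℝ ∞ (S.w (S.toModel.barParam N lam + i • S.shift)) x := fun i hi =>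
    S.contDiffAt_w (hK i (Finset.mem_range.1 hi).le) hxd
  have hsum : ContDiffAt ℝ ∞ (S.sumW N lam) x := by
    unfold sumW
    exact ContDiffAt.sum hw
  -- Taking logarithms separates the constant, the sum of prepotentials and the other Wronskian; the
  -- second derivative kills the constant.
  have hE : (fun y => Real.log |wronskian (S.toModel.seedsKA N lam d) y|) =ᶠ[𝓝 x]
      fun y => Real.log |c| + (S.sumW N lam y + Real.log |V y|) := by
    filter_upwards [S.isOpen_dom.mem_nhds hxd, hVs.continuousAt.eventually_ne hx0] with y hy hy0
    rw [hc y hy, abs_mul, abs_mul, Real.log_mul, Real.log_mul, Real.abs_exp, Real.log_exp,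
      add_assoc]
    · exact abs_ne_zero.2 hc0
    · exact abs_ne_zero.2 (Real.exp_ne_zero _)
    · exact mul_ne_zero (abs_ne_zero.2 hc0) (abs_ne_zero.2 (Real.exp_ne_zero _))
    · exact abs_ne_zero.2 hy0
  have h2 : ∀ {f : ℝ → ℝ}, ContDiffAt ℝ ∞ f x → ContDiffAt ℝ (2 : ℕ) f x :=
    fun h => contDiffAt_infty.1 h 2
  have h3 : iteratedDeriv 2 (fun y => Real.log |wronskian (S.toModel.seedsKA N lam d) y|) x =
      iteratedDeriv 2 (S.sumW N lam) x + iteratedDeriv 2 (fun y => Real.log |V y|) x := by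
    rw [hE.iteratedDeriv_eq, iteratedDeriv_const_add (by norm_num)]
    exact iteratedDeriv_fun_add (h2 hsum) (h2 hlog)
  have h4 : iteratedDeriv 2 (S.sumW N lam) x = ∑ i ∈ Finset.range (N + 1),
      deriv (deriv (S.w (S.toModel.barParam N lam + i • S.shift))) x := by
    unfold sumW
    rw [iteratedDeriv_fun_sum fun i hi => h2 (hw i hi)]
    simp only [iteratedDeriv_two]
  have h5 := U_barParam hK hxd
  rw [Model.potKA, Model.potDP, darbouxPotential, darbouxPotential, h3, h4]
  change S.U lam x - 2 * _ - _ = S.U _ x - _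
  linarith

/-- Proportionality transfers the claim to the Wronskian of the eigenfunctions φ_e, which have
distinct energies and do not vanish on open sets. -/
theorem dense_regularSet {d : List ℕ} (hd : d.Nodup) (hN : ∀ v ∈ d, v ≤ N)
    (hK : ∀ k ≤ N + 1, S.toModel.barParam N lam + k • S.shift ∈ S.params) :
    S.dom ⊆ closure (S.toModel.regularSet lam d) := by
  intro x hx
  rw [mem_closure_iff]
  intro O hO hxO
  obtain ⟨c, hc0, hc⟩ := wronskian_seedsKA hd hN hK
  have hlt : ∀ e ∈ barD N d, e ≤ N := fun e he => (mem_barD.1 he).1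
  have hsol : ∀ k ≤ N + 1, SolOn S.dom (S.U (S.toModel.barParam N lam))
      (S.E k (S.toModel.barParam N lam)) (S.phi k (S.toModel.barParam N lam)) := fun k hk =>
    S.solOn_phi k fun i hi => hK i (hi.trans hk)
  obtain ⟨y, hy, hy0⟩ := exists_wronskian_ne_zero (l := barD N d) (I := O ∩ S.dom)
    (F := fun e => S.phi e (S.toModel.barParam N lam))
    (ε := fun e => S.E (e : ℕ) (S.toModel.barParam N lam)) (hO.inter S.isOpen_dom) ⟨x, hxO, hx⟩
    (fun e he => (hsol e ((hlt e he).trans (Nat.le_succ _))).mono inter_subset_right)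
    ((barD_nodup N d).pairwise_of_forall_ne fun a ha b hb hab =>
      E_ne hK hab ((hlt a ha).trans (Nat.le_succ _)) ((hlt b hb).trans (Nat.le_succ _)))
    (fun e he J hJ => S.exists_phi_ne_zero e (fun k hk => hK k (hk.trans
      ((hlt e he).trans (Nat.le_succ _)))) J (hJ.trans inter_subset_right))
  refine ⟨y, hy.1, hy.2, fun h => hy0 ?_⟩
  have := hc y hy.2
  rw [h, mul_zero] at this
  exact this

theorem equivalent {d : List ℕ} (hd : d.Nodup) (hN : ∀ v ∈ d, v ≤ N)
    (hK : ∀ k ≤ N + 1, S.toModel.barParam N lam + k • S.shift ∈ S.params) :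
    S.toModel.Equivalent N lam d (S.levels N lam) := by
  obtain ⟨c, hc0, hc⟩ := wronskian_seedsKA hd hN hK
  have hreg : ∀ x ∈ S.toModel.regularSet lam d, x ∈ S.dom := fun x hx => hx.1
  have hE0 : S.E (-(N : ℤ) - 1) lam = -S.E ((N + 1 : ℕ) : ℤ) (S.toModel.barParam N lam) := by
    have := S.E_neg_add 0 N (S.toModel.barParam N lam)
    rw [zero_add, barParam_add] at this
    rw [this]
    simp
  refine ⟨fun x hx => ?_, dense_regularSet hd hN hK, fun x hx => potential_eq hd hN hK hx,
    fun n hn => ⟨?_, ?_⟩, fun v hv => ⟨?_, ?_⟩⟩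
  · rw [hc x hx]
    simp [hc0, Real.exp_ne_zero]
  · obtain ⟨c', hc0', hc'⟩ := wronskian_eigKA (n := n) hd hN hn
    exact propOn_ratio hc0' hc0 (fun x hx => hc' x (hreg x hx)) (fun x hx => hc x (hreg x hx))
  · change S.E n lam - S.E (-(N : ℤ) - 1) lam = S.E ((N : ℤ) + 1 + n) (S.toModel.barParam N lam)
    have := S.E_add (N + 1) n (S.toModel.barParam N lam)
    rw [barParam_add] at this
    push_cast at this hE0
    rw [this, hE0]
    ring
  · obtain ⟨c', hc0', hc'⟩ := wronskian_seedsKA (d := d.erase v) (hd.erase v)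
      (fun u hu => hN u (List.mem_of_mem_erase hu)) hK
    exact propOn_ratio hc0' hc0 (fun x hx => hc' x (hreg x hx)) (fun x hx => hc x (hreg x hx))
  · change S.E (-(v : ℤ) - 1) lam - S.E (-(N : ℤ) - 1) lam =
      S.E ((N : ℤ) - v) (S.toModel.barParam N lam)
    have hvN := hN v hv
    obtain ⟨k, rfl⟩ : ∃ k, N = k + v := ⟨N - v, by omega⟩
    have := S.E_neg_add k v (S.toModel.barParam (k + v) lam)
    rw [← add_assoc k v 1, barParam_add] at this
    rw [this, hE0]
    push_cast
    rw [add_sub_cancel_right]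
    ring

end ShapeInvariantSystem

end

section

open Filter Set Topology
open scoped ContDiff

/-! ### Models that agree with a shape-invariant system up to normalization -/

/-- The model `M` agrees with the shape-invariant system `S`, up to the normalization of the
wave functions. -/
structure Model.Matches {P : Type*} [AddCommGroup P] (M : Model P) (S : ShapeInvariantSystem P) :
    Prop where
  dom : M.dom = S.dom
  shift : M.shift = S.shift
  U : ∀ lam, ∀ x ∈ S.dom, M.U lam x = S.U lam x
  E : ∀ (n : ℤ) (lam : P), M.E n lam = S.E n lam
  phi : ∀ n lam, ∃ c : ℝ, c ≠ 0 ∧ ∀ x ∈ S.dom, M.phi n lam x = c * S.phi n lam x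
  pv : ∀ n lam, ∃ c : ℝ, c ≠ 0 ∧ ∀ x ∈ S.dom, M.pv n lam x = c * S.pv n lam x

theorem wronskian_map_propOn {α : Type*} {I : Set ℝ} (hI : IsOpen I) {l : List α}
    {F G : α → ℝ → ℝ} (h : ∀ a ∈ l, ∃ c : ℝ, c ≠ 0 ∧ ∀ x ∈ I, F a x = c * G a x) :
    ∃ c : ℝ, c ≠ 0 ∧ ∀ x ∈ I, wronskian (l.map F) x = c * wronskian (l.map G) x := by
  classical
  choose! c hc0 hc using h
  refine ⟨(l.map c).prod, ?_, fun x hx => ?_⟩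
  · rw [Ne, List.prod_eq_zero_iff, List.mem_map]
    rintro ⟨k, hk, h⟩
    exact hc0 k hk h
  · rw [← wronskian_map_smul]
    refine wronskian_map_congr fun k hk => ?_
    filter_upwards [hI.mem_nhds hx] with t ht using hc k hk t ht

theorem propOn_div {s : Set ℝ} {W₁ W₂ V₁ V₂ : ℝ → ℝ} {c₁ c₂ : ℝ} (h₁ : c₁ ≠ 0) (h₂ : c₂ ≠ 0)
    (hW : ∀ x ∈ s, W₁ x = c₁ * V₁ x) (hV : ∀ x ∈ s, W₂ x = c₂ * V₂ x) :
    PropOn s (fun x => W₁ x / W₂ x) (fun x => V₁ x / V₂ x) := by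
  refine ⟨c₁ / c₂, div_ne_zero h₁ h₂, fun x hx => ?_⟩
  dsimp only
  rw [hW x hx, hV x hx]
  by_cases h0 : V₂ x = 0
  · simp [h0]
  · field_simp

theorem PropOn.trans {s : Set ℝ} {f g h : ℝ → ℝ} (h₁ : PropOn s f g) (h₂ : PropOn s g h) :
    PropOn s f h := by
  obtain ⟨c, hc, h₁⟩ := h₁
  obtain ⟨c', hc', h₂⟩ := h₂
  exact ⟨c * c', mul_ne_zero hc hc', fun x hx => by rw [h₁ x hx, h₂ x hx, mul_assoc]⟩

theorem PropOn.symm {s : Set ℝ} {f g : ℝ → ℝ} (h₁ : PropOn s f g) : PropOn s g f := by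
  obtain ⟨c, hc, h₁⟩ := h₁
  exact ⟨c⁻¹, inv_ne_zero hc, fun x hx => by rw [h₁ x hx, inv_mul_cancel_left₀ hc]⟩

/-- A constant factor of the Wronskian does not change the Darboux transformed potential. -/
theorem darbouxPotential_congr {I : Set ℝ} (hI : IsOpen I) {U V : ℝ → ℝ} {l l' : List (ℝ → ℝ)}
    {c : ℝ} (hc0 : c ≠ 0) (hUV : ∀ x ∈ I, U x = V x)
    (hc : ∀ x ∈ I, wronskian l x = c * wronskian l' x) {x : ℝ} (hx : x ∈ I)
    (hl' : ContinuousAt (wronskian l') x) (h0 : wronskian l' x ≠ 0) :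
    darbouxPotential U l x = darbouxPotential V l' x := by
  rw [darbouxPotential, darbouxPotential, hUV x hx]
  have hE : (fun y => Real.log |wronskian l y|) =ᶠ[𝓝 x]
      fun y => Real.log |c| + Real.log |wronskian l' y| := by
    filter_upwards [hI.mem_nhds hx, hl'.eventually_ne h0] with y hy hy0
    rw [hc y hy, abs_mul, Real.log_mul (abs_ne_zero.2 hc0) (abs_ne_zero.2 hy0)]
  rw [hE.iteratedDeriv_eq, iteratedDeriv_const_add (by norm_num)]

namespace Model.Matches

variable {P : Type*} [AddCommGroup P] {M : Model P} {S : ShapeInvariantSystem P}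

theorem barParam (h : M.Matches S) (N : ℕ) (lam : P) :
    M.barParam N lam = S.toModel.barParam N lam := by
  simp only [Model.barParam, h.shift]; rfl

theorem seedsDP (h : M.Matches S) (lam : P) (d : List ℕ) : ∃ c : ℝ, c ≠ 0 ∧ ∀ x ∈ S.dom,
    wronskian (M.seedsDP lam d) x = c * wronskian (S.toModel.seedsDP lam d) x :=
  wronskian_map_propOn S.isOpen_dom fun v _ => h.pv v lam

theorem seedsKA (h : M.Matches S) (N : ℕ) (lam : P) (d : List ℕ) : ∃ c : ℝ, c ≠ 0 ∧ ∀ x ∈ S.dom,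
    wronskian (M.seedsKA N lam d) x = c * wronskian (S.toModel.seedsKA N lam d) x := by
  simp only [Model.seedsKA, h.barParam]
  exact wronskian_map_propOn S.isOpen_dom fun v _ => h.phi v _

theorem eigDP (h : M.Matches S) (lam : P) (d : List ℕ) (n : ℕ) : ∃ c : ℝ, c ≠ 0 ∧ ∀ x ∈ S.dom,
    wronskian (M.seedsDP lam d ++ [M.phi n lam]) x =
      c * wronskian (S.toModel.seedsDP lam d ++ [S.phi n lam]) x := by
  -- Two kinds of functions occur in one list; an optional index puts them into a single family.
  have := wronskian_map_propOn S.isOpen_dom (l := d.map some ++ [none])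
    (F := fun a => a.elim (M.phi n lam) fun v => M.pv v lam)
    (G := fun a => a.elim (S.phi n lam) fun v => S.pv v lam) (fun a _ => by
      cases a with
      | none => exact h.phi n lam
      | some v => exact h.pv v lam)
  simpa [Model.seedsDP, ShapeInvariantSystem.toModel, Function.comp_def] using this

theorem eigKA (h : M.Matches S) (N : ℕ) (lam : P) (d : List ℕ) (n : ℕ) : ∃ c : ℝ, c ≠ 0 ∧
    ∀ x ∈ S.dom, wronskian (M.seedsKA N lam d ++ [M.phi n (M.barParam N lam)]) x =
      c * wronskian (S.toModel.seedsKA N lam d ++ [S.phi n (S.toModel.barParam N lam)]) x := by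
  simp only [Model.seedsKA, h.barParam]
  have := wronskian_map_propOn S.isOpen_dom (l := barD N d ++ [n])
    (F := fun a => M.phi a (S.toModel.barParam N lam))
    (G := fun a => S.phi a (S.toModel.barParam N lam)) fun a _ => h.phi a _
  simpa [ShapeInvariantSystem.toModel] using this

theorem regularSet (h : M.Matches S) (lam : P) (d : List ℕ) :
    M.regularSet lam d = S.toModel.regularSet lam d := by
  obtain ⟨c, hc0, hc⟩ := h.seedsDP lam d
  ext x
  simp only [Model.regularSet, h.dom, mem_ofPred_eq]
  refine and_congr_right fun hx => ?_
  rw [hc x hx]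
  simp [hc0]

theorem potDP (h : M.Matches S) {lam : P} {d : List ℕ} {x : ℝ}
    (hs : ∀ f ∈ S.toModel.seedsDP lam d, ContDiffAt ℝ ∞ f x)
    (hx : x ∈ S.toModel.regularSet lam d) : M.potDP lam d x = S.toModel.potDP lam d x := by
  obtain ⟨c, hc0, hc⟩ := h.seedsDP lam d
  exact darbouxPotential_congr S.isOpen_dom hc0 (h.U lam) hc hx.1
    (contDiffAt_wronskian hs).continuousAt hx.2

theorem equivalent (h : M.Matches S) {N : ℕ} {lam : P} {d : List ℕ} (hd : d.Nodup)
    (hN : ∀ v ∈ d, v ≤ N)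
    (hK : ∀ k : ℕ, S.toModel.barParam N lam + k • S.shift ∈ S.params) :
    M.Equivalent N lam d Set.univ := by
  have hK' : ∀ k ≤ N + 1, S.toModel.barParam N lam + k • S.shift ∈ S.params := fun k _ => hK k
  obtain ⟨h1, h2, h3, h4, h5⟩ := ShapeInvariantSystem.equivalent hd hN hK'
  obtain ⟨cD, hcD0, hcD⟩ := h.seedsDP lam d
  obtain ⟨cK, hcK0, hcK⟩ := h.seedsKA N lam d
  have hreg : ∀ x ∈ S.toModel.regularSet lam d, x ∈ S.dom := fun x hx => hx.1
  have hsol : ∀ (k : ℕ) (x : ℝ), x ∈ S.dom →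
      ContDiffAt ℝ ∞ (S.phi k (S.toModel.barParam N lam)) x := fun k x hx =>
    (S.solOn_phi k fun i _ => hK i).smooth x hx
  refine ⟨fun x hx => ?_, ?_, fun x hx => ?_, fun n _ => ⟨?_, ?_⟩, fun v hv => ⟨?_, ?_⟩⟩
  · rw [h.dom] at hx
    rw [hcD x hx, hcK x hx]
    simpa [hcD0, hcK0] using h1 x hx
  · rw [h.regularSet, h.dom]
    exact h2
  · rw [h.regularSet] at hx
    have hs := ShapeInvariantSystem.contDiffAt_seedsDP hN hK' (hreg x hx)
    have e1 := h3 x hx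
    rw [h.potDP hs hx, h.E]
    refine e1.trans ?_
    symm
    refine darbouxPotential_congr S.isOpen_dom hcK0 (fun y hy => ?_) hcK hx.1
      (contDiffAt_wronskian fun f hf => ?_).continuousAt fun h0 => hx.2 ((h1 x hx.1).2 h0)
    · rw [h.barParam]; exact h.U _ y hy
    · obtain ⟨e, _, rfl⟩ := List.mem_map.1 hf
      exact hsol e x hx.1
  · obtain ⟨c₁, hc₁0, hc₁⟩ := h.eigDP lam d n
    obtain ⟨c₂, hc₂0, hc₂⟩ := h.eigKA N lam d (N + 1 + n)
    rw [h.regularSet]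
    have a1 := propOn_div hc₁0 hcD0 (fun x hx => hc₁ x (hreg x hx)) fun x hx => hcD x (hreg x hx)
    have a2 := propOn_div hc₂0 hcK0 (fun x hx => hc₂ x (hreg x hx)) fun x hx => hcK x (hreg x hx)
    exact (a1.trans (h4 n fun k _ => hK k).1).trans a2.symm
  · rw [h.E, h.E, h.E, h.barParam]
    exact (h4 n fun k _ => hK k).2
  · obtain ⟨c₁, hc₁0, hc₁⟩ := h.seedsDP lam (d.erase v)
    obtain ⟨c₂, hc₂0, hc₂⟩ := h.seedsKA N lam (d.erase v)
    rw [h.regularSet]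
    have a1 := propOn_div hc₁0 hcD0 (fun x hx => hc₁ x (hreg x hx)) fun x hx => hcD x (hreg x hx)
    have a2 := propOn_div hc₂0 hcK0 (fun x hx => hc₂ x (hreg x hx)) fun x hx => hcK x (hreg x hx)
    exact (a1.trans (h5 v hv).1).trans a2.symm
  · rw [h.E, h.E, h.E, h.barParam]
    exact (h5 v hv).2

end Model.Matches

theorem ShapeInvariantSystem.opAdag_congr {P : Type*} [AddCommGroup P] (S : ShapeInvariantSystem P)
    (lam : P) {f g : ℝ → ℝ} {c : ℝ} (h : ∀ x ∈ S.dom, f x = c * g x) {x : ℝ} (hx : x ∈ S.dom) :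
    S.opAdag lam f x = c * S.opAdag lam g x := by
  have hE : f =ᶠ[𝓝 x] fun y => c * g y := by
    filter_upwards [S.isOpen_dom.mem_nhds hx] with y hy using h y hy
  rw [opAdag, opAdag, hE.deriv_eq, deriv_const_mul_field c, h x hx]
  ring

theorem ShapeInvariantSystem.opA_congr {P : Type*} [AddCommGroup P] (S : ShapeInvariantSystem P)
    (lam : P) {f g : ℝ → ℝ} {c : ℝ} (h : ∀ x ∈ S.dom, f x = c * g x) {x : ℝ} (hx : x ∈ S.dom) :
    S.opA lam f x = c * S.opA lam g x := by
  have hE : f =ᶠ[𝓝 x] fun y => c * g y := by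
    filter_upwards [S.isOpen_dom.mem_nhds hx] with y hy using h y hy
  rw [opA, opA, hE.deriv_eq, deriv_const_mul_field c, h x hx]
  ring

/-- The operators are linear, so first order ladder relations that hold up to constants propagate by
induction to all levels. -/
theorem Model.matches_of_shift {P : Type*} [AddCommGroup P] {M : Model P}
    {S : ShapeInvariantSystem P} (dom : M.dom = S.dom) (shift : M.shift = S.shift)
    (U : ∀ lam, ∀ x ∈ S.dom, M.U lam x = S.U lam x)
    (E : ∀ (n : ℤ) (lam : P), M.E n lam = S.E n lam)
    (phi_zero : ∀ lam, ∀ x ∈ S.dom, M.phi 0 lam x = Real.exp (S.w lam x))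
    (phi_succ : ∀ n lam, ∃ c : ℝ, c ≠ 0 ∧ ∀ x ∈ S.dom,
      M.phi (n + 1) lam x = c * S.opAdag lam (M.phi n (lam + S.shift)) x)
    (pv_zero : ∀ lam, ∀ x ∈ S.dom, M.pv 0 lam x = (Real.exp (S.w (lam - S.shift) x))⁻¹)
    (pv_succ : ∀ n lam, ∃ c : ℝ, c ≠ 0 ∧ ∀ x ∈ S.dom,
      M.pv (n + 1) lam x = c * S.opA (lam - S.shift) (M.pv n (lam - S.shift)) x) :
    M.Matches S := by
  refine ⟨dom, shift, U, E, fun n => ?_, fun n => ?_⟩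
  · induction n with
    | zero => exact fun lam => ⟨1, one_ne_zero, fun x hx => by rw [one_mul, phi_zero lam x hx]; rfl⟩
    | succ n ih =>
      intro lam
      obtain ⟨c, hc0, hc⟩ := ih (lam + S.shift)
      obtain ⟨c', hc0', hc'⟩ := phi_succ n lam
      refine ⟨c' * c, mul_ne_zero hc0' hc0, fun x hx => ?_⟩
      rw [hc' x hx, S.opAdag_congr lam hc hx, mul_assoc]; rfl
  · induction n with
    | zero => exact fun lam => ⟨1, one_ne_zero, fun x hx => by rw [one_mul, pv_zero lam x hx]; rfl⟩
    | succ n ih =>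
      intro lam
      obtain ⟨c, hc0, hc⟩ := ih (lam - S.shift)
      obtain ⟨c', hc0', hc'⟩ := pv_succ n lam
      refine ⟨c' * c, mul_ne_zero hc0' hc0, fun x hx => ?_⟩
      rw [hc' x hx, S.opA_congr _ hc hx, mul_assoc]; rfl

end

/-! ### The harmonic oscillator as a shape-invariant system -/

section

open Filter Set Topology
open scoped ContDiff

open Polynomial in
-- Padding with zeros frees the summation range from n, so that the sums for consecutive degrees can
-- be compared termwise.
theorem hermiteH_eq (n K : ℕ) (hK : n / 2 < K) : hermiteH n = ∑ k ∈ Finset.range K,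
    if 2 * k ≤ n then C ((-1) ^ k * (n.factorial : ℝ) / (k.factorial * (n - 2 * k).factorial)) *
      (C 2 * X) ^ (n - 2 * k) else 0 := by
  have hsub : Finset.range (n / 2 + 1) ⊆ Finset.range K := Finset.range_subset_range.2 hK
  rw [← Finset.sum_subset hsub, hermiteH]
  · refine Finset.sum_congr rfl fun k hk => ?_
    have := Finset.mem_range.1 hk
    rw [if_pos (by omega)]
  · intro k _ hk
    have := Finset.mem_range.not.1 hk
    rw [if_neg (by omega)]

open Polynomial in
/-- `H_{n+1} = 2 X H_n - H_n'`. -/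
theorem hermiteH_succ (n : ℕ) : hermiteH (n + 1) = C 2 * X * hermiteH n - derivative (hermiteH n) := by
  rw [hermiteH_eq (n + 1) (n + 2) (by omega), Finset.sum_range_succ']
  conv_rhs => rw [hermiteH_eq n (n + 2) (by omega)]
  -- The derivative of the k-th term has the degree of the (k+1)-st term of the other two sums. It
  -- is therefore summed over one term fewer, and the others are split at k = 0.
  have h2 := hermiteH_eq n (n + 1) (by omega)
  rw [hermiteH_eq n (n + 2) (by omega)] at h2
  conv_rhs =>
    rw [h2, derivative_sum, ← h2, Finset.sum_range_succ', mul_add, Finset.mul_sum,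
      add_sub_right_comm, ← Finset.sum_sub_distrib]
  congr 1
  · refine Finset.sum_congr rfl fun k _ => ?_
    by_cases h1 : 2 * k ≤ n
    · rw [if_pos h1]
      obtain ⟨m, rfl⟩ := Nat.exists_eq_add_of_le h1
      have e1 : 2 * k + m - 2 * k = m := by omega
      have hk := Nat.factorial_ne_zero k
      have hf : ((2 * k + m + 1).factorial : ℝ) = (2 * k + m + 1) * (2 * k + m).factorial := by
        rw [Nat.factorial_succ]; push_cast; ring
      have hkf : ((k + 1).factorial : ℝ) = (k + 1) * k.factorial := by
        rw [Nat.factorial_succ]; push_cast; ring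
      have hk0 : (k.factorial : ℝ) ≠ 0 := by exact_mod_cast hk
      have hk1 : (k : ℝ) + 1 ≠ 0 := by positivity
      rw [e1]
      -- Here m = n - 2k. For m = 0 nothing of the next degree is left, for m = 1 only H_{n+1} and
      -- the derivative contribute, for m ≥ 2 all three do.
      match m with
      | 0 =>
        rw [if_neg (by omega), if_neg (by omega)]
        simp
      | 1 =>
        have e2 : 2 * k + 1 + 1 - 2 * (k + 1) = 0 := by omega
        rw [if_pos (by omega), if_neg (by omega), e2, hf, hkf]
        simp only [pow_zero, pow_one, mul_one, mul_zero, zero_sub, derivative_mul, derivative_C,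
          derivative_X, zero_mul, zero_add, Nat.factorial_zero, Nat.factorial_one, Nat.cast_one]
        rw [← C_mul, ← C_neg]
        congr 1
        field_simp
        ring
      | m + 2 =>
        have e2 : 2 * k + (m + 2) + 1 - 2 * (k + 1) = m + 1 := by omega
        have e3 : 2 * k + (m + 2) - 2 * (k + 1) = m := by omega
        have hm2 : ((m + 2).factorial : ℝ) = (m + 2) * ((m + 1) * m.factorial) := by
          rw [Nat.factorial_succ, Nat.factorial_succ]; push_cast; ring
        have hm1 : ((m + 1).factorial : ℝ) = (m + 1) * m.factorial := by
          rw [Nat.factorial_succ]; push_cast; ring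
        have hm0 : (m.factorial : ℝ) ≠ 0 := by exact_mod_cast Nat.factorial_ne_zero m
        have h1' : (m : ℝ) + 1 ≠ 0 := by positivity
        have h2' : (m : ℝ) + 2 ≠ 0 := by positivity
        rw [if_pos (by omega), if_pos (by omega), e2, e3, hf, hkf, hm2, hm1, derivative_C_mul,
          derivative_pow, derivative_C_mul, derivative_X]
        have e4 : m + 2 - 1 = m + 1 := by omega
        rw [e4, pow_succ (C (2 : ℝ) * X) m]
        generalize ((2 * k + (m + 2)).factorial : ℝ) = F
        have key : (-1 : ℝ) ^ (k + 1) * ((2 * k + ((m + 2 : ℕ) : ℝ) + 1) * F) /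
            ((k + 1) * k.factorial * ((m + 1) * m.factorial)) =
            (-1) ^ (k + 1) * F / ((k + 1) * k.factorial * m.factorial) -
              (-1) ^ k * F / (k.factorial * ((m + 2) * ((m + 1) * m.factorial))) *
                (2 * (m + 2 : ℕ)) := by
          push_cast
          rw [pow_succ]
          field_simp
          ring
        rw [key]
        simp only [C_mul, C_sub, map_natCast]
        ring
    · rw [if_neg (by omega), if_neg (by omega), if_neg h1]
      simp
  · simp only [mul_zero, Nat.zero_le, if_true, pow_zero, Nat.factorial_zero, Nat.cast_one, one_mul,
      Nat.sub_zero]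
    have h0 : ∀ n : ℕ, (n.factorial : ℝ) / n.factorial = 1 := fun n =>
      div_self (by exact_mod_cast Nat.factorial_ne_zero n)
    rw [h0, h0, pow_succ]
    simp; ring

theorem hermiteH_zero : hermiteH 0 = 1 := by simp [hermiteH]

theorem hermiteXi_zero (x : ℝ) : hermiteXi 0 x = 1 := by
  simp [hermiteXi, hermiteH_zero]

/-- The recursion H_{n+1} = 2X H_n - H_n' evaluated at ix; the power of i attached to ξ turns the
sign of the derivative around. -/
theorem hasDerivAt_hermiteXi (v : ℕ) (x : ℝ) :
    HasDerivAt (hermiteXi v) (hermiteXi (v + 1) x - 2 * x * hermiteXi v x) x := by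
  have h1 : HasDerivAt (fun t : ℝ => Complex.I * (t : ℂ)) (Complex.I * 1) x :=
    (Complex.ofRealCLM.hasDerivAt (x := x)).const_mul Complex.I
  have h2 := ((hermiteH v).hasDerivAt_aeval (Complex.I * (x : ℂ))).comp x h1
  have h3 := (h2.const_mul (Complex.I ^ (-(v : ℤ))))
  have e : Complex.I ^ (-(v : ℤ)) * (Polynomial.aeval (Complex.I * (x : ℂ))
      (Polynomial.derivative (hermiteH v)) * (Complex.I * 1)) =
      ((hermiteXi (v + 1) x - 2 * x * hermiteXi v x : ℝ) : ℂ) := by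
    push_cast
    rw [ofReal_hermiteXi, ofReal_hermiteXi, hermiteH_succ]
    have hI : Complex.I ^ (-((v + 1 : ℕ) : ℤ)) = Complex.I ^ (-(v : ℤ)) * (-Complex.I) := by
      push_cast
      rw [neg_add, zpow_add₀ Complex.I_ne_zero, zpow_neg_one, Complex.inv_I]
    rw [hI]
    simp only [map_sub, map_mul, Polynomial.aeval_X, Polynomial.aeval_C, Complex.coe_algebraMap]
    push_cast
    linear_combination (2 * Complex.I ^ (-(v : ℤ)) * x * Polynomial.aeval (Complex.I * (x : ℂ)) (hermiteH v)) * Complex.I_sq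
  rw [e] at h3
  exact Complex.reCLM.hasFDerivAt.comp_hasDerivAt x h3

theorem hasDerivAt_sq_half (x : ℝ) : HasDerivAt (fun x : ℝ => x ^ 2 / 2) x x :=
  ((hasDerivAt_pow 2 x).div_const 2).congr_deriv (by simp)

theorem hasDerivAt_neg_sq_half (x : ℝ) : HasDerivAt (fun x : ℝ => -x ^ 2 / 2) (-x) x :=
  ((hasDerivAt_pow 2 x).neg.div_const 2).congr_deriv (by simp; ring)

/-- The harmonic oscillator as a shape-invariant system. -/
def sysH : ShapeInvariantSystem Unit where
  dom := Set.univ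
  isOpen_dom := isOpen_univ
  ordConnected_dom := Set.ordConnected_univ
  nonempty_dom := Set.univ_nonempty
  params := Set.univ
  shift := 0
  w := fun _ x => -x ^ 2 / 2
  contDiffOn_w := fun _ _ => by fun_prop
  E₁ := fun _ => 2
  E₁_pos := fun _ _ _ => by norm_num
  shape_invariance := fun _ _ _ x _ => by
    have h1 : deriv (fun x : ℝ => -x ^ 2 / 2) = fun x => -x := by
      funext x
      exact (hasDerivAt_neg_sq_half x).deriv
    rw [h1]
    simp only [deriv_neg]
    ring

theorem deriv_w_sysH (lam : Unit) (x : ℝ) : deriv (sysH.w lam) x = -x := by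
  exact (hasDerivAt_neg_sq_half x).deriv

theorem hasDerivAt_exp_neg_sq (x : ℝ) :
    HasDerivAt (fun x : ℝ => Real.exp (-x ^ 2 / 2)) (Real.exp (-x ^ 2 / 2) * (-x)) x := by
  exact (hasDerivAt_neg_sq_half x).exp

theorem hasDerivAt_exp_sq (x : ℝ) :
    HasDerivAt (fun x : ℝ => Real.exp (x ^ 2 / 2)) (Real.exp (x ^ 2 / 2) * x) x := by
  exact (hasDerivAt_sq_half x).exp

theorem modelH_matches : modelH.Matches sysH := by
  refine Model.matches_of_shift rfl rfl (fun lam x _ => ?_) (fun n lam => ?_) (fun lam x _ => ?_)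
    (fun n lam => ⟨1, one_ne_zero, fun x _ => ?_⟩) (fun lam x _ => ?_)
    (fun n lam => ⟨1, one_ne_zero, fun x _ => ?_⟩)
  · have h1 : deriv (sysH.w lam) = fun x => -x := funext (deriv_w_sysH lam)
    simp only [ShapeInvariantSystem.U, h1, modelH, deriv_neg]
    ring
  · cases n with
    | ofNat n => simp [modelH, ShapeInvariantSystem.E, sysH, mul_comm]
    | negSucc n => simp [modelH, ShapeInvariantSystem.E, sysH, Int.negSucc_eq]; ring
  · simp [modelH, hermiteH_zero, sysH]
  · simp only [modelH, ShapeInvariantSystem.opAdag, deriv_w_sysH, hermiteH_succ, one_mul]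
    have := ((hasDerivAt_exp_neg_sq x).mul ((hermiteH n).hasDerivAt x)).deriv
    simp only [Pi.mul_def] at this
    rw [this]
    simp
    ring
  · simp only [modelH, sysH, hermiteXi_zero, mul_one]
    rw [← Real.exp_neg]
    congr 1
    ring
  · simp only [modelH, ShapeInvariantSystem.opA, deriv_w_sysH, one_mul]
    have := ((hasDerivAt_exp_sq x).mul (hasDerivAt_hermiteXi n x)).deriv
    simp only [Pi.mul_def] at this
    rw [this]
    ring

end

section

open Filter Set Topology
open scoped ContDiff

theorem ascPochhammer_eval_succ_left (n : ℕ) (a : ℝ) :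
    (ascPochhammer ℝ (n + 1)).eval a = a * (ascPochhammer ℝ n).eval (a + 1) := by
  rw [ascPochhammer_succ_left]
  simp

/-! ### The radial oscillator -/

/-- The coefficients of the Laguerre polynomials. -/
def laguerreCoeff (n : ℕ) (α : ℝ) (k : ℕ) : ℝ :=
  (-1) ^ k * (ascPochhammer ℝ (n - k)).eval (α + k + 1) / ((n - k).factorial * k.factorial)

theorem laguerreL_eval (n : ℕ) (α y : ℝ) :
    (laguerreL n α).eval y = ∑ k ∈ Finset.range (n + 1), laguerreCoeff n α k * y ^ k := by
  simp [laguerreL, Polynomial.eval_finsetSum, laguerreCoeff]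

theorem laguerreL_deriv_eval (n : ℕ) (α y : ℝ) : y * (Polynomial.derivative (laguerreL n α)).eval y =
    ∑ k ∈ Finset.range (n + 1), k * laguerreCoeff n α k * y ^ k := by
  rw [laguerreL, Polynomial.derivative_sum, Polynomial.eval_finsetSum, Finset.mul_sum]
  refine Finset.sum_congr rfl fun k _ => ?_
  rw [Polynomial.derivative_C_mul, Polynomial.derivative_X_pow]
  simp only [Polynomial.eval_mul, Polynomial.eval_C, Polynomial.eval_pow, Polynomial.eval_X]
  rw [laguerreCoeff]
  cases k with
  | zero => simp
  | succ k =>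
    rw [Nat.add_sub_cancel, pow_succ y]
    ring

/-- Comparison of the coefficients of y^{k+1} in the backward shift relation. The range k < m leaves
the constant and the leading coefficient to be treated separately. -/
theorem laguerreCoeff_succ (m : ℕ) (α : ℝ) {k : ℕ} (hk : k < m) :
    (m + 1) * laguerreCoeff (m + 1) α (k + 1) =
      (α + 1 + (k + 1)) * laguerreCoeff m (α + 1) (k + 1) - laguerreCoeff m (α + 1) k := by
  obtain ⟨j, rfl⟩ : ∃ j, m = k + 1 + j := ⟨m - k - 1, by omega⟩
  have e1 : k + 1 + j + 1 - (k + 1) = j + 1 := by omega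
  have e2 : k + 1 + j - (k + 1) = j := by omega
  have e3 : k + 1 + j - k = j + 1 := by omega
  simp only [laguerreCoeff, e1, e2, e3]
  have a1 : α + ((k + 1 : ℕ) : ℝ) + 1 = α + k + 2 := by push_cast; ring
  have a2 : α + 1 + ((k + 1 : ℕ) : ℝ) + 1 = α + k + 2 + 1 := by push_cast; ring
  have a3 : α + 1 + (k : ℝ) + 1 = α + k + 2 := by ring
  rw [a1, a2, a3, ascPochhammer_eval_succ_left]
  have hj : ((j + 1).factorial : ℝ) = (j + 1) * j.factorial := by
    rw [Nat.factorial_succ]; push_cast; ring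
  have hkf : ((k + 1).factorial : ℝ) = (k + 1) * k.factorial := by
    rw [Nat.factorial_succ]; push_cast; ring
  have h1 : (j.factorial : ℝ) ≠ 0 := by exact_mod_cast Nat.factorial_ne_zero j
  have h2 : (k.factorial : ℝ) ≠ 0 := by exact_mod_cast Nat.factorial_ne_zero k
  have h3 : (j : ℝ) + 1 ≠ 0 := by positivity
  have h4 : (k : ℝ) + 1 ≠ 0 := by positivity
  rw [hj, hkf, pow_succ]
  push_cast
  field_simp
  ring

theorem laguerreCoeff_zero_succ (m : ℕ) (α : ℝ) :
    (m + 1) * laguerreCoeff (m + 1) α 0 = (α + 1) * laguerreCoeff m (α + 1) 0 := by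
  simp only [laguerreCoeff, Nat.sub_zero, pow_zero, one_mul, Nat.factorial_zero, Nat.cast_zero,
    add_zero, Nat.cast_one, mul_one]
  rw [ascPochhammer_eval_succ_left, Nat.factorial_succ]
  have h1 : (m.factorial : ℝ) ≠ 0 := by exact_mod_cast Nat.factorial_ne_zero m
  have h3 : (m : ℝ) + 1 ≠ 0 := by positivity
  push_cast
  field_simp

theorem laguerreCoeff_top (m : ℕ) (α : ℝ) : laguerreCoeff m α m = (-1) ^ m / m.factorial := by
  simp [laguerreCoeff]

/-- `(α + 1 - y) p + y p' = (m + 1) L_{m+1}^{(α)}` for `p = L_m^{(α+1)}`. -/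
theorem laguerreL_succ (m : ℕ) (α y : ℝ) : (m + 1) * (laguerreL (m + 1) α).eval y =
    (α + 1 - y) * (laguerreL m (α + 1)).eval y +
      y * (Polynomial.derivative (laguerreL m (α + 1))).eval y := by
  have h1 : (α + 1 - y) * (laguerreL m (α + 1)).eval y +
      y * (Polynomial.derivative (laguerreL m (α + 1))).eval y =
      ∑ k ∈ Finset.range (m + 1), (α + 1 + k) * laguerreCoeff m (α + 1) k * y ^ k -
        ∑ k ∈ Finset.range (m + 1), laguerreCoeff m (α + 1) k * y ^ (k + 1) := by
    rw [laguerreL_deriv_eval, laguerreL_eval, Finset.mul_sum, ← Finset.sum_add_distrib,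
      ← Finset.sum_sub_distrib]
    exact Finset.sum_congr rfl fun k _ => by ring
  rw [h1, laguerreL_eval, Finset.mul_sum, Finset.sum_range_succ', Finset.sum_range_succ,
    Finset.sum_range_succ' _ m, Finset.sum_range_succ _ m]
  have h2 : ∀ k ∈ Finset.range m, ((m : ℝ) + 1) * (laguerreCoeff (m + 1) α (k + 1) * y ^ (k + 1)) =
      (α + 1 + (k + 1 : ℕ)) * laguerreCoeff m (α + 1) (k + 1) * y ^ (k + 1) -
        laguerreCoeff m (α + 1) k * y ^ (k + 1) := fun k hk => by
    rw [← mul_assoc, laguerreCoeff_succ m α (Finset.mem_range.1 hk)]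
    push_cast
    ring
  rw [Finset.sum_congr rfl h2, Finset.sum_sub_distrib, ← mul_assoc, ← mul_assoc,
    laguerreCoeff_zero_succ, laguerreCoeff_top, laguerreCoeff_top, Nat.factorial_succ]
  have h1 : (m.factorial : ℝ) ≠ 0 := by exact_mod_cast Nat.factorial_ne_zero m
  have h3 : (m : ℝ) + 1 ≠ 0 := by positivity
  push_cast
  rw [pow_succ (-1 : ℝ)]
  field_simp
  ring

theorem hasDerivAt_w_L (g : ℝ) {x : ℝ} (hx : x ≠ 0) :
    HasDerivAt (fun x : ℝ => -x ^ 2 / 2 + g * Real.log x) (-x + g / x) x :=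
  (hasDerivAt_neg_sq_half x).add ((Real.hasDerivAt_log hx).const_mul g)

theorem hasDerivAt_deriv_w_L (g : ℝ) {x : ℝ} (hx : x ≠ 0) :
    HasDerivAt (fun x : ℝ => -x + g / x) (-1 - g / x ^ 2) x := by
  have := (hasDerivAt_neg x).add ((hasDerivAt_inv hx).const_mul g)
  refine (this.congr_deriv ?_).congr_of_eventuallyEq ?_
  · ring
  · filter_upwards with y
    simp [div_eq_mul_inv]

theorem deriv_deriv_w_L (g : ℝ) {x : ℝ} (hx : x ≠ 0) :
    deriv (deriv fun x : ℝ => -x ^ 2 / 2 + g * Real.log x) x = -1 - g / x ^ 2 := by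
  have hE : deriv (fun x : ℝ => -x ^ 2 / 2 + g * Real.log x) =ᶠ[𝓝 x] fun x => -x + g / x := by
    filter_upwards [isOpen_ne.mem_nhds hx] with y hy using (hasDerivAt_w_L g hy).deriv
  rw [hE.deriv_eq, (hasDerivAt_deriv_w_L g hx).deriv]

/-- The radial oscillator as a shape-invariant system. -/
def sysL : ShapeInvariantSystem ℝ where
  dom := Set.Ioi 0
  isOpen_dom := isOpen_Ioi
  ordConnected_dom := Set.ordConnected_Ioi
  nonempty_dom := ⟨1, Set.mem_Ioi.2 one_pos⟩
  params := Set.univ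
  shift := 1
  w := fun g x => -x ^ 2 / 2 + g * Real.log x
  contDiffOn_w := fun g _ => by
    refine ContDiffOn.add (by fun_prop) (contDiffOn_const.mul ?_)
    exact contDiffOn_id.log fun x hx => (ne_of_gt hx)
  E₁ := fun _ => 4
  E₁_pos := fun _ _ _ => by norm_num
  shape_invariance := fun g _ _ x hx => by
    have hx0 : x ≠ 0 := ne_of_gt hx
    rw [deriv_deriv_w_L g hx0, deriv_deriv_w_L _ hx0, (hasDerivAt_w_L g hx0).deriv,
      (hasDerivAt_w_L _ hx0).deriv]
    field_simp
    ring

theorem hasDerivAt_phiL (g : ℝ) (p : Polynomial ℝ) {x : ℝ} (hx : 0 < x) :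
    HasDerivAt (fun x => Real.exp (-x ^ 2 / 2) * x ^ g * p.eval (x ^ 2))
      (Real.exp (-x ^ 2 / 2) * x ^ g * ((-x + g / x) * p.eval (x ^ 2) +
        2 * x * (Polynomial.derivative p).eval (x ^ 2))) x := by
  have h1 := (hasDerivAt_neg_sq_half x).exp
  have h2 := Real.hasDerivAt_rpow_const (p := g) (Or.inl hx.ne')
  have h3 := (p.hasDerivAt (x ^ 2)).comp x (hasDerivAt_pow 2 x)
  refine ((h1.mul h2).mul h3).congr_deriv ?_
  have : x ^ (g - 1) = x ^ g / x := Real.rpow_sub_one hx.ne' g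
  simp only [Function.comp, Pi.mul_apply, this]
  field_simp
  push_cast
  ring

theorem hasDerivAt_pvL (g : ℝ) (p : Polynomial ℝ) {x : ℝ} (hx : 0 < x) :
    HasDerivAt (fun x => Real.exp (x ^ 2 / 2) * x ^ g * p.eval (-x ^ 2))
      (Real.exp (x ^ 2 / 2) * x ^ g * ((x + g / x) * p.eval (-x ^ 2) -
        2 * x * (Polynomial.derivative p).eval (-x ^ 2))) x := by
  have h1 := (hasDerivAt_sq_half x).exp
  have h2 := Real.hasDerivAt_rpow_const (p := g) (Or.inl hx.ne')
  have h3 := (p.hasDerivAt (-x ^ 2)).comp x (hasDerivAt_pow 2 x).neg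
  refine ((h1.mul h2).mul h3).congr_deriv ?_
  have : x ^ (g - 1) = x ^ g / x := Real.rpow_sub_one hx.ne' g
  simp only [Function.comp, Pi.mul_apply, Pi.neg_apply, this]
  field_simp
  push_cast
  ring

theorem laguerreL_zero (α : ℝ) : laguerreL 0 α = 1 := by simp [laguerreL]

theorem exp_w_L (g : ℝ) {x : ℝ} (hx : 0 < x) :
    Real.exp (-x ^ 2 / 2 + g * Real.log x) = Real.exp (-x ^ 2 / 2) * x ^ g := by
  rw [Real.exp_add, Real.rpow_def_of_pos hx, mul_comm g]

/-- The relation `laguerreL_succ` at y = x² raises the eigenfunctions; with g replaced by 1 - g and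
y = -x² it gives the step for the pseudo virtual states. The constants ∓1/(2(n+1)) undo the factor n
+ 1 of that relation and the 2 from differentiating x². -/
theorem modelL_matches : modelL.Matches sysL := by
  refine Model.matches_of_shift rfl rfl (fun g x hx => ?_) (fun n g => ?_) (fun g x hx => ?_)
    (fun n g => ⟨-1 / (2 * (n + 1)), by simp; positivity, fun x hx => ?_⟩) (fun g x hx => ?_)
    (fun n g => ⟨1 / (2 * (n + 1)), by positivity, fun x hx => ?_⟩)
  all_goals try
    have hx : 0 < x := hx
    have hx0 : x ≠ 0 := hx.ne'
  · change _ = deriv (fun x : ℝ => -x ^ 2 / 2 + g * Real.log x) x ^ 2 +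
      deriv (deriv fun x : ℝ => -x ^ 2 / 2 + g * Real.log x) x
    rw [(hasDerivAt_w_L g hx0).deriv, deriv_deriv_w_L g hx0]
    simp only [modelL]
    field_simp
    ring
  · cases n with
    | ofNat n => simp [modelL, ShapeInvariantSystem.E, sysL, mul_comm]
    | negSucc n => simp [modelL, ShapeInvariantSystem.E, sysL, Int.negSucc_eq]; ring
  · simp only [modelL, laguerreL_zero, Polynomial.eval_one, mul_one]
    exact (exp_w_L g hx).symm
  · change _ = _ * (-deriv (modelL.phi n (g + 1)) x -
      deriv (fun x : ℝ => -x ^ 2 / 2 + g * Real.log x) x * modelL.phi n (g + 1) x)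
    rw [(hasDerivAt_w_L g hx0).deriv]
    simp only [modelL]
    have e : g + 1 - 1 / 2 = g - 1 / 2 + 1 := by ring
    rw [(hasDerivAt_phiL (g + 1) _ hx).deriv, Real.rpow_add_one hx0, e]
    have key := laguerreL_succ n (g - 1 / 2) (x ^ 2)
    generalize (laguerreL (n + 1) (g - 1 / 2)).eval (x ^ 2) = A at key ⊢
    generalize (laguerreL n (g - 1 / 2 + 1)).eval (x ^ 2) = B at key ⊢
    generalize (Polynomial.derivative (laguerreL n (g - 1 / 2 + 1))).eval (x ^ 2) = C at key ⊢
    have hn : (n : ℝ) + 1 ≠ 0 := by positivity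
    field_simp
    linear_combination (2 : ℝ) * key
  · simp only [modelL, laguerreL_zero, Polynomial.eval_one, mul_one]
    change _ = (Real.exp (-x ^ 2 / 2 + (g - 1) * Real.log x))⁻¹
    rw [exp_w_L _ hx, mul_inv, ← Real.exp_neg, ← Real.rpow_neg hx.le]
    congr 2 <;> ring
  · change _ = _ * (deriv (modelL.pv n (g - 1)) x -
      deriv (fun x : ℝ => -x ^ 2 / 2 + (g - 1) * Real.log x) x * modelL.pv n (g - 1) x)
    rw [(hasDerivAt_w_L _ hx0).deriv]
    simp only [modelL]
    have e : 1 - (g - 1) = 1 - g + 1 := by ring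
    have e' : 1 - g + 1 - 1 / 2 = 1 - g - 1 / 2 + 1 := by ring
    rw [(hasDerivAt_pvL (1 - (g - 1)) _ hx).deriv, e, Real.rpow_add_one hx0, e']
    have key := laguerreL_succ n (1 - g - 1 / 2) (-x ^ 2)
    generalize (laguerreL (n + 1) (1 - g - 1 / 2)).eval (-x ^ 2) = A at key ⊢
    generalize (laguerreL n (1 - g - 1 / 2 + 1)).eval (-x ^ 2) = B at key ⊢
    generalize (Polynomial.derivative (laguerreL n (1 - g - 1 / 2 + 1))).eval (-x ^ 2) = C at key ⊢
    have hn : (n : ℝ) + 1 ≠ 0 := by positivity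
    field_simp
    linear_combination (2 : ℝ) * key

end

section

open Filter Set Topology
open scoped ContDiff

/-! ### The Pöschl-Teller potential -/

/-- The coefficients of the Jacobi polynomials in powers of `(1 - X) / 2`. -/
def jacobiCoeff (n : ℕ) (α β : ℝ) (k : ℕ) : ℝ :=
  (-1) ^ k * (ascPochhammer ℝ (n - k)).eval (α + k + 1) *
    (ascPochhammer ℝ k).eval (n + α + β + 1) / ((n - k).factorial * k.factorial)

theorem jacobiP_eval (n : ℕ) (α β y : ℝ) : (jacobiP n α β).eval y =
    ∑ k ∈ Finset.range (n + 1), jacobiCoeff n α β k * ((1 - y) / 2) ^ k := by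
  simp only [jacobiP, Polynomial.eval_finsetSum, jacobiCoeff, Polynomial.eval_mul,
    Polynomial.eval_C, Polynomial.eval_pow, Polynomial.eval_sub, Polynomial.eval_one,
    Polynomial.eval_X]
  refine Finset.sum_congr rfl fun k _ => ?_
  congr 2
  ring

theorem jacobiP_deriv_eval (n : ℕ) (α β y : ℝ) :
    (y - 1) * (Polynomial.derivative (jacobiP n α β)).eval y =
      ∑ k ∈ Finset.range (n + 1), k * jacobiCoeff n α β k * ((1 - y) / 2) ^ k := by
  rw [jacobiP, Polynomial.derivative_sum, Polynomial.eval_finsetSum, Finset.mul_sum]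
  refine Finset.sum_congr rfl fun k _ => ?_
  rw [Polynomial.derivative_C_mul, Polynomial.derivative_pow, Polynomial.derivative_C_mul]
  simp only [Polynomial.eval_mul, Polynomial.eval_C, Polynomial.eval_pow, Polynomial.eval_sub,
    Polynomial.eval_X, Polynomial.eval_one, Polynomial.derivative_sub, Polynomial.derivative_one,
    Polynomial.derivative_X, Polynomial.eval_neg, zero_sub]
  rw [jacobiCoeff]
  cases k with
  | zero => simp
  | succ k =>
    have : (1 / 2 * (1 - y)) = (1 - y) / 2 := by ring
    rw [this, Nat.add_sub_cancel, pow_succ ((1 - y) / 2)]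
    ring

/-- The coefficient of t^{k+1} in the backward shift relation, with t = (1 - y)/2. In this variable
the relation is again two-term, as for Laguerre polynomials. -/
theorem jacobiCoeff_succ (m : ℕ) (α β : ℝ) {k : ℕ} (hk : k < m) :
    (m + 1) * jacobiCoeff (m + 1) α β (k + 1) =
      (α + 1 + (k + 1)) * jacobiCoeff m (α + 1) (β + 1) (k + 1) -
        (k + α + β + 2) * jacobiCoeff m (α + 1) (β + 1) k := by
  obtain ⟨j, rfl⟩ : ∃ j, m = k + 1 + j := ⟨m - k - 1, by omega⟩
  have e1 : k + 1 + j + 1 - (k + 1) = j + 1 := by omega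
  have e2 : k + 1 + j - (k + 1) = j := by omega
  have e3 : k + 1 + j - k = j + 1 := by omega
  simp only [jacobiCoeff, e1, e2, e3]
  have a1 : α + ((k + 1 : ℕ) : ℝ) + 1 = α + k + 2 := by push_cast; ring
  have a2 : α + 1 + ((k + 1 : ℕ) : ℝ) + 1 = α + k + 2 + 1 := by push_cast; ring
  have a3 : α + 1 + (k : ℝ) + 1 = α + k + 2 := by ring
  have b1 : ((k + 1 + j + 1 : ℕ) : ℝ) + α + β + 1 = k + j + α + β + 3 := by push_cast; ring
  have b2 : ((k + 1 + j : ℕ) : ℝ) + (α + 1) + (β + 1) + 1 = k + j + α + β + 3 + 1 := by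
    push_cast; ring
  rw [a1, a2, a3, b1, b2, ascPochhammer_eval_succ_left j, ascPochhammer_eval_succ_left k,
    ascPochhammer_succ_eval (n := k)]
  have hj : ((j + 1).factorial : ℝ) = (j + 1) * j.factorial := by
    rw [Nat.factorial_succ]; push_cast; ring
  have hkf : ((k + 1).factorial : ℝ) = (k + 1) * k.factorial := by
    rw [Nat.factorial_succ]; push_cast; ring
  have h1 : (j.factorial : ℝ) ≠ 0 := by exact_mod_cast Nat.factorial_ne_zero j
  have h2 : (k.factorial : ℝ) ≠ 0 := by exact_mod_cast Nat.factorial_ne_zero k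
  have h3 : (j : ℝ) + 1 ≠ 0 := by positivity
  have h4 : (k : ℝ) + 1 ≠ 0 := by positivity
  rw [hj, hkf, pow_succ]
  push_cast
  field_simp
  ring

theorem jacobiCoeff_zero_succ (m : ℕ) (α β : ℝ) :
    (m + 1) * jacobiCoeff (m + 1) α β 0 = (α + 1) * jacobiCoeff m (α + 1) (β + 1) 0 := by
  simp only [jacobiCoeff, Nat.sub_zero, pow_zero, one_mul, Nat.factorial_zero, Nat.cast_zero,
    add_zero, Nat.cast_one, mul_one, ascPochhammer_zero, Polynomial.eval_one]
  rw [ascPochhammer_eval_succ_left, Nat.factorial_succ]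
  have h1 : (m.factorial : ℝ) ≠ 0 := by exact_mod_cast Nat.factorial_ne_zero m
  have h3 : (m : ℝ) + 1 ≠ 0 := by positivity
  push_cast
  field_simp

theorem jacobiCoeff_top (m : ℕ) (α β : ℝ) : jacobiCoeff m α β m =
    (-1) ^ m * (ascPochhammer ℝ m).eval (m + α + β + 1) / m.factorial := by
  simp [jacobiCoeff]

/-- The backward shift relation of the Jacobi polynomials, with `p = P_m^{(α+1,β+1)}`. -/
theorem jacobiP_succ (m : ℕ) (α β y : ℝ) : (m + 1) * (jacobiP (m + 1) α β).eval y =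
    ((α + 1) * ((1 + y) / 2) - (β + 1) * ((1 - y) / 2)) * (jacobiP m (α + 1) (β + 1)).eval y -
      2 * ((1 - y) / 2) * ((1 + y) / 2) *
        (Polynomial.derivative (jacobiP m (α + 1) (β + 1))).eval y := by
  have h0 : ((α + 1) * ((1 + y) / 2) - (β + 1) * ((1 - y) / 2)) *
      (jacobiP m (α + 1) (β + 1)).eval y - 2 * ((1 - y) / 2) * ((1 + y) / 2) *
        (Polynomial.derivative (jacobiP m (α + 1) (β + 1))).eval y =
      (α + 1 - (α + β + 2) * ((1 - y) / 2)) * (jacobiP m (α + 1) (β + 1)).eval y +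
        (1 - (1 - y) / 2) *
          ((y - 1) * (Polynomial.derivative (jacobiP m (α + 1) (β + 1))).eval y) := by
    ring
  rw [h0, jacobiP_deriv_eval, jacobiP_eval, jacobiP_eval]
  generalize (1 - y) / 2 = t
  have h1 : (α + 1 - (α + β + 2) * t) *
      (∑ k ∈ Finset.range (m + 1), jacobiCoeff m (α + 1) (β + 1) k * t ^ k) +
      (1 - t) * ∑ k ∈ Finset.range (m + 1), k * jacobiCoeff m (α + 1) (β + 1) k * t ^ k =
      ∑ k ∈ Finset.range (m + 1), (α + 1 + k) * jacobiCoeff m (α + 1) (β + 1) k * t ^ k -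
        ∑ k ∈ Finset.range (m + 1), (k + α + β + 2) * jacobiCoeff m (α + 1) (β + 1) k *
          t ^ (k + 1) := by
    rw [Finset.mul_sum, Finset.mul_sum, ← Finset.sum_add_distrib, ← Finset.sum_sub_distrib]
    exact Finset.sum_congr rfl fun k _ => by ring
  rw [h1, Finset.mul_sum, Finset.sum_range_succ', Finset.sum_range_succ,
    Finset.sum_range_succ' _ m, Finset.sum_range_succ _ m]
  have h2 : ∀ k ∈ Finset.range m, ((m : ℝ) + 1) * (jacobiCoeff (m + 1) α β (k + 1) * t ^ (k + 1)) =
      (α + 1 + (k + 1 : ℕ)) * jacobiCoeff m (α + 1) (β + 1) (k + 1) * t ^ (k + 1) -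
        (k + α + β + 2) * jacobiCoeff m (α + 1) (β + 1) k * t ^ (k + 1) := fun k hk => by
    rw [← mul_assoc, jacobiCoeff_succ m α β (Finset.mem_range.1 hk)]
    push_cast
    ring
  rw [Finset.sum_congr rfl h2, Finset.sum_sub_distrib, ← mul_assoc, ← mul_assoc,
    jacobiCoeff_zero_succ, jacobiCoeff_top, jacobiCoeff_top, Nat.factorial_succ]
  have h1 : (m.factorial : ℝ) ≠ 0 := by exact_mod_cast Nat.factorial_ne_zero m
  have h3 : (m : ℝ) + 1 ≠ 0 := by positivity
  have b1 : ((m + 1 : ℕ) : ℝ) + α + β + 1 = m + α + β + 2 := by push_cast; ring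
  have b2 : (m : ℝ) + (α + 1) + (β + 1) + 1 = m + α + β + 2 + 1 := by ring
  rw [b1, b2, ascPochhammer_eval_succ_left]
  push_cast
  rw [pow_succ (-1 : ℝ)]
  field_simp
  ring

theorem sin_pos_J {x : ℝ} (hx : x ∈ Set.Ioo 0 (Real.pi / 2)) : 0 < Real.sin x :=
  Real.sin_pos_of_pos_of_lt_pi hx.1 (by linarith [hx.2, Real.pi_pos])

theorem cos_pos_J {x : ℝ} (hx : x ∈ Set.Ioo 0 (Real.pi / 2)) : 0 < Real.cos x :=
  Real.cos_pos_of_mem_Ioo ⟨by linarith [hx.1, Real.pi_pos], hx.2⟩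

/-- The prepotential `g log sin x + h log cos x`. -/
def wJ (p : ℝ × ℝ) (x : ℝ) : ℝ := p.1 * Real.log (Real.sin x) + p.2 * Real.log (Real.cos x)

theorem hasDerivAt_wJ (p : ℝ × ℝ) {x : ℝ} (hx : x ∈ Set.Ioo 0 (Real.pi / 2)) :
    HasDerivAt (wJ p) (p.1 * (Real.cos x / Real.sin x) - p.2 * (Real.sin x / Real.cos x)) x := by
  have h1 := (Real.hasDerivAt_sin x).log (sin_pos_J hx).ne'
  have h2 := (Real.hasDerivAt_cos x).log (cos_pos_J hx).ne'
  refine ((h1.const_mul p.1).add (h2.const_mul p.2)).congr_deriv ?_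
  ring

theorem deriv_deriv_wJ (p : ℝ × ℝ) {x : ℝ} (hx : x ∈ Set.Ioo 0 (Real.pi / 2)) :
    deriv (deriv (wJ p)) x = -p.1 / Real.sin x ^ 2 - p.2 / Real.cos x ^ 2 := by
  have hE : deriv (wJ p) =ᶠ[𝓝 x]
      fun x => p.1 * (Real.cos x / Real.sin x) - p.2 * (Real.sin x / Real.cos x) := by
    filter_upwards [isOpen_Ioo.mem_nhds hx] with y hy using (hasDerivAt_wJ p hy).deriv
  rw [hE.deriv_eq]
  have hs := (sin_pos_J hx).ne'
  have hc := (cos_pos_J hx).ne'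
  have h1 := ((Real.hasDerivAt_cos x).div (Real.hasDerivAt_sin x) hs).const_mul p.1
  have h2 := ((Real.hasDerivAt_sin x).div (Real.hasDerivAt_cos x) hc).const_mul p.2
  refine (h1.sub h2).deriv.trans ?_
  have e1 : -Real.sin x * Real.sin x - Real.cos x * Real.cos x = -1 := by
    linarith [Real.sin_sq_add_cos_sq x, sq (Real.sin x), sq (Real.cos x)]
  have e2 : Real.cos x * Real.cos x - Real.sin x * -Real.sin x = 1 := by
    linarith [Real.sin_sq_add_cos_sq x, sq (Real.sin x), sq (Real.cos x)]
  rw [e1, e2]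
  ring

theorem contDiffOn_wJ (p : ℝ × ℝ) : ContDiffOn ℝ ∞ (wJ p) (Set.Ioo 0 (Real.pi / 2)) := by
  refine ContDiffOn.add (contDiffOn_const.mul ?_) (contDiffOn_const.mul ?_)
  · exact Real.contDiff_sin.contDiffOn.log fun x hx => (sin_pos_J hx).ne'
  · exact Real.contDiff_cos.contDiffOn.log fun x hx => (cos_pos_J hx).ne'

/-- The Pöschl-Teller system as a shape-invariant system. -/
def sysJ : ShapeInvariantSystem (ℝ × ℝ) where
  dom := Set.Ioo 0 (Real.pi / 2)
  isOpen_dom := isOpen_Ioo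
  ordConnected_dom := Set.ordConnected_Ioo
  nonempty_dom := Set.nonempty_Ioo.2 (by positivity)
  -- Only g + h matters for the positivity of `E₁`; this set is also stable under the shift.
  params := {p | 0 < p.1 + p.2}
  shift := (1, 1)
  w := wJ
  contDiffOn_w := fun p _ => contDiffOn_wJ p
  E₁ := fun p => 4 * (1 + p.1 + p.2)
  E₁_pos := fun p hp _ => by
    have : 0 < p.1 + p.2 := hp
    nlinarith
  shape_invariance := fun p _ _ x hx => by
    rw [deriv_deriv_wJ p hx, deriv_deriv_wJ _ hx, (hasDerivAt_wJ p hx).deriv,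
      (hasDerivAt_wJ _ hx).deriv]
    have hs := (sin_pos_J hx).ne'
    have hc := (cos_pos_J hx).ne'
    have h2 := Real.sin_sq_add_cos_sq x
    simp only [Prod.fst_add, Prod.snd_add]
    have e : Real.cos x ^ 2 = 1 - Real.sin x ^ 2 := by linarith
    have hc2 : 1 - Real.sin x ^ 2 ≠ 0 := by rw [← e]; positivity
    have r1 : (Real.cos x / Real.sin x) ^ 2 = 1 / Real.sin x ^ 2 - 1 := by
      rw [div_pow, e]; field_simp
    have r2 : (Real.sin x / Real.cos x) ^ 2 = 1 / Real.cos x ^ 2 - 1 := by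
      rw [div_pow]; field_simp; linarith
    have r3 : (Real.cos x / Real.sin x) * (Real.sin x / Real.cos x) = 1 := by field_simp
    linear_combination (p.1 ^ 2 - (p.1 + 1) ^ 2) * r1 + (p.2 ^ 2 - (p.2 + 1) ^ 2) * r2 -
      2 * (p.1 * p.2 - (p.1 + 1) * (p.2 + 1)) * r3

theorem hasDerivAt_phiJ (g h : ℝ) (p : Polynomial ℝ) {x : ℝ} (hx : x ∈ Set.Ioo 0 (Real.pi / 2)) :
    HasDerivAt (fun x => Real.sin x ^ g * Real.cos x ^ h * p.eval (Real.cos (2 * x)))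
      (Real.sin x ^ g * Real.cos x ^ h *
        ((g * (Real.cos x / Real.sin x) - h * (Real.sin x / Real.cos x)) *
          p.eval (Real.cos (2 * x)) -
        4 * Real.sin x * Real.cos x * (Polynomial.derivative p).eval (Real.cos (2 * x)))) x := by
  have hs := sin_pos_J hx
  have hc := cos_pos_J hx
  have h1 := (Real.hasDerivAt_sin x).rpow_const (p := g) (Or.inl hs.ne')
  have h2 := (Real.hasDerivAt_cos x).rpow_const (p := h) (Or.inl hc.ne')
  have h0 : HasDerivAt (fun x => Real.cos (2 * x)) (-Real.sin (2 * x) * (2 * 1)) x :=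
    ((hasDerivAt_id x).const_mul 2).cos
  have h3 := (p.hasDerivAt (Real.cos (2 * x))).comp x h0
  refine ((h1.mul h2).mul h3).congr_deriv ?_
  have e1 : Real.sin x ^ (g - 1) = Real.sin x ^ g / Real.sin x := Real.rpow_sub_one hs.ne' g
  have e2 : Real.cos x ^ (h - 1) = Real.cos x ^ h / Real.cos x := Real.rpow_sub_one hc.ne' h
  simp only [Function.comp, Pi.mul_apply, e1, e2, Real.sin_two_mul]
  field_simp
  ring

theorem jacobiP_zero (α β : ℝ) : jacobiP 0 α β = 1 := by simp [jacobiP]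

theorem exp_wJ (p : ℝ × ℝ) {x : ℝ} (hx : x ∈ Set.Ioo 0 (Real.pi / 2)) :
    Real.exp (wJ p x) = Real.sin x ^ p.1 * Real.cos x ^ p.2 := by
  rw [wJ, Real.exp_add, Real.rpow_def_of_pos (sin_pos_J hx), Real.rpow_def_of_pos (cos_pos_J hx),
    mul_comm p.1, mul_comm p.2]

/-- The first order relation behind both ladder relations of the Pöschl-Teller potential. -/
theorem phiJ_succ (n : ℕ) (g h : ℝ) {x : ℝ} (hx : x ∈ Set.Ioo 0 (Real.pi / 2)) :
    deriv (fun x => Real.sin x ^ (g + 1) * Real.cos x ^ (h + 1) *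
        (jacobiP n (g + 1 - 1 / 2) (h + 1 - 1 / 2)).eval (Real.cos (2 * x))) x +
      (g * (Real.cos x / Real.sin x) - h * (Real.sin x / Real.cos x)) *
        (Real.sin x ^ (g + 1) * Real.cos x ^ (h + 1) *
          (jacobiP n (g + 1 - 1 / 2) (h + 1 - 1 / 2)).eval (Real.cos (2 * x))) =
      2 * (n + 1) * (Real.sin x ^ g * Real.cos x ^ h *
        (jacobiP (n + 1) (g - 1 / 2) (h - 1 / 2)).eval (Real.cos (2 * x))) := by
  have hs := (sin_pos_J hx).ne'
  have hc := (cos_pos_J hx).ne'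
  rw [(hasDerivAt_phiJ _ _ _ hx).deriv, Real.rpow_add_one hs, Real.rpow_add_one hc]
  have e : g + 1 - 1 / 2 = g - 1 / 2 + 1 := by ring
  have e' : h + 1 - 1 / 2 = h - 1 / 2 + 1 := by ring
  have key := jacobiP_succ n (g - 1 / 2) (h - 1 / 2) (Real.cos (2 * x))
  have c1 : (1 - Real.cos (2 * x)) / 2 = Real.sin x ^ 2 := by
    rw [Real.sin_sq_eq_half_sub]; ring
  have c2 : (1 + Real.cos (2 * x)) / 2 = Real.cos x ^ 2 := by
    rw [Real.cos_sq]; ring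
  rw [c1, c2] at key
  rw [e, e']
  generalize (jacobiP (n + 1) (g - 1 / 2) (h - 1 / 2)).eval (Real.cos (2 * x)) = A at key ⊢
  generalize (jacobiP n (g - 1 / 2 + 1) (h - 1 / 2 + 1)).eval (Real.cos (2 * x)) = B at key ⊢
  generalize (Polynomial.derivative (jacobiP n (g - 1 / 2 + 1) (h - 1 / 2 + 1))).eval
    (Real.cos (2 * x)) = C at key ⊢
  field_simp
  linear_combination (-2 * Real.sin x ^ g * Real.cos x ^ h) * key

/-- Replacing (g, h) by (1 - g, 1 - h) turns the eigenfunctions into the pseudo virtual states, so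
`phiJ_succ` serves for both ladders. -/
theorem modelJ_matches : modelJ.Matches sysJ := by
  refine Model.matches_of_shift rfl rfl (fun p x hx => ?_) (fun n p => ?_) (fun p x hx => ?_)
    (fun n p => ⟨-1 / (2 * (n + 1)), by simp; positivity, fun x hx => ?_⟩) (fun p x hx => ?_)
    (fun n p => ⟨1 / (2 * (n + 1)), by positivity, fun x hx => ?_⟩)
  all_goals try
    have hs := (sin_pos_J hx).ne'
    have hc := (cos_pos_J hx).ne'
  · change _ = deriv (wJ p) x ^ 2 + deriv (deriv (wJ p)) x
    rw [(hasDerivAt_wJ p hx).deriv, deriv_deriv_wJ p hx]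
    simp only [modelJ]
    have h2 := Real.sin_sq_add_cos_sq x
    have r1 : (Real.cos x / Real.sin x) ^ 2 = 1 / Real.sin x ^ 2 - 1 := by
      rw [div_pow]; field_simp; linarith
    have r2 : (Real.sin x / Real.cos x) ^ 2 = 1 / Real.cos x ^ 2 - 1 := by
      rw [div_pow]; field_simp; linarith
    have r3 : (Real.cos x / Real.sin x) * (Real.sin x / Real.cos x) = 1 := by field_simp
    linear_combination (-p.1 ^ 2) * r1 - p.2 ^ 2 * r2 + 2 * p.1 * p.2 * r3
  · have hsum : ∀ (n : ℕ) (q : ℝ × ℝ),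
        ∑ s ∈ Finset.range n, 4 * (1 + (q.1 + s) + (q.2 + s)) = 4 * n * (n + q.1 + q.2) := by
      intro n q
      induction n with
      | zero => simp
      | succ n ih => rw [Finset.sum_range_succ, ih]; push_cast; ring
    have hsum' : ∀ (n : ℕ) (q : ℝ × ℝ),
        ∑ s ∈ Finset.range n, 4 * (1 + (q.1 - (s + 1)) + (q.2 - (s + 1))) =
          4 * n * (q.1 + q.2 - n) := by
      intro n q
      induction n with
      | zero => simp
      | succ n ih => rw [Finset.sum_range_succ, ih]; push_cast; ring
    cases n with
    | ofNat n => simp [modelJ, ShapeInvariantSystem.E, sysJ, hsum]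
    | negSucc n =>
      have := hsum' (n + 1) p
      have e : ∀ s : ℕ, (s + 1) • ((1 : ℝ), (1 : ℝ)) = ((s : ℝ) + 1, (s : ℝ) + 1) := fun s => by
        ext <;> simp
      simp only [modelJ, ShapeInvariantSystem.E, sysJ, e, Prod.fst_sub, Prod.snd_sub, Nat.cast_add,
        Nat.cast_one, Int.cast_negSucc] at this ⊢
      rw [this]
      ring
  · simp only [modelJ, jacobiP_zero, Polynomial.eval_one, mul_one]
    exact (exp_wJ p hx).symm
  · change _ = _ * (-deriv (modelJ.phi n (p + (1, 1))) x -
      deriv (wJ p) x * modelJ.phi n (p + (1, 1)) x)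
    rw [(hasDerivAt_wJ p hx).deriv]
    have key := phiJ_succ n p.1 p.2 hx
    have hn : (n : ℝ) + 1 ≠ 0 := by positivity
    simp only [modelJ, Prod.fst_add, Prod.snd_add]
    rw [div_mul_eq_mul_div, eq_div_iff (by positivity)]
    linear_combination -key
  · simp only [modelJ, jacobiP_zero, Polynomial.eval_one, mul_one]
    change _ = (Real.exp (wJ (p - (1, 1)) x))⁻¹
    rw [exp_wJ _ hx, mul_inv, ← Real.rpow_neg (sin_pos_J hx).le, ← Real.rpow_neg (cos_pos_J hx).le]
    simp
  · change _ = _ * (deriv (modelJ.pv n (p - (1, 1))) x -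
      deriv (wJ (p - (1, 1))) x * modelJ.pv n (p - (1, 1)) x)
    rw [(hasDerivAt_wJ _ hx).deriv]
    have key := phiJ_succ n (1 - p.1) (1 - p.2) hx
    have hn : (n : ℝ) + 1 ≠ 0 := by positivity
    have e : ∀ t : ℝ, 1 - (t - 1) = 1 - t + 1 := fun t => by ring
    simp only [modelJ, Prod.fst_sub, Prod.snd_sub, e]
    rw [div_mul_eq_mul_div, eq_div_iff (by positivity)]
    linear_combination -key

end

section

open Filter Set Topology MeasureTheory
open scoped ContDiff

/-! ### Parseval's identity for a complete orthogonal sequence -/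

/-- After normalization, completeness says that the span has trivial orthogonal complement, so the
functions form a Hilbert basis. The bilinear form is stated because it is applied to two different
functions. -/
theorem hasSum_parseval {α : Type*} [MeasurableSpace α] {μ : Measure α} {φ : ℕ → α → ℝ}
    (hφ : ∀ n, MemLp (φ n) 2 μ) (horth : ∀ m n, m ≠ n → ∫ x, φ m x * φ n x ∂μ = 0)
    (hpos : ∀ n, 0 < ∫ x, φ n x * φ n x ∂μ)
    (hcomp : ∀ u, MemLp u 2 μ → (∀ n, ∫ x, u x * φ n x ∂μ = 0) → u =ᵐ[μ] 0)
    {u v : α → ℝ} (hu : MemLp u 2 μ) (hv : MemLp v 2 μ) :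
    HasSum (fun n => (∫ x, u x * φ n x ∂μ) * (∫ x, v x * φ n x ∂μ) / ∫ x, φ n x * φ n x ∂μ)
      (∫ x, u x * v x ∂μ) := by
  have hin : ∀ {f g : α → ℝ} (hf : MemLp f 2 μ) (hg : MemLp g 2 μ),
      inner ℝ (hf.toLp f) (hg.toLp g) = ∫ x, f x * g x ∂μ := by
    intro f g hf hg
    rw [L2.inner_def]
    refine integral_congr_ae ?_
    filter_upwards [hf.coeFn_toLp, hg.coeFn_toLp] with x hx hy
    rw [hx, hy, RCLike.inner_apply, conj_trivial, mul_comm]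
  set c : ℕ → ℝ := fun n => (Real.sqrt (∫ x, φ n x * φ n x ∂μ))⁻¹ with hc
  have hc0 : ∀ n, c n ≠ 0 := fun n => inv_ne_zero (Real.sqrt_pos.2 (hpos n)).ne'
  have hcc : ∀ n, c n * c n = (∫ x, φ n x * φ n x ∂μ)⁻¹ := fun n => by
    rw [hc, ← mul_inv, Real.mul_self_sqrt (hpos n).le]
  set e : ℕ → Lp ℝ 2 μ := fun n => c n • (hφ n).toLp (φ n) with he
  have hon : Orthonormal ℝ e := by
    rw [orthonormal_iff_ite]
    intro i j
    simp only [he, inner_smul_left, inner_smul_right, hin, conj_trivial]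
    split_ifs with h
    · subst h
      rw [← mul_assoc, hcc, inv_mul_cancel₀ (hpos i).ne']
    · rw [horth i j h]; simp
  have hbot : (Submodule.span ℝ (Set.range e))ᗮ = ⊥ := by
    rw [eq_bot_iff]
    intro f hf
    rw [Submodule.mem_orthogonal] at hf
    have hmem : MemLp (f : α → ℝ) 2 μ := Lp.memLp f
    have h0 := hcomp f hmem fun n => by
      have h1 := hf (e n) (Submodule.subset_span ⟨n, rfl⟩)
      have h2 : f = hmem.toLp f := (Lp.toLp_coeFn f hmem).symm
      rw [h2, he, inner_smul_left, hin, conj_trivial] at h1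
      rcases mul_eq_zero.1 h1 with h | h
      · exact absurd h (hc0 n)
      · rw [← h]
        exact integral_congr_ae (Eventually.of_forall fun x => mul_comm _ _)
    rw [Submodule.mem_bot]
    exact (Lp.eq_zero_iff_ae_eq_zero).2 h0
  have key := (HilbertBasis.mkOfOrthogonalEqBot hon hbot).hasSum_inner_mul_inner
    (hu.toLp u) (hv.toLp v)
  rw [HilbertBasis.coe_mkOfOrthogonalEqBot, hin] at key
  have hterm : ∀ n, inner ℝ (hu.toLp u) (e n) * inner ℝ (e n) (hv.toLp v) =
      (∫ x, u x * φ n x ∂μ) * (∫ x, v x * φ n x ∂μ) / ∫ x, φ n x * φ n x ∂μ := fun n => ?_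
  · simp only [hterm] at key
    exact key
  simp only [he, inner_smul_left, inner_smul_right, hin, conj_trivial]
  rw [div_eq_mul_inv, ← hcc]
  have : ∫ x, φ n x * v x ∂μ = ∫ x, v x * φ n x ∂μ :=
    integral_congr_ae (Eventually.of_forall fun x => mul_comm _ _)
  rw [this]
  ring

/-! ### Complete systems of bound states -/

/-- The solutions `φ n`, with increasing energies `ε n`, form a complete orthogonal system of bound
states of `-f'' + U f` on the interval `I`, whose ends are described by the filters `lL`, `lR`. -/
structure Eigensystem (I : Set ℝ) (lL lR : Filter ℝ) (U : ℝ → ℝ) (ε : ℕ → ℝ)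
    (φ : ℕ → ℝ → ℝ) : Prop where
  isOpen : IsOpen I
  ordConnected : I.OrdConnected
  left_mem : ∀ x ∈ I, ∀ᶠ y in lL, y ∈ I ∧ y < x
  right_mem : ∀ x ∈ I, ∀ᶠ y in lR, y ∈ I ∧ x < y
  smoothU : ∀ x ∈ I, ContDiffAt ℝ ∞ U x
  sol : ∀ n, SolOn I U (ε n) (φ n)
  strictMono : StrictMono ε
  nonvanishing : ∀ n, ∀ J ⊆ I, IsOpen J → J.Nonempty → ∃ x ∈ J, φ n x ≠ 0
  memLp : ∀ n, MemLp (φ n) 2 (volume.restrict I)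
  wr_left : ∀ m n, Tendsto (fun x => φ m x * deriv (φ n) x - deriv (φ m) x * φ n x) lL (𝓝 0)
  wr_right : ∀ m n, Tendsto (fun x => φ m x * deriv (φ n) x - deriv (φ m) x * φ n x) lR (𝓝 0)
  complete : ∀ u, MemLp u 2 (volume.restrict I) → (∀ n, ∫ x in I, u x * φ n x = 0) →
    u =ᵐ[volume.restrict I] 0

namespace Eigensystem

variable {I : Set ℝ} {lL lR : Filter ℝ} {U : ℝ → ℝ} {ε : ℕ → ℝ} {φ : ℕ → ℝ → ℝ}

/-- Lagrange's identity: the potential drops out of the derivative of a Wronskian of two solutions.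
-/
theorem hasDerivAt_wr (h : Eigensystem I lL lR U ε φ) (m n : ℕ) {x : ℝ} (hx : x ∈ I) :
    HasDerivAt (fun x => φ m x * deriv (φ n) x - deriv (φ m) x * φ n x)
      ((ε m - ε n) * (φ m x * φ n x)) x := by
  have h1 := (((h.sol m).hasDerivAt hx).mul ((h.sol n).hasDerivAt_deriv hx)).sub
    (((h.sol m).hasDerivAt_deriv hx).mul ((h.sol n).hasDerivAt hx))
  exact h1.congr_deriv (by ring)

theorem integrable_mul (h : Eigensystem I lL lR U ε φ) (m n : ℕ) :
    IntegrableOn (fun x => φ m x * φ n x) I := (h.memLp m).integrable_mul (h.memLp n)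

theorem continuousOn (h : Eigensystem I lL lR U ε φ) (m : ℕ) : ContinuousOn (φ m) I :=
  fun x hx => ((h.sol m).smooth x hx).continuousAt.continuousWithinAt

theorem intervalIntegral_mul (h : Eigensystem I lL lR U ε φ) (m n : ℕ) {a b : ℝ} (ha : a ∈ I)
    (hb : b ∈ I) : (ε m - ε n) * ∫ x in a..b, φ m x * φ n x =
      (φ m b * deriv (φ n) b - deriv (φ m) b * φ n b) -
        (φ m a * deriv (φ n) a - deriv (φ m) a * φ n a) := by
  have hsub : Set.uIcc a b ⊆ I := h.ordConnected.uIcc_subset ha hb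
  rw [← intervalIntegral.integral_const_mul]
  refine intervalIntegral.integral_eq_sub_of_hasDerivAt
    (fun x hx => h.hasDerivAt_wr m n (hsub hx)) ?_
  exact (((h.continuousOn m).mul (h.continuousOn n)).const_mul _ |>.mono hsub).intervalIntegrable

theorem tendsto_integral_right [lR.IsCountablyGenerated] (h : Eigensystem I lL lR U ε φ) {f : ℝ → ℝ}
    (hf : IntegrableOn f I) {a : ℝ} (ha : a ∈ I) :
    Tendsto (fun b => ∫ x in a..b, f x) lR (𝓝 (∫ x in I ∩ Set.Ioi a, f x)) := by
  have hcov : AECover (volume.restrict (I ∩ Set.Ioi a)) lR fun b => Set.Ioc a b := by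
    refine ⟨?_, fun b => measurableSet_Ioc⟩
    refine (ae_restrict_iff' (h.isOpen.inter isOpen_Ioi).measurableSet).2
      (Eventually.of_forall fun x hx => ?_)
    filter_upwards [h.right_mem x hx.1] with b hb using ⟨hx.2, hb.2.le⟩
  have := hcov.integral_tendsto_of_countably_generated (hf.mono_set Set.inter_subset_left)
  refine this.congr' ?_
  filter_upwards [h.right_mem a ha] with b hb
  rw [intervalIntegral.integral_of_le hb.2.le, Measure.restrict_restrict measurableSet_Ioc]
  congr 2
  ext x
  refine ⟨fun hx => hx.1, fun hx => ⟨hx, h.ordConnected.out ha hb.1 ⟨hx.1.le, hx.2⟩, hx.1⟩⟩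

theorem tendsto_integral_left [lL.IsCountablyGenerated] (h : Eigensystem I lL lR U ε φ) {f : ℝ → ℝ}
    (hf : IntegrableOn f I) {b : ℝ} (hb : b ∈ I) :
    Tendsto (fun a => ∫ x in a..b, f x) lL (𝓝 (∫ x in I ∩ Set.Iic b, f x)) := by
  have hcov : AECover (volume.restrict (I ∩ Set.Iic b)) lL fun a => Set.Ioc a b := by
    refine ⟨?_, fun b => measurableSet_Ioc⟩
    refine (ae_restrict_iff' (h.isOpen.measurableSet.inter measurableSet_Iic)).2
      (Eventually.of_forall fun x hx => ?_)
    filter_upwards [h.left_mem x hx.1] with a ha using ⟨ha.2, hx.2⟩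
  have := hcov.integral_tendsto_of_countably_generated (hf.mono_set Set.inter_subset_left)
  refine this.congr' ?_
  filter_upwards [h.left_mem b hb] with a ha
  rw [intervalIntegral.integral_of_le ha.2.le, Measure.restrict_restrict measurableSet_Ioc]
  congr 2
  ext x
  refine ⟨fun hx => hx.1, fun hx => ⟨hx, h.ordConnected.out ha.1 hb ⟨hx.1.le, hx.2⟩, hx.2⟩⟩

/-- Green's formula on the part to the right of `a`; the boundary term at the end of the interval
vanishes by `wr_right`. -/
theorem integral_right [lR.NeBot] [lR.IsCountablyGenerated] (h : Eigensystem I lL lR U ε φ) (m n : ℕ) {a : ℝ} (ha : a ∈ I) :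
    (ε m - ε n) * ∫ x in I ∩ Set.Ioi a, φ m x * φ n x =
      -(φ m a * deriv (φ n) a - deriv (φ m) a * φ n a) := by
  have h1 := (h.tendsto_integral_right (h.integrable_mul m n) ha).const_mul (ε m - ε n)
  have h2 := (h.wr_right m n).sub_const (φ m a * deriv (φ n) a - deriv (φ m) a * φ n a)
  rw [zero_sub] at h2
  refine tendsto_nhds_unique (h1.congr' ?_) h2
  filter_upwards [h.right_mem a ha] with b hb using h.intervalIntegral_mul m n ha hb.1

theorem integral_left [lL.NeBot] [lL.IsCountablyGenerated] (h : Eigensystem I lL lR U ε φ) (m n : ℕ) {b : ℝ} (hb : b ∈ I) :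
    (ε m - ε n) * ∫ x in I ∩ Set.Iic b, φ m x * φ n x =
      φ m b * deriv (φ n) b - deriv (φ m) b * φ n b := by
  have h1 := (h.tendsto_integral_left (h.integrable_mul m n) hb).const_mul (ε m - ε n)
  have h2 := (h.wr_left m n).const_sub (φ m b * deriv (φ n) b - deriv (φ m) b * φ n b)
  rw [sub_zero] at h2
  refine tendsto_nhds_unique (h1.congr' ?_) h2
  filter_upwards [h.left_mem b hb] with a ha using h.intervalIntegral_mul m n ha.1 hb

/-- The boundary terms at `a` from the left and the right parts cancel, and the energies are
distinct. -/
theorem integral_mul_eq_zero [lL.NeBot] [lL.IsCountablyGenerated] [lR.NeBot]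
    [lR.IsCountablyGenerated] (h : Eigensystem I lL lR U ε φ) (hI : I.Nonempty) {m n : ℕ}
    (hmn : m ≠ n) : ∫ x in I, φ m x * φ n x = 0 := by
  obtain ⟨a, ha⟩ := hI
  have h1 : ∫ x in I, φ m x * φ n x =
      (∫ x in I ∩ Set.Iic a, φ m x * φ n x) + ∫ x in I ∩ Set.Ioi a, φ m x * φ n x := by
    rw [← Set.compl_Iic, ← Set.sdiff_eq, integral_inter_add_sdiff measurableSet_Iic
      (h.integrable_mul m n)]
  have h2 := h.integral_left m n ha
  have h3 := h.integral_right m n ha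
  have h4 : ε m - ε n ≠ 0 := sub_ne_zero.2 (h.strictMono.injective.ne hmn)
  refine (mul_eq_zero.1 ?_).resolve_left h4
  rw [h1, mul_add, h2, h3]
  ring

theorem integral_self_pos (h : Eigensystem I lL lR U ε φ) (hI : I.Nonempty) (n : ℕ) :
    0 < ∫ x in I, φ n x * φ n x := by
  refine lt_of_le_of_ne (integral_nonneg fun x => mul_self_nonneg _) fun h0 => ?_
  have h1 := (integral_eq_zero_iff_of_nonneg (fun x => mul_self_nonneg _)
    (h.integrable_mul n n)).1 h0.symm
  have h2 := Measure.eqOn_open_of_ae_eq h1 h.isOpen ((h.continuousOn n).mul (h.continuousOn n))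
    continuousOn_const
  obtain ⟨x, hx, hne⟩ := h.nonvanishing n I le_rfl h.isOpen hI
  exact hne (mul_self_eq_zero.1 (h2 hx))

/-! ### Linear combinations of finitely many bound states -/

variable {ι : Type*} [Fintype ι]

/-- The linear combination `∑ w_k φ_{s k}`. -/
def comb (φ : ℕ → ℝ → ℝ) (s : ι → ℕ) (w : ι → ℝ) (x : ℝ) : ℝ := ∑ k, w k * φ (s k) x

theorem comb_contDiffAt (h : Eigensystem I lL lR U ε φ) (s : ι → ℕ) (w : ι → ℝ) {x : ℝ}
    (hx : x ∈ I) : ContDiffAt ℝ ∞ (comb φ s w) x :=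
  ContDiffAt.sum fun k _ => contDiffAt_const.mul ((h.sol (s k)).smooth x hx)

theorem iteratedDeriv_comb (h : Eigensystem I lL lR U ε φ) (s : ι → ℕ) (w : ι → ℝ) {x : ℝ}
    (hx : x ∈ I) (j : ℕ) :
    iteratedDeriv j (comb φ s w) x = ∑ k, w k * iteratedDeriv j (φ (s k)) x := by
  have hs : ∀ k, ContDiffAt ℝ j (φ (s k)) x := fun k =>
    ((h.sol (s k)).smooth x hx).of_le (mod_cast le_top)
  unfold comb
  rw [iteratedDeriv_fun_sum fun k _ => contDiffAt_const.mul (hs k)]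
  exact Finset.sum_congr rfl fun k _ => iteratedDeriv_const_mul _ (hs k)

/-- Multiplying the coefficients by ε - a is the action of H - a on the combination. -/
theorem comb_sub_mul (h : Eigensystem I lL lR U ε φ) (s : ι → ℕ) (w : ι → ℝ) (a : ℝ) {x : ℝ}
    (hx : x ∈ I) : comb φ s (fun k => w k * (ε (s k) - a)) x =
      (U x - a) * comb φ s w x - iteratedDeriv 2 (comb φ s w) x := by
  rw [h.iteratedDeriv_comb s w hx, comb, comb, Finset.mul_sum, ← Finset.sum_sub_distrib]
  refine Finset.sum_congr rfl fun k _ => ?_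
  rw [ShapeInvariantSystem.iteratedDeriv_two, (h.sol (s k)).eq x hx]
  ring

/-- If `f = ∑ w_k φ_k` vanishes to order `n + 2` at `x`, then `-f'' + (U - a) f` vanishes to
order `n`. -/
theorem vanishing_comb_sub_mul (h : Eigensystem I lL lR U ε φ) {s : ι → ℕ} {w : ι → ℝ} (a : ℝ)
    {x : ℝ} (hx : x ∈ I) {n : ℕ} (hv : ∀ j < n + 2, iteratedDeriv j (comb φ s w) x = 0) :
    ∀ j < n, iteratedDeriv j (comb φ s fun k => w k * (ε (s k) - a)) x = 0 := by
  intro j hj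
  have hE : (comb φ s fun k => w k * (ε (s k) - a)) =ᶠ[𝓝 x]
      (fun t => U t - a) * comb φ s w - iteratedDeriv 2 (comb φ s w) := by
    filter_upwards [h.isOpen.mem_nhds hx] with t ht using h.comb_sub_mul s w a ht
  have hj' : (j : WithTop ℕ∞) ≤ ∞ := mod_cast le_top
  have h1 : ContDiffAt ℝ j (fun t => U t - a) x :=
    ((h.smoothU x hx).sub contDiffAt_const).of_le hj'
  have h2 : ContDiffAt ℝ j (comb φ s w) x := (h.comb_contDiffAt s w hx).of_le hj'
  have h3 : ContDiffAt ℝ j (iteratedDeriv 2 (comb φ s w)) x :=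
    ((h.comb_contDiffAt s w hx).iteratedDeriv_infty 2).of_le hj'
  rw [hE.iteratedDeriv_eq, iteratedDeriv_sub (f := (fun t => U t - a) * comb φ s w) (h1.mul h2) h3,
    iteratedDeriv_mul h1 h2,
    Finset.sum_eq_zero, zero_sub, neg_eq_zero]
  · rw [ShapeInvariantSystem.iteratedDeriv_two, ← iteratedDeriv_succ', ← iteratedDeriv_succ']
    exact hv _ (by omega)
  · intro i _
    rw [hv (j - i) (by omega), mul_zero]

theorem integral_comb_mul (h : Eigensystem I lL lR U ε φ) (s : ι → ℕ) (w : ι → ℝ) (n : ℕ) (J : Set ℝ)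
    (hJ : J ⊆ I) :
    ∫ x in J, comb φ s w x * φ n x = ∑ k, w k * ∫ x in J, φ (s k) x * φ n x := by
  simp only [comb, Finset.sum_mul, mul_assoc]
  rw [integral_finsetSum _ fun k _ => ((h.integrable_mul (s k) n).mono_set hJ).const_mul _]
  simp only [integral_const_mul]

/-- H is symmetric on the half-interval when one function vanishes to second order at its inner end
point: the boundary terms involve only f(x) and f'(x). -/
theorem integral_comb_sub_mul [lR.NeBot] [lR.IsCountablyGenerated] (h : Eigensystem I lL lR U ε φ)
    {s : ι → ℕ} {w : ι → ℝ} (a : ℝ) {x : ℝ} (hx : x ∈ I)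
    (hv : ∀ j < 2, iteratedDeriv j (comb φ s w) x = 0) (n : ℕ) :
    ∫ t in I ∩ Set.Ioi x, comb φ s (fun k => w k * (ε (s k) - a)) t * φ n t =
      (ε n - a) * ∫ t in I ∩ Set.Ioi x, comb φ s w t * φ n t := by
  rw [h.integral_comb_mul _ _ _ _ Set.inter_subset_left,
    h.integral_comb_mul _ _ _ _ Set.inter_subset_left, Finset.mul_sum, ← sub_eq_zero,
    ← Finset.sum_sub_distrib]
  have e0 := hv 0 (by norm_num)
  have e1 := hv 1 (by norm_num)
  rw [h.iteratedDeriv_comb s w hx] at e0 e1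
  simp only [iteratedDeriv_zero, iteratedDeriv_one] at e0 e1
  calc _ = ∑ k, (deriv (φ n) x * -(w k * φ (s k) x) + φ n x * (w k * deriv (φ (s k)) x)) := by
        refine Finset.sum_congr rfl fun k _ => ?_
        linear_combination w k * h.integral_right (s k) n hx
    _ = 0 := by
        rw [Finset.sum_add_distrib, ← Finset.mul_sum, ← Finset.mul_sum, Finset.sum_neg_distrib, e0,
          e1]
        simp

/-- Integration by parts for `∏ (H - a) f` on the part of the interval to the right of a zero of
`f` of high order. -/
theorem integral_comb_prod [lR.NeBot] [lR.IsCountablyGenerated] (h : Eigensystem I lL lR U ε φ)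
    {s : ι → ℕ} {x : ℝ} (hx : x ∈ I) (n : ℕ) (L : List ℝ) : ∀ {w : ι → ℝ},
    (∀ j < 2 * L.length, iteratedDeriv j (comb φ s w) x = 0) →
    ∫ t in I ∩ Set.Ioi x, comb φ s (fun k => w k * (L.map fun a => ε (s k) - a).prod) t * φ n t =
      (L.map fun a => ε n - a).prod * ∫ t in I ∩ Set.Ioi x, comb φ s w t * φ n t := by
  induction L with
  | nil => intro w _; simp
  | cons a L ih =>
    intro w hw
    simp only [List.length_cons] at hw
    have h1 := ih (w := fun k => w k * (ε (s k) - a))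
      (h.vanishing_comb_sub_mul a hx fun j hj => hw j (by omega))
    simp only [List.map_cons, List.prod_cons, ← mul_assoc] at h1 ⊢
    rw [h1, h.integral_comb_sub_mul a hx fun j hj => hw j (by omega)]
    ring

theorem memLp_comb (h : Eigensystem I lL lR U ε φ) (s : ι → ℕ) (w : ι → ℝ) :
    MemLp (comb φ s w) 2 (volume.restrict I) :=
  memLp_finsetSum _ fun k _ => (h.memLp (s k)).const_mul (w k)

theorem pairwise_ne (h : Eigensystem I lL lR U ε φ) {l : List ℕ} (hl : l.Nodup) :
    l.Pairwise fun a b => ε a ≠ ε b :=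
  hl.imp fun hab => h.strictMono.injective.ne hab

/-- Finitely many bound states are linearly independent on every open set. -/
theorem eq_zero_of_comb_eqOn_zero (h : Eigensystem I lL lR U ε φ) {l : List ℕ} (hl : l.Nodup)
    {w : Fin l.length → ℝ} {J : Set ℝ} (hJ : J ⊆ I) (hJo : IsOpen J) (hJn : J.Nonempty)
    (h0 : ∀ x ∈ J, comb φ l.get w x = 0) : w = 0 := by
  obtain ⟨x, hx, hW⟩ := exists_wronskian_ne_zero (l := l) (F := φ) (ε := ε) hJo hJn
    (fun a _ => (h.sol a).mono hJ) (h.pairwise_ne hl)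
    (fun a _ K hK hKo hKn => h.nonvanishing a K (hK.trans hJ) hKo hKn)
  rw [wronskian_map, wr] at hW
  refine Matrix.eq_zero_of_mulVec_eq_zero hW ?_
  funext j
  have hE : comb φ l.get w =ᶠ[𝓝 x] fun _ => 0 := by
    filter_upwards [hJo.mem_nhds hx] with t ht using h0 t ht
  have := h.iteratedDeriv_comb l.get w (hJ hx) j
  rw [hE.iteratedDeriv_eq] at this
  simp only [Matrix.mulVec, dotProduct, Matrix.of_apply, Pi.zero_apply]
  rw [iteratedDeriv_const] at this
  simp only [ite_self] at this
  rw [this]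
  exact Finset.sum_congr rfl fun k _ => mul_comm _ _

/-- The Wronskian of an even number of bound states `φ_e`, `e ∈ l`, has no zero if
`∏ (ε n - ε e) ≥ 0` for all `n`. -/
theorem wronskian_ne_zero_of_even [lL.NeBot] [lL.IsCountablyGenerated] [lR.NeBot]
    [lR.IsCountablyGenerated] (h : Eigensystem I lL lR U ε φ) {l : List ℕ} (hl : l.Nodup)
    (heven : Even l.length) (hpos : ∀ n, 0 ≤ (l.map fun e => ε n - ε e).prod) {x : ℝ}
    (hx : x ∈ I) : wronskian (l.map φ) x ≠ 0 := by
  intro hW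
  have hI : I.Nonempty := ⟨x, hx⟩
  rw [wronskian_map, wr] at hW
  -- A kernel vector of the Wronskian matrix is a combination vanishing at x to order `l.length`.
  obtain ⟨v, hv0, hv⟩ := Matrix.exists_mulVec_eq_zero_iff.2 hW
  apply hv0
  have hvan : ∀ j < l.length, iteratedDeriv j (comb φ l.get v) x = 0 := by
    intro j hj
    rw [h.iteratedDeriv_comb _ _ hx]
    have := congrFun hv ⟨j, hj⟩
    simp only [Matrix.mulVec, dotProduct, Matrix.of_apply, Pi.zero_apply] at this
    rw [← this]
    exact Finset.sum_congr rfl fun k _ => mul_comm _ _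
  -- Applying r factors H - ε by parts requires vanishing to order 2r, which is the order available.
  -- So the factors are divided into two halves.
  obtain ⟨r, hr⟩ := heven
  set L₁ := (l.take r).map ε with hL₁
  set L₂ := (l.drop r).map ε with hL₂
  have hlen₁ : L₁.length = r := by simp [hL₁]; omega
  have hlen₂ : L₂.length = r := by simp [hL₂]; omega
  have hsplit : ∀ y, (L₁.map fun a => y - a).prod * (L₂.map fun a => y - a).prod =
      (l.map fun e => y - ε e).prod := fun y => by
    rw [hL₁, hL₂, List.map_map, List.map_map, ← List.prod_append, ← List.map_append,
      List.take_append_drop]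
    rfl
  set A : ℕ → ℝ := fun n => ∫ t in I ∩ Set.Ioi x, comb φ l.get v t * φ n t with hA
  have hA₁ := fun n => h.integral_comb_prod (s := l.get) hx n L₁ (w := v)
    fun j hj => hvan j (by omega)
  have hA₂ := fun n => h.integral_comb_prod (s := l.get) hx n L₂ (w := v)
    fun j hj => hvan j (by omega)
  set w₁ : Fin l.length → ℝ := fun k => v k * (L₁.map fun a => ε (l.get k) - a).prod with hw₁
  set w₂ : Fin l.length → ℝ := fun k => v k * (L₂.map fun a => ε (l.get k) - a).prod with hw₂
  have hms : MeasurableSet (Set.Ioi x) := measurableSet_Ioi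
  have hind : ∀ f g : ℝ → ℝ, ∫ t in I, (Set.Ioi x).indicator f t * g t =
      ∫ t in I ∩ Set.Ioi x, f t * g t := fun f g => by
    simp only [← Set.indicator_mul_left]
    rw [setIntegral_indicator hms]
  have hu : MemLp ((Set.Ioi x).indicator (comb φ l.get w₁)) 2 (volume.restrict I) :=
    (h.memLp_comb _ _).indicator hms
  have hv' : MemLp ((Set.Ioi x).indicator (comb φ l.get w₂)) 2 (volume.restrict I) :=
    (h.memLp_comb _ _).indicator hms
  have hP := hasSum_parseval h.memLp (fun m n hmn => h.integral_mul_eq_zero hI hmn)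
    (h.integral_self_pos hI) h.complete hu hv'
  -- Expand the second function in the φ_k with k in `l` and move the first half of the operators
  -- onto φ_k: the full product ∏ (ε_k - ε_e) appears, and it is zero.
  have hcross : ∫ t in I, (Set.Ioi x).indicator (comb φ l.get w₁) t *
      (Set.Ioi x).indicator (comb φ l.get w₂) t = 0 := by
    have e1 : ∫ t in I, (Set.Ioi x).indicator (comb φ l.get w₁) t *
        (Set.Ioi x).indicator (comb φ l.get w₂) t =
        ∫ t in I ∩ Set.Ioi x, comb φ l.get w₂ t * comb φ l.get w₁ t := by
      rw [← hind]
      refine integral_congr_ae (Eventually.of_forall fun t => ?_)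
      by_cases ht : t ∈ Set.Ioi x <;> simp [ht, mul_comm]
    have hint : ∀ k, IntegrableOn (fun t => w₂ k * φ (l.get k) t * comb φ l.get w₁ t)
        (I ∩ Set.Ioi x) := fun k =>
      IntegrableOn.mono_set (((h.memLp (l.get k)).const_mul (w₂ k)).integrable_mul
        (h.memLp_comb l.get w₁)) Set.inter_subset_left
    rw [e1]
    have e2 : ∀ t, comb φ l.get w₂ t * comb φ l.get w₁ t =
      ∑ k, w₂ k * φ (l.get k) t * comb φ l.get w₁ t := fun t => by
        rw [← Finset.sum_mul]; rfl
    simp only [e2]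
    rw [integral_finsetSum _ fun k _ => hint k]
    refine Finset.sum_eq_zero fun k _ => ?_
    have e3 : ∀ t, w₂ k * φ (l.get k) t * comb φ l.get w₁ t =
      w₂ k * (comb φ l.get w₁ t * φ (l.get k) t) := fun t => by ring
    simp only [e3]
    rw [integral_const_mul, hA₁, hw₂]
    have hz : (L₁.map fun a => ε (l.get k) - a).prod * (L₂.map fun a => ε (l.get k) - a).prod = 0 := by
      rw [hsplit]
      exact List.prod_eq_zero (List.mem_map.2 ⟨l.get k, l.get_mem k, sub_self _⟩)
    linear_combination v k * (∫ t in I ∩ Set.Ioi x, comb φ l.get v t * φ (l.get k) t) * hz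
  rw [hcross] at hP
  simp only [hind, hA₁, hA₂] at hP
  have hterm : ∀ n, (L₁.map fun a => ε n - a).prod * A n * ((L₂.map fun a => ε n - a).prod * A n) /
      ∫ t in I, φ n t * φ n t =
      (l.map fun e => ε n - ε e).prod * (A n * A n) / ∫ t in I, φ n t * φ n t := fun n => by
    rw [← hsplit]; ring
  -- A vanishing sum of non-negative terms; for n outside `l` the product is non-zero, so the
  -- coefficient A_n must vanish.
  have hA0 : ∀ n, n ∉ l → A n = 0 := by
    intro n hn
    have h1 := (hasSum_zero_iff_of_nonneg fun n => ?_).1 hP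
    · have h2 := congrFun h1 n
      simp only [Pi.zero_apply] at h2
      rw [hterm, div_eq_zero_iff, or_iff_left (h.integral_self_pos hI n).ne', mul_eq_zero] at h2
      rcases h2 with h2 | h2
      · obtain ⟨e, he, he'⟩ := List.mem_map.1 (List.prod_eq_zero_iff.1 h2)
        exact absurd (h.strictMono.injective (sub_eq_zero.1 he')) fun hne => hn (hne ▸ he)
      · exact mul_self_eq_zero.1 h2
    · show 0 ≤ _
      rw [hterm]
      exact div_nonneg (mul_nonneg (hpos n) (mul_self_nonneg _)) (h.integral_self_pos hI n).le
  -- The cut-off function therefore has only the Fourier coefficients with index in `l`, and equals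
  -- this finite combination almost everywhere.
  set γ : Fin l.length → ℝ := fun k => A (l.get k) / ∫ t in I, φ (l.get k) t * φ (l.get k) t
    with hγ
  have hfu : MemLp ((Set.Ioi x).indicator (comb φ l.get v)) 2 (volume.restrict I) :=
    (h.memLp_comb _ _).indicator hms
  have hae := h.complete _ (hfu.sub (h.memLp_comb l.get γ)) fun n => by
    simp only [Pi.sub_apply, sub_mul]
    have i1 : IntegrableOn (fun t => (Set.Ioi x).indicator (comb φ l.get v) t * φ n t) I :=
      hfu.integrable_mul (h.memLp n)
    have i2 : IntegrableOn (fun t => comb φ l.get γ t * φ n t) I :=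
      (h.memLp_comb l.get γ).integrable_mul (h.memLp n)
    rw [integral_sub i1 i2, hind,
      h.integral_comb_mul _ _ _ _ le_rfl]
    by_cases hn : n ∈ l
    · obtain ⟨k, rfl⟩ := List.mem_iff_get.1 hn
      rw [Finset.sum_eq_single k]
      · rw [hγ]
        simp only
        rw [div_mul_cancel₀ _ (h.integral_self_pos hI _).ne', sub_self]
      · intro j _ hj
        rw [h.integral_mul_eq_zero hI fun he => hj (List.nodup_iff_injective_get.1 hl he), mul_zero]
      · simp
    · have := hA0 n hn
      rw [hA] at this
      simp only at this
      rw [this, Finset.sum_eq_zero, sub_zero]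
      intro j _
      have hne : l.get j ≠ n := fun he => hn (he ▸ l.get_mem j)
      rw [h.integral_mul_eq_zero hI hne, mul_zero]
  have hpiece : ∀ J ⊆ I, IsOpen J → ∀ c : Fin l.length → ℝ,
      (∀ t ∈ J, (Set.Ioi x).indicator (comb φ l.get v) t - comb φ l.get γ t = comb φ l.get c t) →
      ∀ t ∈ J, comb φ l.get c t = 0 := by
    intro J hJ hJo c hc
    have h1 : comb φ l.get c =ᵐ[volume.restrict J] fun _ => 0 := by
      filter_upwards [ae_restrict_of_ae_restrict_of_subset hJ hae,
        ae_restrict_mem hJo.measurableSet] with t ht htJ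
      rw [← hc t htJ]
      exact ht
    exact Measure.eqOn_open_of_ae_eq h1 hJo
      (fun t ht => (h.comb_contDiffAt l.get c (hJ ht)).continuousAt.continuousWithinAt)
      continuousOn_const
  have hJL : (I ∩ Set.Iio x).Nonempty := by
    obtain ⟨y, hy⟩ := (h.left_mem x hx).exists
    exact ⟨y, hy.1, hy.2⟩
  have hJR : (I ∩ Set.Ioi x).Nonempty := by
    obtain ⟨y, hy⟩ := (h.right_mem x hx).exists
    exact ⟨y, hy.1, hy.2⟩
  -- To the left of x the cut-off function is zero, so independence on that open set gives γ = 0; to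
  -- the right the same argument then gives v = 0.
  have hγ0 : γ = 0 := by
    have h1 := h.eq_zero_of_comb_eqOn_zero hl (w := -γ) Set.inter_subset_left
      (h.isOpen.inter isOpen_Iio) hJL (hpiece _ Set.inter_subset_left (h.isOpen.inter isOpen_Iio) _
        fun t ht => by
          rw [Set.indicator_of_notMem (by simpa using (Set.mem_Iio.1 ht.2).le)]
          simp [comb])
    exact neg_eq_zero.1 h1
  exact h.eq_zero_of_comb_eqOn_zero hl Set.inter_subset_left (h.isOpen.inter isOpen_Ioi) hJR
    (hpiece _ Set.inter_subset_left (h.isOpen.inter isOpen_Ioi) _ fun t ht => by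
      rw [Set.indicator_of_mem ht.2, hγ0]
      simp [comb])

end Eigensystem

end

section

open Filter Set Topology MeasureTheory
open scoped ContDiff

/-! ### Asymptotic gauges at the ends of the interval -/

/-- The Wronskian of two functions. -/
def wr₂ (f g : ℝ → ℝ) (x : ℝ) : ℝ := f x * deriv g x - deriv f x * g x

theorem SolOn.hasDerivAt_wr₂ {I : Set ℝ} {U : ℝ → ℝ} {e e' : ℝ} {f g : ℝ → ℝ} (hf : SolOn I U e f)
    (hg : SolOn I U e' g) {x : ℝ} (hx : x ∈ I) :
    HasDerivAt (wr₂ f g) ((e - e') * (f x * g x)) x := by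
  have h1 := ((hf.hasDerivAt hx).mul (hg.hasDerivAt_deriv hx)).sub
    ((hf.hasDerivAt_deriv hx).mul (hg.hasDerivAt hx))
  exact h1.congr_deriv (by ring)

/-- A family `Γ` of comparison functions at an end of an interval, stable under multiplication by
`τ`; a Darboux transformation multiplies the size of a solution by `τ`. -/
structure EndGauge (l : Filter ℝ) (Γ : Set (ℝ → ℝ)) (τ : ℝ → ℝ) : Prop where
  lhopital : ∀ {f f' g g' : ℝ → ℝ} {c : ℝ}, (∀ᶠ x in l, HasDerivAt f (f' x) x) →
    (∀ᶠ x in l, HasDerivAt g (g' x) x) → (∀ᶠ x in l, g' x ≠ 0) → Tendsto f l (𝓝 0) →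
    Tendsto g l (𝓝 0) → Tendsto (fun x => f' x / g' x) l (𝓝 c) →
    Tendsto (fun x => f x / g x) l (𝓝 c)
  mul_mem : ∀ γ ∈ Γ, (fun x => γ x * τ x) ∈ Γ
  ne_zero : ∀ γ ∈ Γ, ∀ᶠ x in l, γ x ≠ 0
  tendsto_zero : ∀ γ₁ ∈ Γ, ∀ γ₂ ∈ Γ, Tendsto (fun x => γ₁ x * γ₂ x * τ x) l (𝓝 0)
  hasDerivAt : ∀ γ₁ ∈ Γ, ∀ γ₂ ∈ Γ, ∃ g' : ℝ → ℝ,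
    (∀ᶠ x in l, HasDerivAt (fun x => γ₁ x * γ₂ x * τ x) (g' x) x) ∧
    ∃ c : ℝ, c ≠ 0 ∧ Tendsto (fun x => g' x / (γ₁ x * γ₂ x)) l (𝓝 c)

/-- `f` is comparable to a member of `Γ`. -/
def HasGauge (l : Filter ℝ) (Γ : Set (ℝ → ℝ)) (f : ℝ → ℝ) : Prop :=
  ∃ γ ∈ Γ, ∃ C : ℝ, C ≠ 0 ∧ Tendsto (fun x => f x / γ x) l (𝓝 C)

namespace EndGauge

variable {l : Filter ℝ} {Γ : Set (ℝ → ℝ)} {τ : ℝ → ℝ}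

theorem eventually_ne (_h : EndGauge l Γ τ) {f : ℝ → ℝ} (hf : HasGauge l Γ f) :
    ∀ᶠ x in l, f x ≠ 0 := by
  obtain ⟨γ, _, C, hC, ht⟩ := hf
  filter_upwards [ht.eventually_ne hC] with x hx h0
  exact hx (by rw [h0, zero_div])

/-- The transform is the Wronskian of ψ and y divided by ψ. That Wronskian tends to zero with
derivative (e₀ - e) ψ y, so l'Hôpital's rule compares it with γ₁ γ₂ τ, and dividing by ψ leaves γ₂
τ. -/
theorem darboux (h : EndGauge l Γ τ) {V : Set ℝ} (hV : ∀ᶠ x in l, x ∈ V) {U : ℝ → ℝ} {e₀ e : ℝ}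
    {ψ y : ℝ → ℝ} (hψ : SolOn V U e₀ ψ) (hy : SolOn V U e y) (hne : e₀ ≠ e) {γ₁ γ₂ : ℝ → ℝ}
    (hγ₁ : γ₁ ∈ Γ) (hγ₂ : γ₂ ∈ Γ) {C₁ C₂ : ℝ} (hC₁ : C₁ ≠ 0) (hC₂ : C₂ ≠ 0)
    (h₁ : Tendsto (fun x => ψ x / γ₁ x) l (𝓝 C₁)) (h₂ : Tendsto (fun x => y x / γ₂ x) l (𝓝 C₂))
    (hW : Tendsto (wr₂ ψ y) l (𝓝 0)) :
    ∃ C : ℝ, C ≠ 0 ∧ Tendsto (fun x => Duality.darboux ψ y x / (γ₂ x * τ x)) l (𝓝 C) := by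
  obtain ⟨g', hg', c, hc, hlim⟩ := h.hasDerivAt γ₁ hγ₁ γ₂ hγ₂
  have key := h.lhopital (f := wr₂ ψ y) (f' := fun x => (e₀ - e) * (ψ x * y x))
    (g := fun x => γ₁ x * γ₂ x * τ x) (g' := g') (c := (e₀ - e) * (C₁ * C₂) / c)
    (by filter_upwards [hV] with x hx using hψ.hasDerivAt_wr₂ hy hx) hg'
    (by
      filter_upwards [hlim.eventually_ne hc] with x hx h0
      exact hx (by rw [h0, zero_div])) hW (h.tendsto_zero γ₁ hγ₁ γ₂ hγ₂)
    (by
      refine (((h₁.mul h₂).const_mul (e₀ - e)).div hlim hc).congr' ?_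
      filter_upwards [h.ne_zero γ₁ hγ₁, h.ne_zero γ₂ hγ₂, hlim.eventually_ne hc] with x h1 h2 h3
      have h4 : g' x ≠ 0 := fun h0 => h3 (by rw [h0, zero_div])
      simp only [Pi.div_apply]
      field_simp)
  refine ⟨_, ?_, (key.div h₁ hC₁).congr' ?_⟩
  · exact div_ne_zero (div_ne_zero (mul_ne_zero (sub_ne_zero.2 hne) (mul_ne_zero hC₁ hC₂)) hc) hC₁
  · filter_upwards [h.ne_zero γ₁ hγ₁, h.ne_zero _ (h.mul_mem γ₂ hγ₂), h₁.eventually_ne hC₁]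
      with x h1 h2 h3
    have h4 : ψ x ≠ 0 := fun h0 => h3 (by rw [h0, zero_div])
    have h5 : γ₂ x ≠ 0 := left_ne_zero_of_mul h2
    have h6 : τ x ≠ 0 := right_ne_zero_of_mul h2
    simp only [wr₂, Duality.darboux, Pi.div_apply]
    field_simp

theorem tendsto_mul (h : EndGauge l Γ τ) {y z : ℝ → ℝ} {γ₁ γ₂ : ℝ → ℝ} (hγ₁ : γ₁ ∈ Γ)
    (hγ₂ : γ₂ ∈ Γ) {C₁ C₂ : ℝ} (h₁ : Tendsto (fun x => y x / γ₁ x) l (𝓝 C₁))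
    (h₂ : Tendsto (fun x => z x / (γ₂ x * τ x)) l (𝓝 C₂)) :
    Tendsto (fun x => y x * z x) l (𝓝 0) := by
  have := (h₁.mul h₂).mul (h.tendsto_zero γ₁ hγ₁ γ₂ hγ₂)
  rw [mul_zero] at this
  refine this.congr' ?_
  filter_upwards [h.ne_zero γ₁ hγ₁, h.ne_zero _ (h.mul_mem γ₂ hγ₂)] with x h1 h2
  have h5 : γ₂ x ≠ 0 := left_ne_zero_of_mul h2
  have h6 : τ x ≠ 0 := right_ne_zero_of_mul h2
  field_simp

end EndGauge

/-- The behaviour of the functions `F a`, `a ∈ L`, at an end of the interval: they are comparable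
to members of `Γ` and their mutual Wronskians tend to zero. -/
def EndBehavior {α : Type*} (l : Filter ℝ) (Γ : Set (ℝ → ℝ)) (L : List α) (F : α → ℝ → ℝ) : Prop :=
  (∀ a ∈ L, HasGauge l Γ (F a)) ∧ ∀ a ∈ L, ∀ b ∈ L, Tendsto (wr₂ (F a) (F b)) l (𝓝 0)

section

variable {α : Type*} {l : Filter ℝ} {Γ : Set (ℝ → ℝ)} {τ : ℝ → ℝ} {V : Set ℝ} {U : ℝ → ℝ}
  {ε : α → ℝ} {F : α → ℝ → ℝ} {a : α} {L : List α}

theorem EndBehavior.tendsto_mul_darboux (h : EndGauge l Γ τ) (hV : ∀ᶠ x in l, x ∈ V)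
    (hF : ∀ b ∈ a :: L, SolOn V U (ε b) (F b)) (hε : ∀ b ∈ L, ε a ≠ ε b)
    (hB : EndBehavior l Γ (a :: L) F) {b c : α} (hb : b ∈ a :: L) (hc : c ∈ L) :
    Tendsto (fun x => F b x * darboux (F a) (F c) x) l (𝓝 0) := by
  have hc' := List.mem_cons_of_mem a hc
  obtain ⟨γ₁, hγ₁, C₁, hC₁, h₁⟩ := hB.1 a (by simp)
  obtain ⟨γ₂, hγ₂, C₂, hC₂, h₂⟩ := hB.1 c hc'
  obtain ⟨γ₃, hγ₃, C₃, hC₃, h₃⟩ := hB.1 b hb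
  obtain ⟨C, _, h₄⟩ := h.darboux hV (hF a (by simp)) (hF c hc') (hε c hc) hγ₁ hγ₂ hC₁ hC₂ h₁ h₂
    (hB.2 a (by simp) c hc')
  exact h.tendsto_mul hγ₃ hγ₂ h₃ h₄

/-- The gauges are multiplied by τ. The Wronskian of two transforms is a combination of products of
an original function with a transform, each of which tends to zero; thus the hypotheses reproduce
themselves under iteration. -/
theorem EndBehavior.darboux (h : EndGauge l Γ τ) (hV : ∀ᶠ x in l, x ∈ V)
    (hF : ∀ b ∈ a :: L, SolOn V U (ε b) (F b)) (hε : ∀ b ∈ L, ε a ≠ ε b)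
    (hB : EndBehavior l Γ (a :: L) F) : EndBehavior l Γ L fun b => darboux (F a) (F b) := by
  refine ⟨fun b hb => ?_, fun b hb c hc => ?_⟩
  · have hb' := List.mem_cons_of_mem a hb
    obtain ⟨γ₁, hγ₁, C₁, hC₁, h₁⟩ := hB.1 a (by simp)
    obtain ⟨γ₂, hγ₂, C₂, hC₂, h₂⟩ := hB.1 b hb'
    obtain ⟨C, hC, h₄⟩ := h.darboux hV (hF a (by simp)) (hF b hb') (hε b hb) hγ₁ hγ₂ hC₁ hC₂ h₁ h₂
      (hB.2 a (by simp) b hb')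
    exact ⟨_, h.mul_mem γ₂ hγ₂, C, hC, h₄⟩
  · have e1 := (hB.tendsto_mul_darboux h hV hF hε (List.mem_cons_of_mem a hc) hb).const_mul
      (ε a - ε c)
    have e2 := (hB.tendsto_mul_darboux h hV hF hε (List.mem_cons_of_mem a hb) hc).const_mul
      (ε a - ε b)
    have e3 := e1.sub e2
    rw [mul_zero, mul_zero, sub_zero] at e3
    refine e3.congr' ?_
    filter_upwards [hV, h.eventually_ne (hB.1 a (by simp))] with x hx hax
    have d := fun d hd => (hasDerivAt_darboux (hF a (by simp))
      (hF d (List.mem_cons_of_mem a hd)) hx hax).deriv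
    rw [wr₂, d b hb, d c hc]
    ring

/-! ### The boundary form -/

theorem eventually_ne_of_meromorphicAt {f : ℝ → ℝ} {z : ℝ} (hf : MeromorphicAt f z)
    (hV : ∀ᶠ x in 𝓝[≠] z, x ∈ V)
    (hnv : ∀ J ⊆ V, IsOpen J → J.Nonempty → ∃ x ∈ J, f x ≠ 0) : ∀ᶠ x in 𝓝[≠] z, f x ≠ 0 := by
  refine hf.eventually_eq_zero_or_eventually_ne_zero.resolve_left fun h0 => ?_
  obtain ⟨O, hO, hzO, hsub⟩ := mem_nhdsWithin.1 (hV.and h0)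
  have hJ : (O ∩ {z}ᶜ).Nonempty :=
    NeBot.nonempty_of_mem (f := 𝓝[≠] z) inferInstance
      (inter_mem (mem_nhdsWithin_of_mem_nhds (hO.mem_nhds hzO)) self_mem_nhdsWithin)
  obtain ⟨x, hx, hfx⟩ := hnv _ (fun x hx => (hsub hx).1) (hO.inter isOpen_compl_singleton) hJ
  exact hfx (hsub hx).2

/-- The boundary form of the multiple Darboux transformation: an explicit primitive of
`(W[F_L, F_m] / W[F_L])² - ∏ (ε_m - ε_b) F_m²`, meromorphic on `I` and vanishing at the ends. -/
theorem exists_boundary_form {I : Set ℝ} {m : α} :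
    ∀ {V : Set ℝ} {U : ℝ → ℝ} {F : α → ℝ → ℝ}, (L ++ [m]).Pairwise (fun a b => ε a ≠ ε b) →
      IsOpen V → (∀ z ∈ I, ∀ᶠ x in 𝓝[≠] z, x ∈ V) →
      (∀ b ∈ L ++ [m], SolOn V U (ε b) (F b)) → (∀ b ∈ L ++ [m], MeromorphicOn (F b) I) →
      (∀ b ∈ L ++ [m], ∀ J ⊆ V, IsOpen J → J.Nonempty → ∃ x ∈ J, F b x ≠ 0) →
      ∃ (B : ℝ → ℝ) (V' : Set ℝ), IsOpen V' ∧ V' ⊆ V ∧ (∀ z ∈ I, ∀ᶠ x in 𝓝[≠] z, x ∈ V') ∧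
        MeromorphicOn B I ∧
        (∀ x ∈ V', HasDerivAt B ((wronskian ((L ++ [m]).map F) x / wronskian (L.map F) x) ^ 2 -
          (L.map fun b => ε m - ε b).prod * F m x ^ 2) x) ∧
        ∀ l Γ τ, EndGauge l Γ τ → (∀ᶠ x in l, x ∈ V) → EndBehavior l Γ (L ++ [m]) F →
          Tendsto B l (𝓝 0) ∧ ∀ᶠ x in l, x ∈ V' := by
  induction L with
  | nil =>
    intro V U F _ hV hcod _ _ _
    refine ⟨fun _ => 0, V, hV, le_rfl, hcod, fun z _ => MeromorphicAt.const 0 z, fun x _ => ?_,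
      fun l Γ τ _ hl _ => ⟨tendsto_const_nhds, hl⟩⟩
    refine (hasDerivAt_const x (0 : ℝ)).congr_deriv ?_
    simp
  | cons a L ih =>
    intro V U F hε hV hcod hF hM hnv
    rw [List.cons_append] at hε hF hM hnv
    have ha : a ∈ a :: (L ++ [m]) := by simp
    have hmL : m ∈ L ++ [m] := by simp
    have hm : m ∈ a :: (L ++ [m]) := List.mem_cons_of_mem a hmL
    obtain ⟨hεa, hε'⟩ := List.pairwise_cons.1 hε
    -- The first seed may vanish inside `I`. Its zeros are isolated, so the formulas are used off a
    -- discrete set while meromorphy holds throughout.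
    have hV₁ : IsOpen (V ∩ {x | F a x ≠ 0}) := by
      rw [isOpen_iff_mem_nhds]
      rintro x ⟨hx, hx0⟩
      exact inter_mem (hV.mem_nhds hx) (((hF a ha).smooth x hx).continuousAt.eventually_ne hx0)
    have hsub : V ∩ {x | F a x ≠ 0} ⊆ V := Set.inter_subset_left
    have hne : ∀ x ∈ V ∩ {x | F a x ≠ 0}, F a x ≠ 0 := fun x hx => hx.2
    have hFV := fun b hb => (hF b hb).mono hsub
    obtain ⟨B, V', hV'o, hV'V, hV'c, hBM, hBd, hBl⟩ := ih (V := V ∩ {x | F a x ≠ 0})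
      (U := darbouxU U (ε a) (F a)) (F := fun b => darboux (F a) (F b)) hε' hV₁
      (fun z hz => (hcod z hz).and
        (eventually_ne_of_meromorphicAt (hM a ha z hz) (hcod z hz) (hnv a ha)))
      (fun b hb => (hFV a ha).darboux hV₁ hne (hFV b (List.mem_cons_of_mem a hb)))
      (fun b hb => by
        have h1 := hM a ha
        have h2 := hM b (List.mem_cons_of_mem a hb)
        intro z hz
        exact (h2 z hz).deriv.sub (((h1 z hz).deriv.div (h1 z hz)).mul (h2 z hz)))
      (fun b hb J hJ hJo hJn => by
        have hb' := List.mem_cons_of_mem a hb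
        exact darboux_not_eqOn_zero hJo ((hFV a ha).mono hJ) (fun x hx => (hJ hx).2)
          ((hFV b hb').mono hJ) (hεa b hb).symm (hnv b hb' J (hJ.trans hsub) hJo hJn))
    set κ : ℝ := (L.map fun b => ε m - ε b).prod with hκ
    -- One reduction step: (F_m · DF_m)' = (DF_m)² - (ε_m - ε_a) F_m². Weighted by κ it replaces κ
    -- (DF_m)², left over from the induction, by the full product times F_m².
    refine ⟨fun x => κ * (F m x * darboux (F a) (F m) x) + B x, V', hV'o, hV'V.trans hsub, hV'c,
      fun z hz => ?_, fun x hx => ?_, fun l Γ τ hG hl hB => ?_⟩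
    · have h1 := hM a ha z hz
      have h2 := hM m hm z hz
      exact (((MeromorphicAt.const κ z).mul (h2.mul
        (h2.deriv.sub ((h1.deriv.div h1).mul h2)))).add (hBM z hz))
    · have hxV := hV'V hx
      have hsm : ∀ L' : List α, (∀ b ∈ L', b ∈ a :: (L ++ [m])) → ∀ f ∈ L'.map F,
          ContDiffAt ℝ ∞ f x := by
        intro L' hL' f hf
        obtain ⟨b, hb, rfl⟩ := List.mem_map.1 hf
        exact (hF b (hL' b hb)).smooth x hxV.1
      have e1 : wronskian ((a :: L).map F) x =
          F a x * wronskian (L.map fun b => darboux (F a) (F b)) x := by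
        rw [List.map_cons, wronskian_cons ((hF a ha).smooth x hxV.1)
          (hsm L fun b hb => by simp [hb]) hxV.2, List.map_map]
        rfl
      have e2 : wronskian ((a :: L ++ [m]).map F) x =
          F a x * wronskian ((L ++ [m]).map fun b => darboux (F a) (F b)) x := by
        rw [List.cons_append, List.map_cons, wronskian_cons ((hF a ha).smooth x hxV.1)
          (hsm (L ++ [m]) fun b hb => List.mem_cons_of_mem a hb) hxV.2, List.map_map]
        rfl
      have d1 := (((hF m hm).hasDerivAt hxV.1).mul
        (hasDerivAt_darboux (hF a ha) (hF m hm) hxV.1 hxV.2)).const_mul κ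
      refine (d1.add (hBd x hx)).congr_deriv ?_
      rw [e1, e2, mul_div_mul_left _ _ hxV.2, List.map_cons, List.prod_cons, ← hκ]
      simp only [Duality.darboux]
      ring
    · rw [List.cons_append] at hB
      obtain ⟨h1, h2⟩ := hBl l Γ τ hG (hl.and (hG.eventually_ne (hB.1 a ha)))
        (hB.darboux hG hl hF hεa)
      refine ⟨?_, h2⟩
      have := ((hB.tendsto_mul_darboux hG hl hF hεa hm hmL).const_mul κ).add h1
      rwa [mul_zero, add_zero] at this

end

/-- A meromorphic function whose difference with a continuous function is locally constant off a
discrete set differs from it by a constant off a discrete set. -/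
theorem exists_eventually_sub_eq {I : Set ℝ} (hI : I.OrdConnected) (hne : I.Nonempty) {B G : ℝ → ℝ}
    {V : Set ℝ} (hc : ∀ z ∈ I, ∀ᶠ x in 𝓝[≠] z, x ∈ V)
    (hB : MeromorphicOn B I) (hG : ∀ x ∈ I, ContinuousAt G x)
    (hd : ∀ x ∈ V, HasDerivAt (fun t => B t - G t) 0 x) :
    ∃ c : ℝ, ∀ z ∈ I, ∀ᶠ x in 𝓝[≠] z, B x - G x = c := by
  have hloc : ∀ z ∈ I, ∃ c : ℝ, ∀ᶠ x in 𝓝[≠] z, B x - G x = c := by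
    intro z hz
    obtain ⟨δ, hδ, hball⟩ := Metric.mem_nhdsWithin_iff.1 (hc z hz)
    have hconst : ∀ J ⊆ Metric.ball z δ ∩ {z}ᶜ, IsOpen J → IsPreconnected J → ∀ x ∈ J, ∀ y ∈ J,
        B x - G x = B y - G y := by
      intro J hJ hJo hJp x hx y hy
      exact hJo.is_const_of_deriv_eq_zero hJp
        (fun t ht => (hd t (hball (hJ ht))).differentiableAt.differentiableWithinAt)
        (fun t ht => (hd t (hball (hJ ht))).deriv) hx hy
    have hR : Set.Ioo z (z + δ) ⊆ Metric.ball z δ ∩ {z}ᶜ := fun x hx =>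
      ⟨by rw [Real.ball_eq_Ioo]; exact ⟨by linarith [hx.1], hx.2⟩, ne_of_gt hx.1⟩
    have hL : Set.Ioo (z - δ) z ⊆ Metric.ball z δ ∩ {z}ᶜ := fun x hx =>
      ⟨by rw [Real.ball_eq_Ioo]; exact ⟨hx.1, by linarith [hx.2]⟩, ne_of_lt hx.2⟩
    have hcR : ∀ᶠ x in 𝓝[>] z, B x - G x = B (z + δ / 2) - G (z + δ / 2) := by
      filter_upwards [Ioo_mem_nhdsGT (show z < z + δ by linarith)] with x hx
      exact hconst _ hR isOpen_Ioo isPreconnected_Ioo x hx _ ⟨by linarith, by linarith⟩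
    have hcL : ∀ᶠ x in 𝓝[<] z, B x - G x = B (z - δ / 2) - G (z - δ / 2) := by
      filter_upwards [Ioo_mem_nhdsLT (show z - δ < z by linarith)] with x hx
      exact hconst _ hL isOpen_Ioo isPreconnected_Ioo x hx _ ⟨by linarith, by linarith⟩
    have hleR : 𝓝[>] z ≤ 𝓝[≠] z := nhdsWithin_mono _ fun x hx => ne_of_gt hx
    have hleL : 𝓝[<] z ≤ 𝓝[≠] z := nhdsWithin_mono _ fun x hx => ne_of_lt hx
    have hBR : Tendsto B (𝓝[>] z) (𝓝 (B (z + δ / 2) - G (z + δ / 2) + G z)) := by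
      have : Tendsto (fun x => B (z + δ / 2) - G (z + δ / 2) + G x) (𝓝[>] z)
          (𝓝 (B (z + δ / 2) - G (z + δ / 2) + G z)) :=
        ((hG z hz).tendsto.mono_left nhdsWithin_le_nhds).const_add _
      refine this.congr' ?_
      filter_upwards [hcR] with x hx
      rw [← hx]; ring
    have hBL : Tendsto B (𝓝[<] z) (𝓝 (B (z - δ / 2) - G (z - δ / 2) + G z)) := by
      have : Tendsto (fun x => B (z - δ / 2) - G (z - δ / 2) + G x) (𝓝[<] z)
          (𝓝 (B (z - δ / 2) - G (z - δ / 2) + G z)) :=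
        ((hG z hz).tendsto.mono_left nhdsWithin_le_nhds).const_add _
      refine this.congr' ?_
      filter_upwards [hcL] with x hx
      rw [← hx]; ring
    -- A pole is impossible because the one-sided limits are finite. Meromorphy then yields a
    -- two-sided limit, so the constants on both sides agree.
    have hlim : ∃ b, Tendsto B (𝓝[≠] z) (𝓝 b) := by
      rw [tendsto_nhds_iff_meromorphicOrderAt_nonneg (hB z hz)]
      by_contra! hneg
      have h1 := (tendsto_norm_atTop_iff_cobounded.2
        (tendsto_cobounded_of_meromorphicOrderAt_neg hneg)).mono_left hleR
      exact not_tendsto_atTop_of_tendsto_nhds hBR.norm h1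
    obtain ⟨b, hb⟩ := hlim
    have e1 := tendsto_nhds_unique hBR (hb.mono_left hleR)
    have e2 := tendsto_nhds_unique hBL (hb.mono_left hleL)
    refine ⟨b - G z, ?_⟩
    rw [← Set.Iio_union_Ioi, nhdsWithin_union, eventually_sup]
    constructor
    · filter_upwards [hcL] with x hx
      rw [hx]; linarith
    · filter_upwards [hcR] with x hx
      rw [hx]; linarith
  obtain ⟨z₀, hz₀⟩ := hne
  obtain ⟨c, hc₀⟩ := hloc z₀ hz₀
  refine ⟨c, ?_⟩
  have hopen : ∀ p : ℝ → Prop, IsOpen {z : ℝ | ∀ᶠ x in 𝓝[≠] z, p x} := by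
    intro p
    rw [isOpen_iff_mem_nhds]
    intro z hz
    rw [mem_nhds_iff]
    obtain ⟨O, hO, hzO, hsub⟩ := mem_nhdsWithin.1 hz
    refine ⟨O, fun y hy => ?_, hO, hzO⟩
    by_cases hyz : y = z
    · rw [hyz]; exact hz
    · have : O ∩ {z}ᶜ ∈ 𝓝 y := (hO.inter isOpen_compl_singleton).mem_nhds ⟨hy, hyz⟩
      exact mem_nhdsWithin_of_mem_nhds (mem_of_superset this hsub)
  -- The local constant is locally constant in z, hence constant on the connected interval.
  refine (hI.isPreconnected).subset_left_of_subset_union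
    (u := {z | ∀ᶠ x in 𝓝[≠] z, B x - G x = c})
    (v := ⋃ c' ∈ {c' : ℝ | c' ≠ c}, {z | ∀ᶠ x in 𝓝[≠] z, B x - G x = c'}) (hopen _)
    (isOpen_biUnion fun c' _ => hopen _) ?_ ?_ ⟨z₀, hz₀, hc₀⟩
  · rw [Set.disjoint_left]
    intro z hz hz'
    simp only [Set.mem_iUnion] at hz'
    obtain ⟨c', hc', hz'⟩ := hz'
    have hz₁ : ∀ᶠ x in 𝓝[≠] z, B x - G x = c := hz
    have hz₂ : ∀ᶠ x in 𝓝[≠] z, B x - G x = c' := hz'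
    obtain ⟨x, hx1, hx2⟩ := (hz₁.and hz₂).exists
    exact hc' (hx2.symm.trans hx1)
  · intro z hz
    obtain ⟨c', hc'⟩ := hloc z hz
    by_cases h : c' = c
    · left; rw [← h]; exact hc'
    · right
      simp only [Set.mem_iUnion]
      exact ⟨c', h, hc'⟩

namespace Eigensystem

variable {I : Set ℝ} {lL lR : Filter ℝ} {U : ℝ → ℝ} {ε : ℕ → ℝ} {φ : ℕ → ℝ → ℝ}

/-- If the Wronskian of the bound states `φ_e`, `e ∈ l`, has no zero, then
`∏ (ε n - ε e) ≥ 0` for all `n`. -/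
theorem prod_nonneg_of_wronskian_ne_zero [lL.NeBot] [lR.NeBot] (h : Eigensystem I lL lR U ε φ)
    (hA : ∀ n, AnalyticOnNhd ℝ (φ n) I) {ΓL ΓR : Set (ℝ → ℝ)} {τL τR : ℝ → ℝ}
    (hGL : EndGauge lL ΓL τL) (hGR : EndGauge lR ΓR τR) (hφL : ∀ n, HasGauge lL ΓL (φ n))
    (hφR : ∀ n, HasGauge lR ΓR (φ n)) {l : List ℕ} (hl : l.Nodup) (hne : I.Nonempty)
    (hW : ∀ x ∈ I, wronskian (l.map φ) x ≠ 0) (m : ℕ) : 0 ≤ (l.map fun e => ε m - ε e).prod := by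
  by_contra! hneg
  have hml : m ∉ l := fun hm => hneg.ne
    (List.prod_eq_zero (List.mem_map.2 ⟨m, hm, sub_self _⟩))
  have hnd : (l ++ [m]).Nodup := by
    rw [List.nodup_append]
    exact ⟨hl, by simp, fun a ha b hb hab => hml (by simp at hb; rw [← hb, ← hab]; exact ha)⟩
  have hend : ∀ l', (∀ x ∈ I, ∀ᶠ y in l', y ∈ I) → ∀ᶠ y in l', y ∈ I := fun l' hl' => by
    obtain ⟨x, hx⟩ := hne
    exact hl' x hx
  obtain ⟨B, V', hV'o, hV'I, hV'c, hBM, hBd, hBl⟩ := exists_boundary_form (I := I) (L := l) (m := m)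
    (ε := ε) (V := I) (U := U) (F := φ) (h.pairwise_ne hnd) h.isOpen
    (fun z hz => mem_nhdsWithin_of_mem_nhds (h.isOpen.mem_nhds hz)) (fun b _ => h.sol b)
    (fun b _ => (hA b).meromorphicOn) (fun b _ => h.nonvanishing b)
  set Ψ : ℝ → ℝ := fun x => wronskian ((l ++ [m]).map φ) x / wronskian (l.map φ) x with hΨ
  set p : ℝ := (l.map fun e => ε m - ε e).prod with hp
  set q : ℝ → ℝ := fun x => Ψ x ^ 2 - p * φ m x ^ 2 with hq
  have hcW : ∀ L : List ℕ, ∀ x ∈ I, ContinuousAt (wronskian (L.map φ)) x := fun L x hx =>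
    (contDiffAt_wronskian fun f hf => by
      obtain ⟨b, _, rfl⟩ := List.mem_map.1 hf
      exact (h.sol b).smooth x hx).continuousAt
  -- Although the intermediate Wronskians in B may vanish, the integrand involves only the final
  -- denominator, which has no zero.
  have hqc : ∀ x ∈ I, ContinuousAt q x := fun x hx =>
    (((hcW _ x hx).div (hcW _ x hx) (hW x hx)).pow 2).sub
      ((((h.sol m).smooth x hx).continuousAt.pow 2).const_mul p)
  obtain ⟨x₀, hx₀⟩ := hne
  set G : ℝ → ℝ := fun x => ∫ t in x₀..x, q t with hGdef
  have hGd : ∀ x ∈ I, HasDerivAt G (q x) x := by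
    intro x hx
    refine intervalIntegral.integral_hasDerivAt_right ?_ ?_ (hqc x hx)
    · exact ContinuousOn.intervalIntegrable fun t ht =>
        (hqc t (h.ordConnected.uIcc_subset hx₀ hx ht)).continuousWithinAt
    · exact ContinuousOn.stronglyMeasurableAtFilter h.isOpen
        (fun t ht => (hqc t ht).continuousWithinAt) x hx
  -- B and G have the same derivative off a discrete set. Apparent poles of B thus cause no jumps,
  -- and the boundary values of B determine those of G.
  obtain ⟨c, hc⟩ := exists_eventually_sub_eq h.ordConnected ⟨x₀, hx₀⟩ hV'c hBM
    (fun x hx => (hGd x hx).continuousAt)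
    (fun x hx => ((hBd x hx).sub (hGd x (hV'I hx))).congr_deriv (by rw [hq]; ring))
  have hcV : ∀ x ∈ V', B x - G x = c := by
    intro x hx
    have h1 : ContinuousAt (fun t => B t - G t) x :=
      ((hBd x hx).sub (hGd x (hV'I hx))).continuousAt
    exact tendsto_nhds_unique (h1.tendsto.mono_left nhdsWithin_le_nhds)
      (Tendsto.congr' (EventuallyEq.symm (hc x (hV'I hx))) tendsto_const_nhds)
  have hGlim : ∀ (l' : Filter ℝ) (Γ : Set (ℝ → ℝ)) (τ : ℝ → ℝ), EndGauge l' Γ τ →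
      (∀ᶠ x in l', x ∈ I) → (∀ n, HasGauge l' Γ (φ n)) →
      (∀ a b, Tendsto (wr₂ (φ a) (φ b)) l' (𝓝 0)) → Tendsto G l' (𝓝 (-c)) := by
    intro l' Γ τ hG' hI' hφ' hwr
    obtain ⟨h1, h2⟩ := hBl l' Γ τ hG' hI' ⟨fun a _ => hφ' a, fun a _ b _ => hwr a b⟩
    have h3 := h1.sub_const c
    rw [zero_sub] at h3
    refine h3.congr' ?_
    filter_upwards [h2] with x hx
    rw [← hcV x hx]; ring
  have hR := hGlim lR ΓR τR hGR ((h.right_mem x₀ hx₀).mono fun y hy => hy.1) hφR h.wr_right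
  have hL := hGlim lL ΓL τL hGL ((h.left_mem x₀ hx₀).mono fun y hy => hy.1) hφL h.wr_left
  -- With a negative product both parts of q are non-negative, so G increases between two equal
  -- limits and is constant. Then q = 0, against φ_m ≠ 0 somewhere.
  have hmono : MonotoneOn G I := by
    refine monotoneOn_of_deriv_nonneg h.ordConnected.convex
      (fun x hx => (hGd x hx).continuousAt.continuousWithinAt)
      (fun x hx => (hGd x (interior_subset hx)).differentiableAt.differentiableWithinAt)
      fun x hx => ?_
    rw [(hGd x (interior_subset hx)).deriv, hq]
    nlinarith [sq_nonneg (Ψ x), sq_nonneg (φ m x)]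
  have hconst : ∀ x ∈ I, G x = -c := by
    intro x hx
    refine le_antisymm ?_ ?_
    · refine ge_of_tendsto hR ?_
      filter_upwards [h.right_mem x hx] with y hy using hmono hx hy.1 hy.2.le
    · refine le_of_tendsto hL ?_
      filter_upwards [h.left_mem x hx] with y hy using hmono hy.1 hx hy.2.le
  obtain ⟨x, hx, hxm⟩ := h.nonvanishing m I le_rfl h.isOpen ⟨x₀, hx₀⟩
  have hE : G =ᶠ[𝓝 x] fun _ => -c := by
    filter_upwards [h.isOpen.mem_nhds hx] with t ht using hconst t ht
  have h1 : q x = 0 := by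
    rw [← (hGd x hx).deriv, hE.deriv_eq, deriv_const]
  have h2 : 0 < φ m x ^ 2 := by positivity
  rw [hq] at h1
  nlinarith [sq_nonneg (Ψ x)]

end Eigensystem

end

section

open Filter Set Topology MeasureTheory ProbabilityTheory
open scoped ContDiff

/-! ### The moment problem for functions with exponential decay -/

/-- Finite measures with finite exponential moments are determined by the moments of `X`. -/
theorem map_eq_map_of_integral_pow_eq {Ω : Type*} [MeasurableSpace Ω] {μ ν : Measure Ω}
    [IsFiniteMeasure μ] [IsFiniteMeasure ν] {X : Ω → ℝ} (hX : Measurable X) {t : ℝ} (ht : 0 < t)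
    (hμ : ∀ s ∈ Set.Ioo (-t) t, Integrable (fun a => Real.exp (s * X a)) μ)
    (hν : ∀ s ∈ Set.Ioo (-t) t, Integrable (fun a => Real.exp (s * X a)) ν)
    (h : ∀ n : ℕ, ∫ a, X a ^ n ∂μ = ∫ a, X a ^ n ∂ν) : μ.map X = ν.map X := by
  have hint : ∀ ρ : Measure Ω, (∀ s ∈ Set.Ioo (-t) t, Integrable (fun a => Real.exp (s * X a)) ρ) →
      Set.Ioo (-t) t ⊆ interior (integrableExpSet X ρ) := fun ρ hρ =>
    interior_maximal (fun s hs => hρ s hs) isOpen_Ioo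
  set S : Set ℂ := {z | z.re ∈ Set.Ioo (-t) t} with hS
  have hSo : IsOpen S := isOpen_Ioo.preimage Complex.continuous_re
  have hSc : IsPreconnected S :=
    ((convex_Ioo (-t) t).linear_preimage Complex.reLm).isPreconnected
  have h0S : (0 : ℂ) ∈ S := by simp [hS, ht]
  have hanμ : AnalyticOnNhd ℂ (complexMGF X μ) S := fun z hz =>
    analyticOnNhd_complexMGF z (hint μ hμ hz)
  have hanν : AnalyticOnNhd ℂ (complexMGF X ν) S := fun z hz =>
    analyticOnNhd_complexMGF z (hint ν hν hz)
  -- The moments are the Taylor coefficients at 0 of the complex moment generating functions, which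
  -- are analytic on a strip containing the imaginary axis. Equality near 0 spreads to that axis,
  -- where they are the characteristic functions.
  have hder : ∀ n, iteratedDeriv n (complexMGF X μ) 0 = iteratedDeriv n (complexMGF X ν) 0 := by
    intro n
    rw [iteratedDeriv_complexMGF (hint μ hμ h0S), iteratedDeriv_complexMGF (hint ν hν h0S)]
    simp only [zero_mul, Complex.exp_zero, mul_one]
    have := congrArg (fun r : ℝ => (r : ℂ)) (h n)
    simp only [← integral_complex_ofReal, Complex.ofReal_pow] at this
    exact this
  obtain ⟨r, hr, hball⟩ := Metric.isOpen_iff.1 hSo 0 h0S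
  have hE : complexMGF X μ =ᶠ[𝓝 0] complexMGF X ν := by
    filter_upwards [Metric.ball_mem_nhds (0 : ℂ) hr] with z hz
    have h1 := Complex.hasSum_taylorSeries_on_ball
      (hanμ.differentiableOn.mono hball) hz
    have h2 := Complex.hasSum_taylorSeries_on_ball
      (hanν.differentiableOn.mono hball) hz
    simp only [hder] at h1
    exact h1.unique h2
  have heq := hanμ.eqOn_of_preconnected_of_eventuallyEq hanν hSc h0S hE
  refine Measure.ext_of_charFun ?_
  funext s
  rw [← complexMGF_mul_I hX.aemeasurable, ← complexMGF_mul_I hX.aemeasurable]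
  exact heq (by simp [hS, ht])

/-- An integrable function with exponential decay all of whose moments with respect to an injective
function `X` vanish is zero. -/
theorem ae_eq_zero_of_integral_pow_mul_eq_zero {I : Set ℝ} (hI : MeasurableSet I) {X f : ℝ → ℝ}
    (hX : Continuous X) (hinj : Set.InjOn X I) {t : ℝ} (ht : 0 < t)
    (hexp : Integrable (fun x => Real.exp (t * |X x|) * |f x|) (volume.restrict I))
    (hf : AEStronglyMeasurable f (volume.restrict I))
    (h : ∀ n : ℕ, ∫ x in I, X x ^ n * f x = 0) : f =ᵐ[volume.restrict I] 0 := by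
  set μ := volume.restrict I with hμ
  have hdom : ∀ s ∈ Set.Ioo (-t) t, ∀ x, Real.exp (s * X x) ≤ Real.exp (t * |X x|) := by
    intro s hs x
    refine Real.exp_le_exp.2 ((le_abs_self _).trans ?_)
    rw [abs_mul]
    exact mul_le_mul_of_nonneg_right (abs_le.2 ⟨hs.1.le, hs.2.le⟩) (abs_nonneg _)
  have hfi : Integrable f μ := hexp.mono hf (Eventually.of_forall fun x => by
    rw [Real.norm_eq_abs, Real.norm_eq_abs, abs_mul, abs_abs, Real.abs_exp]
    have h1 : 1 ≤ Real.exp (t * |X x|) := Real.one_le_exp (by positivity)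
    nlinarith [abs_nonneg (f x)])
  have hpowi : ∀ n : ℕ, Integrable (fun x => X x ^ n * f x) μ := by
    intro n
    refine (hexp.const_mul (n.factorial / t ^ n)).mono
      ((hX.pow n).aestronglyMeasurable.mul hf) (Eventually.of_forall fun x => ?_)
    rw [norm_mul, Real.norm_eq_abs, Real.norm_eq_abs, Real.norm_of_nonneg (by positivity), abs_pow,
      ← mul_assoc]
    refine mul_le_mul_of_nonneg_right ?_ (abs_nonneg _)
    have := Real.pow_div_factorial_le_exp (t * |X x|) (by positivity) n
    rw [mul_pow, div_le_iff₀ (by positivity)] at this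
    rw [div_mul_eq_mul_div, le_div_iff₀ (by positivity)]
    linarith
  -- Used for g = f and g = -f: the positive and negative parts of f are densities of two finite
  -- measures with exponential moments.
  have hgen : ∀ g : ℝ → ℝ, AEStronglyMeasurable g μ → (∀ x, |g x| ≤ |f x|) →
      IsFiniteMeasure (μ.withDensity fun x => ((g x).toNNReal : ENNReal)) ∧
      (∀ s ∈ Set.Ioo (-t) t, Integrable (fun x => Real.exp (s * X x))
        (μ.withDensity fun x => ((g x).toNNReal : ENNReal))) ∧
      ∀ n : ℕ, ∫ x, X x ^ n ∂(μ.withDensity fun x => ((g x).toNNReal : ENNReal)) =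
        ∫ x, max (g x) 0 * X x ^ n ∂μ := by
    intro g hg hgf
    have hgm : AEMeasurable (fun x => (g x).toNNReal) μ := hg.aemeasurable.real_toNNReal
    have hgi : Integrable g μ := hfi.mono hg (Eventually.of_forall hgf)
    refine ⟨?_, fun s hs => ?_, fun n => ?_⟩
    · exact isFiniteMeasure_withDensity_ofReal hgi.2
    · rw [integrable_withDensity_iff_integrable_coe_smul₀ hgm]
      refine hexp.mono (hgm.coe_nnreal_real.aestronglyMeasurable.smul
        (by fun_prop)) (Eventually.of_forall fun x => ?_)
      rw [smul_eq_mul, norm_mul, norm_mul, Real.norm_eq_abs, Real.norm_eq_abs, Real.norm_eq_abs,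
        Real.norm_eq_abs, Real.abs_exp, Real.abs_exp, abs_abs, Real.coe_toNNReal', mul_comm]
      refine mul_le_mul (hdom s hs x) (le_trans ?_ (hgf x)) (abs_nonneg _) (Real.exp_nonneg _)
      rw [abs_of_nonneg (le_max_right _ _)]
      exact max_le (le_abs_self _) (abs_nonneg _)
    · rw [integral_withDensity_eq_integral_smul₀ hgm]
      rfl
  obtain ⟨fin₁, int₁, mom₁⟩ := hgen f hf fun x => le_rfl
  obtain ⟨fin₂, int₂, mom₂⟩ := hgen (fun x => -f x) hf.neg fun x => (abs_neg _).le
  have hmap := map_eq_map_of_integral_pow_eq hX.measurable ht int₁ int₂ fun n => by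
    rw [mom₁, mom₂, ← sub_eq_zero, ← integral_sub]
    · refine Eq.trans ?_ (h n)
      refine integral_congr_ae (Eventually.of_forall fun x => ?_)
      simp only
      rw [← sub_mul, max_zero_sub_eq_self, mul_comm]
    · refine (hpowi n).mono (by fun_prop) (Eventually.of_forall fun x => ?_)
      rw [norm_mul, norm_mul, mul_comm]
      refine mul_le_mul_of_nonneg_left ?_ (norm_nonneg _)
      rw [Real.norm_eq_abs, abs_of_nonneg (le_max_right _ _), Real.norm_eq_abs]
      exact max_le (le_abs_self _) (abs_nonneg _)
    · refine (hpowi n).mono (by fun_prop) (Eventually.of_forall fun x => ?_)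
      rw [norm_mul, norm_mul, mul_comm]
      refine mul_le_mul_of_nonneg_left ?_ (norm_nonneg _)
      rw [Real.norm_eq_abs, abs_of_nonneg (le_max_right _ _), Real.norm_eq_abs]
      exact max_le (neg_le_abs _) (abs_nonneg _)
  refine hfi.ae_eq_zero_of_forall_setIntegral_eq_zero fun A hA _ => ?_
  -- Equality of the push-forwards under X returns to measurable subsets of `I` because X is
  -- injective there and injective continuous images of Borel sets are Borel.
  have hT : MeasurableSet (X '' (A ∩ I)) := (hA.inter hI).image_of_continuousOn_injOn
    hX.continuousOn (hinj.mono Set.inter_subset_right)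
  have hpre : X ⁻¹' (X '' (A ∩ I)) ∩ I = A ∩ I := by
    ext x
    refine ⟨?_, fun hx => ⟨⟨x, hx, rfl⟩, hx.2⟩⟩
    rintro ⟨⟨y, hy, hyx⟩, hx⟩
    rwa [← hinj hy.2 hx hyx]
  have hval : ∀ g : ℝ → ℝ, (μ.withDensity fun x => ((g x).toNNReal : ENNReal)).map X (X '' (A ∩ I))
      = ∫⁻ x in A, ENNReal.ofReal (g x) ∂μ := by
    intro g
    rw [Measure.map_apply hX.measurable hT, withDensity_apply _ (hX.measurable hT), hμ,
      Measure.restrict_restrict (hX.measurable hT), hpre, Measure.restrict_restrict hA]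
    rfl
  rw [integral_eq_lintegral_pos_part_sub_lintegral_neg_part hfi.integrableOn, ← hval,
    ← hval fun x => -f x, hmap, sub_self]

/-! ### Weighted polynomials -/

/-- `ρ²` is a weight with exponential decay with respect to the variable `η`. -/
structure Weight (I : Set ℝ) (η ρ : ℝ → ℝ) (t : ℝ) : Prop where
  isOpen : IsOpen I
  continuous : Continuous η
  injOn : Set.InjOn η I
  continuousOn : ContinuousOn ρ I
  ne_zero : ∀ x ∈ I, ρ x ≠ 0
  pos : 0 < t
  memLp : MemLp (fun x => Real.exp (t * |η x|) * ρ x) 2 (volume.restrict I)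

namespace Weight

variable {I : Set ℝ} {η ρ : ℝ → ℝ} {t : ℝ}

theorem aestronglyMeasurable (h : Weight I η ρ t) :
    AEStronglyMeasurable ρ (volume.restrict I) :=
  h.continuousOn.aestronglyMeasurable h.isOpen.measurableSet

/-- Powers of η are dominated by the exponential: |η|ⁿ ≤ n!/tⁿ · exp(t|η|). -/
theorem memLp_poly (h : Weight I η ρ t) (q : Polynomial ℝ) :
    MemLp (fun x => ρ x * q.eval (η x)) 2 (volume.restrict I) := by
  induction q using Polynomial.induction_on' with
  | add p q hp hq =>
    simp only [Polynomial.eval_add, mul_add]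
    exact hp.add hq
  | monomial n a =>
    have hc := h.continuous
    have := h.pos
    refine (h.memLp.const_mul (|a| * (n.factorial / t ^ n))).mono
      (h.aestronglyMeasurable.mul (by fun_prop)) (Eventually.of_forall fun x => ?_)
    rw [Polynomial.eval_monomial, norm_mul, norm_mul, norm_mul (|a| * _),
      Real.norm_of_nonneg (show 0 ≤ |a| * (n.factorial / t ^ n) by positivity), norm_mul,
      Real.norm_eq_abs a, Real.norm_of_nonneg (Real.exp_nonneg _), norm_pow, Real.norm_eq_abs (η x)]
    have h1 := Real.pow_div_factorial_le_exp (t * |η x|) (by positivity) n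
    rw [mul_pow, div_le_iff₀ (by positivity)] at h1
    have h2 : |η x| ^ n ≤ n.factorial / t ^ n * Real.exp (t * |η x|) := by
      rw [div_mul_eq_mul_div, le_div_iff₀ (by positivity)]
      linarith
    calc ‖ρ x‖ * (|a| * |η x| ^ n) = |a| * |η x| ^ n * ‖ρ x‖ := by ring
      _ ≤ |a| * (n.factorial / t ^ n * Real.exp (t * |η x|)) * ‖ρ x‖ := by gcongr
      _ = _ := by ring

/-- One polynomial in every degree spans all polynomials, so all moments of u ρ in η vanish. Its
exponential decay comes from Hölder's inequality, and the moment problem applies. -/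
theorem complete (h : Weight I η ρ t) {P : ℕ → Polynomial ℝ} (hP : ∀ n, (P n).degree = n)
    {u : ℝ → ℝ} (hu : MemLp u 2 (volume.restrict I))
    (h0 : ∀ n, ∫ x in I, u x * (ρ x * (P n).eval (η x)) = 0) : u =ᵐ[volume.restrict I] 0 := by
  have hall : ∀ q : Polynomial ℝ, ∫ x in I, u x * (ρ x * q.eval (η x)) = 0 := by
    intro q
    let S : Polynomial.Sequence ℝ := ⟨P, hP⟩
    have hq : q ∈ Submodule.span ℝ (Set.range S) := by
      rw [S.span fun i => IsUnit.mk0 _ (Polynomial.leadingCoeff_ne_zero.2 (S.ne_zero i))]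
      trivial
    have hint : ∀ q : Polynomial ℝ, IntegrableOn (fun x => u x * (ρ x * q.eval (η x))) I :=
      fun q => hu.integrable_mul (h.memLp_poly q)
    induction hq using Submodule.span_induction with
    | mem q hq =>
      obtain ⟨n, rfl⟩ := hq
      exact h0 n
    | zero => simp
    | add p q _ _ hp hq =>
      simp only [Polynomial.eval_add, mul_add]
      rw [integral_add (hint p) (hint q), hp, hq, add_zero]
    | smul a q _ hq =>
      have e : ∀ x, u x * (ρ x * (a • q).eval (η x)) = a * (u x * (ρ x * q.eval (η x))) :=
        fun x => by rw [Polynomial.eval_smul, smul_eq_mul]; ring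
      simp only [e]
      rw [integral_const_mul, hq, mul_zero]
  have hz := ae_eq_zero_of_integral_pow_mul_eq_zero h.isOpen.measurableSet (f := fun x => u x * ρ x)
    h.continuous h.injOn h.pos
    (by
      refine (hu.integrable_mul h.memLp).norm.congr (Eventually.of_forall fun x => ?_)
      simp only [Pi.mul_apply, Real.norm_eq_abs, abs_mul, Real.abs_exp]
      ring)
    (hu.1.mul h.aestronglyMeasurable) fun n => by
      have := hall (Polynomial.X ^ n)
      simp only [Polynomial.eval_pow, Polynomial.eval_X] at this
      rw [← this]
      refine integral_congr_ae (Eventually.of_forall fun x => ?_)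
      simp only
      ring
  filter_upwards [hz, ae_restrict_mem h.isOpen.measurableSet] with x hx hxI
  exact (mul_eq_zero.1 hx).resolve_right (h.ne_zero x hxI)

end Weight

end

section

open Filter Set Topology MeasureTheory
open scoped ContDiff

/-! ### Gauges for regular singular ends and for Gaussian ends -/

/-- At a regular singular end the bound states behave like xᵃ with a > 0, and integrating a product
of two of them gains one factor x, which is τ. -/
theorem endGauge_zero : EndGauge (𝓝[>] (0 : ℝ))
    {γ | ∃ a : ℝ, 0 < a ∧ γ = fun x => Real.exp (a * Real.log x)}
    fun x => Real.exp (Real.log x) where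
  lhopital h1 h2 h3 h4 h5 h6 := HasDerivAt.lhopital_zero_nhdsGT h1 h2 h3 h4 h5 h6
  mul_mem := by
    rintro _ ⟨a, ha, rfl⟩
    refine ⟨a + 1, by linarith, ?_⟩
    funext x
    rw [← Real.exp_add]
    ring_nf
  ne_zero := by
    rintro _ ⟨a, ha, rfl⟩
    exact Eventually.of_forall fun x => Real.exp_ne_zero _
  tendsto_zero := by
    rintro _ ⟨a, ha, rfl⟩ _ ⟨b, hb, rfl⟩
    have : Tendsto (fun x => (a + b + 1) * Real.log x) (𝓝[>] (0 : ℝ)) atBot :=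
      Real.tendsto_log_nhdsGT_zero.const_mul_atBot (by linarith)
    refine (Real.tendsto_exp_atBot.comp this).congr fun x => ?_
    simp only [Function.comp, ← Real.exp_add]
    ring_nf
  hasDerivAt := by
    rintro _ ⟨a, ha, rfl⟩ _ ⟨b, hb, rfl⟩
    refine ⟨fun x => Real.exp ((a + b + 1) * Real.log x) * ((a + b + 1) * x⁻¹), ?_, a + b + 1,
      by positivity, ?_⟩
    · filter_upwards [self_mem_nhdsWithin] with x hx
      have hx0 : x ≠ 0 := ne_of_gt hx
      have e : (fun x => Real.exp (a * Real.log x) * Real.exp (b * Real.log x) *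
          Real.exp (Real.log x)) = fun x => Real.exp ((a + b + 1) * Real.log x) := by
        funext y
        rw [← Real.exp_add, ← Real.exp_add]
        ring_nf
      rw [e]
      exact ((Real.hasDerivAt_log hx0).const_mul _).exp
    · refine tendsto_const_nhds.congr' ?_
      filter_upwards [self_mem_nhdsWithin] with x hx
      have hx0 : 0 < x := hx
      have e : Real.exp ((a + b + 1) * Real.log x) =
          Real.exp (a * Real.log x) * Real.exp (b * Real.log x) * x := by
        nth_rw 4 [← Real.exp_log hx0]
        rw [← Real.exp_add, ← Real.exp_add]
        ring_nf
      rw [e]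
      have := Real.exp_ne_zero (a * Real.log x)
      have := Real.exp_ne_zero (b * Real.log x)
      field_simp

theorem tendsto_rpow_mul_exp_neg_sq (s : ℝ) {b : ℝ} (hb : 0 < b) :
    Tendsto (fun x : ℝ => x ^ s * Real.exp (-b * x ^ 2)) atTop (𝓝 0) := by
  refine squeeze_zero' ?_ ?_ (tendsto_rpow_mul_exp_neg_mul_atTop_nhds_zero s b hb)
  · filter_upwards [eventually_ge_atTop 0] with x hx
    positivity
  · filter_upwards [eventually_ge_atTop 1] with x hx
    refine mul_le_mul_of_nonneg_left (Real.exp_le_exp.2 ?_) (by positivity)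
    nlinarith [mul_pos hb (show 0 < x by linarith), mul_nonneg (mul_pos hb
      (show 0 < x by linarith)).le (sub_nonneg.2 hx)]

/-- At a Gaussian end the comparison functions are xᵃ exp(-x²/2). The derivative of a product of
two, divided by x, is asymptotic to -2 times that product, so here τ = 1/x. -/
theorem endGauge_atTop : EndGauge atTop
    {γ | ∃ a : ℝ, γ = fun x => Real.exp (a * Real.log x - x ^ 2 / 2)}
    fun x => Real.exp (-Real.log x) where
  lhopital h1 h2 h3 h4 h5 h6 := HasDerivAt.lhopital_zero_atTop h1 h2 h3 h4 h5 h6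
  mul_mem := by
    rintro _ ⟨a, rfl⟩
    refine ⟨a - 1, ?_⟩
    funext x
    rw [← Real.exp_add]
    ring_nf
  ne_zero := by
    rintro _ ⟨a, rfl⟩
    exact Eventually.of_forall fun x => Real.exp_ne_zero _
  tendsto_zero := by
    rintro _ ⟨a, rfl⟩ _ ⟨b, rfl⟩
    refine (tendsto_rpow_mul_exp_neg_sq (a + b - 1) one_pos).congr' ?_
    filter_upwards [eventually_gt_atTop 0] with x hx
    rw [Real.rpow_def_of_pos hx, ← Real.exp_add, ← Real.exp_add, ← Real.exp_add]
    ring_nf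
  hasDerivAt := by
    rintro _ ⟨a, rfl⟩ _ ⟨b, rfl⟩
    refine ⟨fun x => Real.exp ((a + b - 1) * Real.log x - x ^ 2) *
      ((a + b - 1) * x⁻¹ - 2 * x), ?_, -2, by norm_num, ?_⟩
    · filter_upwards [eventually_gt_atTop 0] with x hx
      have e : (fun x => Real.exp (a * Real.log x - x ^ 2 / 2) *
          Real.exp (b * Real.log x - x ^ 2 / 2) *
          Real.exp (-Real.log x)) = fun x => Real.exp ((a + b - 1) * Real.log x - x ^ 2) := by
        funext y
        rw [← Real.exp_add, ← Real.exp_add]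
        ring_nf
      rw [e]
      refine (((Real.hasDerivAt_log hx.ne').const_mul _).sub (hasDerivAt_pow 2 x)).exp.congr_deriv ?_
      simp
    · have h1 : Tendsto (fun x : ℝ => (a + b - 1) * (x⁻¹ * x⁻¹) - 2) atTop (𝓝 (-2)) := by
        have := ((tendsto_inv_atTop_zero.mul tendsto_inv_atTop_zero).const_mul (a + b - 1)).sub_const
          (2 : ℝ)
        simpa using this
      refine h1.congr' ?_
      filter_upwards [eventually_gt_atTop 0] with x hx
      have e : Real.exp ((a + b - 1) * Real.log x - x ^ 2) =
          Real.exp (a * Real.log x - x ^ 2 / 2) * Real.exp (b * Real.log x - x ^ 2 / 2) * x⁻¹ := by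
        have e' : x⁻¹ = Real.exp (-Real.log x) := by rw [Real.exp_neg, Real.exp_log hx]
        rw [e', ← Real.exp_add, ← Real.exp_add]
        ring_nf
      rw [e]
      have := Real.exp_ne_zero (a * Real.log x - x ^ 2 / 2)
      have := Real.exp_ne_zero (b * Real.log x - x ^ 2 / 2)
      field_simp

/-- Transport of gauges by a reflection. -/
theorem EndGauge.reflect {l : Filter ℝ} {Γ : Set (ℝ → ℝ)} {τ : ℝ → ℝ} (h : EndGauge l Γ τ)
    {σ : ℝ → ℝ} (hσ : ∀ x, σ (σ x) = x) (hd : ∀ x, HasDerivAt σ (-1) x) :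
    EndGauge (Filter.map σ l) ((fun γ => γ ∘ σ) '' Γ) (τ ∘ σ) where
  lhopital {f f' g g' c} h1 h2 h3 h4 h5 h6 := by
    rw [eventually_map] at h1 h2 h3
    rw [tendsto_map'_iff] at h4 h5 h6 ⊢
    refine h.lhopital (f := f ∘ σ) (f' := fun x => f' (σ x) * -1) (g := g ∘ σ)
      (g' := fun x => g' (σ x) * -1) ?_ ?_ ?_ h4 h5 ?_
    · filter_upwards [h1] with x hx using hx.comp x (hd x)
    · filter_upwards [h2] with x hx using hx.comp x (hd x)
    · filter_upwards [h3] with x hx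
      simpa using hx
    · refine h6.congr fun x => ?_
      simp only [Function.comp]
      rw [mul_div_mul_right _ _ (by norm_num)]
  mul_mem := by
    rintro _ ⟨γ, hγ, rfl⟩
    exact ⟨_, h.mul_mem γ hγ, rfl⟩
  ne_zero := by
    rintro _ ⟨γ, hγ, rfl⟩
    rw [eventually_map]
    simp only [Function.comp, hσ]
    exact h.ne_zero γ hγ
  tendsto_zero := by
    rintro _ ⟨γ₁, hγ₁, rfl⟩ _ ⟨γ₂, hγ₂, rfl⟩
    rw [tendsto_map'_iff]
    refine (h.tendsto_zero γ₁ hγ₁ γ₂ hγ₂).congr fun x => ?_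
    simp [hσ]
  hasDerivAt := by
    rintro _ ⟨γ₁, hγ₁, rfl⟩ _ ⟨γ₂, hγ₂, rfl⟩
    obtain ⟨g', hg', c, hc, hlim⟩ := h.hasDerivAt γ₁ hγ₁ γ₂ hγ₂
    refine ⟨fun x => g' (σ x) * -1, ?_, -c, neg_ne_zero.2 hc, ?_⟩
    · rw [eventually_map]
      filter_upwards [hg'] with x hx
      have hx' : HasDerivAt (fun x => γ₁ x * γ₂ x * τ x) (g' (σ (σ x))) (σ (σ x)) := by
        rwa [hσ]
      exact hx'.comp (σ x) (hd (σ x))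
    · rw [tendsto_map'_iff]
      refine hlim.neg.congr fun x => ?_
      simp only [Function.comp, hσ]
      ring

theorem HasGauge.reflect {l : Filter ℝ} {Γ : Set (ℝ → ℝ)} {f : ℝ → ℝ} {σ : ℝ → ℝ}
    (hσ : ∀ x, σ (σ x) = x) (h : HasGauge l Γ (f ∘ σ)) :
    HasGauge (Filter.map σ l) ((fun γ => γ ∘ σ) '' Γ) f := by
  obtain ⟨γ, hγ, C, hC, ht⟩ := h
  refine ⟨_, ⟨γ, hγ, rfl⟩, C, hC, ?_⟩
  rw [tendsto_map'_iff]
  refine ht.congr fun x => ?_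
  simp [hσ]

/-! ### Weighted polynomials as bound states -/

/-- The Wronskian of two weighted polynomials is ρ² η' times a polynomial in η, since the
derivatives of ρ cancel. The boundary conditions thus reduce to the limits `hlL`, `hlR`;
completeness is `Weight.complete`. -/
theorem eigensystem_of_weight {I : Set ℝ} {η ρ η' : ℝ → ℝ} {t : ℝ} (h : Weight I η ρ t)
    {lL lR : Filter ℝ} {U : ℝ → ℝ} {ε : ℕ → ℝ} {φ : ℕ → ℝ → ℝ} {P : ℕ → Polynomial ℝ}
    (hP : ∀ n, (P n).degree = n) (hI : I.OrdConnected)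
    (hL : ∀ x ∈ I, ∀ᶠ y in lL, y ∈ I ∧ y < x) (hR : ∀ x ∈ I, ∀ᶠ y in lR, y ∈ I ∧ x < y)
    (hU : ∀ x ∈ I, ContDiffAt ℝ ∞ U x) (hsol : ∀ n, SolOn I U (ε n) (φ n)) (hε : StrictMono ε)
    (hφ : ∀ n, φ n = fun x => ρ x * (P n).eval (η x)) (hne : I.Nonempty)
    (hnv : ∀ n, ∀ J ⊆ I, IsOpen J → J.Nonempty → ∃ x ∈ J, φ n x ≠ 0)
    (hρ : ∀ x ∈ I, DifferentiableAt ℝ ρ x) (hη : ∀ x ∈ I, HasDerivAt η (η' x) x)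
    (hlL : ∀ q : Polynomial ℝ, Tendsto (fun x => ρ x ^ 2 * η' x * q.eval (η x)) lL (𝓝 0))
    (hlR : ∀ q : Polynomial ℝ, Tendsto (fun x => ρ x ^ 2 * η' x * q.eval (η x)) lR (𝓝 0)) :
    Eigensystem I lL lR U ε φ := by
  obtain ⟨x₀, hx₀⟩ := hne
  have hd : ∀ n, ∀ x ∈ I, deriv (φ n) x = deriv ρ x * (P n).eval (η x) +
      ρ x * ((Polynomial.derivative (P n)).eval (η x) * η' x) := by
    intro n x hx
    rw [hφ]
    exact ((hρ x hx).hasDerivAt.mul (((P n).hasDerivAt (η x)).comp x (hη x hx))).deriv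
  have hw : ∀ m n, ∀ x ∈ I, φ m x * deriv (φ n) x - deriv (φ m) x * φ n x =
      ρ x ^ 2 * η' x * (P m * Polynomial.derivative (P n) -
        Polynomial.derivative (P m) * P n).eval (η x) := by
    intro m n x hx
    rw [hd m x hx, hd n x hx, hφ, hφ, Polynomial.eval_sub, Polynomial.eval_mul, Polynomial.eval_mul]
    ring
  refine ⟨h.isOpen, hI, hL, hR, hU, hsol, hε, hnv, fun n => ?_, fun m n => ?_, fun m n => ?_,
    fun u hu h0 => ?_⟩
  · rw [hφ]
    exact h.memLp_poly (P n)
  · refine (hlL (P m * Polynomial.derivative (P n) - Polynomial.derivative (P m) * P n)).congr' ?_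
    filter_upwards [hL x₀ hx₀] with x hx using (hw m n x hx.1).symm
  · refine (hlR (P m * Polynomial.derivative (P n) - Polynomial.derivative (P m) * P n)).congr' ?_
    filter_upwards [hR x₀ hx₀] with x hx using (hw m n x hx.1).symm
  · simp only [hφ] at h0
    exact h.complete hP hu h0

/-- The bound states of the model `M` at the parameters `lam`: their Wronskians are nodeless
precisely under the Krein-Adler condition. -/
structure Model.NodelessCriterion {P : Type*} (M : Model P) (lam : P) : Prop where
  strictMono : StrictMono fun n : ℕ => M.E n lam
  ne_zero : ∀ l : List ℕ, l.Nodup → Even l.length →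
    (∀ n : ℕ, 0 ≤ (l.map fun e : ℕ => M.E n lam - M.E e lam).prod) →
    ∀ x ∈ M.dom, wronskian (l.map fun e => M.phi e lam) x ≠ 0
  prod_nonneg : ∀ l : List ℕ, l.Nodup →
    (∀ x ∈ M.dom, wronskian (l.map fun e => M.phi e lam) x ≠ 0) →
    ∀ n : ℕ, 0 ≤ (l.map fun e : ℕ => M.E n lam - M.E e lam).prod

theorem Eigensystem.nodelessCriterion {P : Type*} {M : Model P} {lam : P} {lL lR : Filter ℝ}
    [lL.NeBot] [lR.NeBot] [lL.IsCountablyGenerated] [lR.IsCountablyGenerated]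
    (h : Eigensystem M.dom lL lR (M.U lam) (fun n : ℕ => M.E n lam) fun n => M.phi n lam)
    (hA : ∀ n, AnalyticOnNhd ℝ (M.phi n lam) M.dom) {ΓL ΓR : Set (ℝ → ℝ)} {τL τR : ℝ → ℝ}
    (hGL : EndGauge lL ΓL τL) (hGR : EndGauge lR ΓR τR) (hφL : ∀ n, HasGauge lL ΓL (M.phi n lam))
    (hφR : ∀ n, HasGauge lR ΓR (M.phi n lam)) (hne : M.dom.Nonempty) :
    M.NodelessCriterion lam where
  strictMono := h.strictMono
  ne_zero _ hl he hp _ hx := h.wronskian_ne_zero_of_even hl he hp hx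
  prod_nonneg _ hl hW := h.prod_nonneg_of_wronskian_ne_zero hA hGL hGR hφL hφR hl hne hW

theorem Model.Matches.solOn_phi {P : Type*} [AddCommGroup P] {M : Model P}
    {S : ShapeInvariantSystem P} (h : M.Matches S) {lam : P}
    (hK : ∀ k : ℕ, lam + k • S.shift ∈ S.params) (n : ℕ) :
    SolOn M.dom (M.U lam) (M.E n lam) (M.phi n lam) := by
  obtain ⟨c, _, hc⟩ := h.phi n lam
  rw [h.dom, h.E]
  exact ((S.solOn_phi n fun k _ => hK k).const_mul c).congr S.isOpen_dom hc
    (h.U lam)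

theorem Model.Matches.exists_phi_ne_zero {P : Type*} [AddCommGroup P] {M : Model P}
    {S : ShapeInvariantSystem P} (h : M.Matches S) {lam : P}
    (hK : ∀ k : ℕ, lam + k • S.shift ∈ S.params) (n : ℕ) :
    ∀ J ⊆ M.dom, IsOpen J → J.Nonempty → ∃ x ∈ J, M.phi n lam x ≠ 0 := by
  intro J hJ hJo hJn
  obtain ⟨c, hc0, hc⟩ := h.phi n lam
  rw [h.dom] at hJ
  obtain ⟨x, hx, hx0⟩ := S.exists_phi_ne_zero n (fun k _ => hK k) J hJ hJo hJn
  exact ⟨x, hx, by rw [hc x (hJ hx)]; exact mul_ne_zero hc0 hx0⟩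

end

section

open Filter Set Topology MeasureTheory Polynomial
open scoped ContDiff

theorem analyticAt_rpow_const {f : ℝ → ℝ} {x s : ℝ} (hf : AnalyticAt ℝ f x) (h : 0 < f x) :
    AnalyticAt ℝ (fun y => f y ^ s) x := by
  have h1 : AnalyticAt ℝ (fun y => Real.exp (Real.log (f y) * s)) x :=
    ((hf.log h).mul analyticAt_const).rexp
  refine h1.congr ?_
  filter_upwards [hf.continuousAt.eventually (lt_mem_nhds h)] with y hy
  rw [Real.rpow_def_of_pos hy]

/-! ### Degrees and boundary values of the classical polynomials -/

theorem degree_sum_C_mul_pow {n : ℕ} {c : ℕ → ℝ} {q : ℝ[X]} (hq : q.degree = 1) (hc : c n ≠ 0) :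
    (∑ k ∈ Finset.range (n + 1), C (c k) * q ^ k).degree = n := by
  have hpow : ∀ k : ℕ, (q ^ k).degree = k := fun k => by
    rw [degree_pow, hq]; simp
  have htop : (C (c n) * q ^ n).degree = n := by
    rw [degree_C_mul hc, hpow]
  rw [Finset.sum_range_succ, degree_add_eq_right_of_degree_lt, htop]
  rw [htop]
  refine (degree_sum_le _ _).trans_lt ((Finset.sup_lt_iff (WithBot.bot_lt_coe n)).2 fun k hk => ?_)
  refine lt_of_le_of_lt (b := ((k : ℕ) : WithBot ℕ)) ?_ (WithBot.coe_lt_coe.2 (Finset.mem_range.1 hk))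
  rcases eq_or_ne (c k) 0 with h | h
  · simp [h]
  · rw [degree_C_mul h, hpow]

theorem degree_hermiteH (n : ℕ) : (hermiteH n).degree = n := by
  induction n with
  | zero => rw [hermiteH_zero]; simp
  | succ n ih =>
    have hne : hermiteH n ≠ 0 := fun h => by
      rw [h, degree_zero] at ih
      exact absurd ih.symm (WithBot.coe_ne_bot)
    have h1 : (C 2 * X * hermiteH n).degree = ((n + 1 : ℕ) : WithBot ℕ) := by
      rw [mul_assoc, degree_C_mul two_ne_zero, degree_mul, degree_X, ih]
      push_cast
      ring
    rw [hermiteH_succ, degree_sub_eq_left_of_degree_lt, h1]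
    rw [h1]
    refine (degree_derivative_lt hne).trans_le ?_
    rw [ih]
    exact_mod_cast Nat.le_succ n

theorem degree_laguerreL (n : ℕ) (α : ℝ) : (laguerreL n α).degree = n := by
  unfold laguerreL
  refine degree_sum_C_mul_pow degree_X ?_
  have h : (n.factorial : ℝ) ≠ 0 := by positivity
  simp [h]

theorem laguerreL_eval_zero_ne_zero (n : ℕ) {α : ℝ} (hα : -1 < α) : (laguerreL n α).eval 0 ≠ 0 := by
  rw [laguerreL_eval, Finset.sum_eq_single 0]
  · have := ascPochhammer_pos n (α + 1) (by linarith)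
    simp only [laguerreCoeff, Nat.cast_zero, add_zero, pow_zero, tsub_zero, mul_one, one_mul]
    positivity
  · intro k _ hk
    simp [hk]
  · simp

/-- The top coefficient contains the Pochhammer symbol (n+α+β+1)_n, which is positive under this
assumption. -/
theorem degree_jacobiP (n : ℕ) {α β : ℝ} (h : -1 < α + β) : (jacobiP n α β).degree = n := by
  unfold jacobiP
  refine degree_sum_C_mul_pow ?_ ?_
  · rw [degree_C_mul (by norm_num), ← degree_neg, neg_sub]
    exact degree_X_sub_C 1
  · have := ascPochhammer_pos n ((n : ℝ) + α + β + 1) (by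
      have : (0 : ℝ) ≤ n := n.cast_nonneg
      linarith)
    have h' : (n.factorial : ℝ) ≠ 0 := by positivity
    simp [h', this.ne']

theorem jacobiP_eval_one_ne_zero (n : ℕ) {α : ℝ} (β : ℝ) (hα : -1 < α) :
    (jacobiP n α β).eval 1 ≠ 0 := by
  rw [jacobiP_eval, Finset.sum_eq_single 0]
  · have := ascPochhammer_pos n (α + 1) (by linarith)
    simp only [jacobiCoeff, Nat.cast_zero, add_zero, pow_zero, tsub_zero, mul_one, one_mul,
      ascPochhammer_zero, eval_one]
    positivity
  · intro k _ hk
    simp [hk]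
  · simp

/-- At y = -1 the derivative term of the backward shift relation drops out, leaving -(β+1) times a
value of lower degree. The expansion at y = 1 does not show this directly. -/
theorem jacobiP_eval_neg_one_ne_zero (n : ℕ) : ∀ (α : ℝ) {β : ℝ}, -1 < β →
    (jacobiP n α β).eval (-1) ≠ 0 := by
  induction n with
  | zero => intro α β _; simp [jacobiP_zero]
  | succ n ih =>
    intro α β hβ h
    have h1 := jacobiP_succ n α β (-1)
    rw [h] at h1
    have h2 := ih (α + 1) (β := β + 1) (by linarith)
    have h3 : (β + 1) * (jacobiP n (α + 1) (β + 1)).eval (-1) = 0 := by linarith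
    rcases mul_eq_zero.1 h3 with h4 | h4
    · linarith
    · exact h2 h4

theorem ne_zero_of_degree_eq {p : ℝ[X]} {n : ℕ} (h : p.degree = n) : p ≠ 0 := fun h0 => by
  rw [h0, degree_zero] at h
  exact absurd h.symm (WithBot.coe_ne_bot)

theorem tendsto_eval_div_pow {p : ℝ[X]} {n : ℕ} (h : p.degree = n) :
    Tendsto (fun x => p.eval x / x ^ n) atTop (𝓝 p.leadingCoeff) := by
  have := div_tendsto_atTop_leadingCoeff_div_of_degree_eq p (X ^ n) (by rw [h, degree_X_pow])
  simpa using this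

theorem degree_comp_neg_X {p : ℝ[X]} {n : ℕ} (h : p.degree = n) : (p.comp (-X)).degree = n := by
  have h1 : (p.comp (-X)).natDegree = n := by
    rw [natDegree_comp, natDegree_neg, natDegree_X, mul_one, natDegree_eq_of_degree_eq_some h]
  have h2 : p.comp (-X) ≠ 0 := by
    intro h0
    have := congrArg (fun q : ℝ[X] => q.comp (-X)) h0
    simp only [comp_assoc, neg_comp, X_comp, neg_neg, comp_X, zero_comp] at this
    exact ne_zero_of_degree_eq h this
  rw [degree_eq_natDegree h2, h1]

/-! ### Behaviour at Gaussian ends -/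

theorem tendsto_exp_neg_sq_mul_eval (s : ℝ) (q : ℝ[X]) :
    Tendsto (fun x : ℝ => x ^ s * Real.exp (-x ^ 2) * q.eval x) atTop (𝓝 0) := by
  induction q using Polynomial.induction_on' with
  | add p q hp hq =>
    have := hp.add hq
    simp only [eval_add, mul_add]
    simpa using this
  | monomial n a =>
    have := (tendsto_rpow_mul_exp_neg_sq (s + n) one_pos).const_mul a
    rw [mul_zero] at this
    refine this.congr' ?_
    filter_upwards [eventually_gt_atTop 0] with x hx
    rw [Real.rpow_add_natCast hx.ne', eval_monomial, neg_one_mul]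
    ring

theorem hasGauge_atTop {f : ℝ → ℝ} {s : ℝ} {p : ℝ[X]} {n : ℕ} (hp : p.degree = n) {k : ℕ}
    (hk : k ≠ 0) (hf : ∀ x, 0 < x → f x = Real.exp (-x ^ 2 / 2) * x ^ s * p.eval (x ^ k)) :
    HasGauge atTop {γ | ∃ a : ℝ, γ = fun x => Real.exp (a * Real.log x - x ^ 2 / 2)} f := by
  refine ⟨_, ⟨s + (k * n : ℕ), rfl⟩, p.leadingCoeff,
    leadingCoeff_ne_zero.2 (ne_zero_of_degree_eq hp), ?_⟩
  refine ((tendsto_eval_div_pow hp).comp (tendsto_pow_atTop hk)).congr' ?_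
  filter_upwards [eventually_gt_atTop 0] with x hx
  have e : Real.exp ((s + (k * n : ℕ)) * Real.log x - x ^ 2 / 2) =
      Real.exp (-x ^ 2 / 2) * x ^ s * (x ^ k) ^ n := by
    have e' : (x ^ k) ^ n = Real.exp ((k * n : ℕ) * Real.log x) := by
      rw [← pow_mul, Real.exp_nat_mul, Real.exp_log hx]
    rw [Real.rpow_def_of_pos hx, e', ← Real.exp_add, ← Real.exp_add]
    ring_nf
  rw [hf x hx, e]
  simp only [Function.comp]
  rw [mul_div_mul_left]
  positivity

/-! ### The harmonic oscillator -/

theorem weightH : Weight Set.univ (fun x => x) (fun x => Real.exp (-x ^ 2 / 2)) 1 where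
  isOpen := isOpen_univ
  continuous := continuous_id
  injOn := fun x _ y _ h => h
  continuousOn := by fun_prop
  ne_zero := fun x _ => Real.exp_ne_zero _
  pos := one_pos
  memLp := by
    rw [Measure.restrict_univ, memLp_two_iff_integrable_sq (by fun_prop)]
    -- The squared function is exp(2|x| - x²), bounded by e² exp(-x²/2) because (|x| - 2)² ≥ 0.
    refine ((integrable_exp_neg_mul_sq (b := 1 / 2) (by norm_num)).const_mul (Real.exp 2)).mono'
      (by fun_prop) (Eventually.of_forall fun x => ?_)
    rw [Real.norm_of_nonneg (sq_nonneg _), ← Real.exp_add, ← Real.exp_add, ← Real.exp_nat_mul,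
      Real.exp_le_exp]
    push_cast
    nlinarith [sq_nonneg (|x| - 2), sq_abs x]

instance : (Filter.map (fun x : ℝ => -x) atTop).NeBot := Filter.NeBot.map inferInstance _

theorem eigensystemH : Eigensystem modelH.dom (Filter.map (fun x : ℝ => -x) atTop) atTop
    (modelH.U ()) (fun n : ℕ => modelH.E n ()) fun n => modelH.phi n () := by
  have hK : ∀ k : ℕ, () + k • sysH.shift ∈ sysH.params := fun _ => Set.mem_univ _
  have hlim : ∀ q : ℝ[X],
      Tendsto (fun x : ℝ => Real.exp (-x ^ 2 / 2) ^ 2 * 1 * q.eval x) atTop (𝓝 0) := fun q => by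
    refine (tendsto_exp_neg_sq_mul_eval 0 q).congr fun x => ?_
    rw [Real.rpow_zero, ← Real.exp_nat_mul]
    push_cast
    ring_nf
  refine eigensystem_of_weight (η' := fun _ => 1) weightH degree_hermiteH Set.ordConnected_univ
    (fun x _ => ?_) (fun x _ => ?_) (fun x _ => ?_) (fun n => modelH_matches.solOn_phi hK n) ?_
    (fun n => rfl) ⟨0, Set.mem_univ _⟩ (fun n => modelH_matches.exists_phi_ne_zero hK n)
    (fun x _ => (hasDerivAt_exp_neg_sq x).differentiableAt) (fun x _ => hasDerivAt_id x)
    (fun q => ?_) hlim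
  · rw [eventually_map]
    filter_upwards [eventually_gt_atTop (-x)] with y hy using ⟨Set.mem_univ _, by linarith⟩
  · filter_upwards [eventually_gt_atTop x] with y hy using ⟨Set.mem_univ _, hy⟩
  · simp only [modelH]
    fun_prop
  · intro m n hmn
    simp only [modelH]
    have : (m : ℝ) < n := by exact_mod_cast hmn
    push_cast
    linarith
  · rw [tendsto_map'_iff]
    refine (hlim (q.comp (-X))).congr fun x => ?_
    simp

theorem nodelessCriterionH : modelH.NodelessCriterion () := by
  have hneg : ∀ x : ℝ, HasDerivAt (fun x : ℝ => -x) (-1) x := fun x => hasDerivAt_neg x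
  refine eigensystemH.nodelessCriterion (fun n x _ => ?_)
    (endGauge_atTop.reflect (fun x => neg_neg x) hneg) endGauge_atTop
    (fun n => HasGauge.reflect (fun x => neg_neg x) ?_) (fun n => ?_) ⟨0, Set.mem_univ _⟩
  · simp only [modelH]
    have h1 : AnalyticAt ℝ (fun x : ℝ => (hermiteH n).eval x) x :=
      AnalyticAt.aeval_polynomial (f := fun x : ℝ => x) analyticAt_id (hermiteH n)
    fun_prop
  · refine hasGauge_atTop (s := 0) (degree_comp_neg_X (degree_hermiteH n)) one_ne_zero
      fun x _ => ?_
    simp [modelH]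
  · refine hasGauge_atTop (s := 0) (degree_hermiteH n) one_ne_zero fun x _ => ?_
    simp [modelH]

/-! ### The radial oscillator -/

theorem weightL {g : ℝ} (hg : 1 / 2 < g) :
    Weight (Set.Ioi 0) (fun x => x ^ 2) (fun x => Real.exp (-x ^ 2 / 2) * x ^ g) (1 / 4) where
  isOpen := isOpen_Ioi
  continuous := by fun_prop
  injOn := fun x hx y hy h => (pow_left_inj₀ (le_of_lt hx) (le_of_lt hy) two_ne_zero).1 h
  continuousOn := by
    refine ContinuousOn.mul (by fun_prop) ?_
    exact continuousOn_id.rpow_const fun x hx => Or.inl (ne_of_gt hx)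
  ne_zero := fun x hx => by
    have hx : 0 < x := hx
    positivity
  pos := by norm_num
  memLp := by
    have hm : AEStronglyMeasurable
        (fun x : ℝ => Real.exp (1 / 4 * |x ^ 2|) * (Real.exp (-x ^ 2 / 2) * x ^ g))
        (volume.restrict (Set.Ioi 0)) := by
      refine ContinuousOn.aestronglyMeasurable (ContinuousOn.mul (by fun_prop)
        (ContinuousOn.mul (by fun_prop) ?_)) measurableSet_Ioi
      exact continuousOn_id.rpow_const fun x hx => Or.inl (ne_of_gt hx)
    rw [memLp_two_iff_integrable_sq hm]
    -- With t = 1/4 the square of the weighted function is exactly x^{2g} exp(-x²/2).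
    refine (integrableOn_rpow_mul_exp_neg_mul_sq (b := 1 / 2) (by norm_num)
      (s := 2 * g) (by linarith)).congr_fun (fun x hx => ?_) measurableSet_Ioi
    have hx : 0 < x := hx
    simp only
    rw [abs_of_nonneg (sq_nonneg x), mul_pow, mul_pow, ← Real.exp_nat_mul, ← Real.exp_nat_mul,
      ← Real.rpow_natCast (x ^ g), ← Real.rpow_mul hx.le, ← mul_assoc, ← Real.exp_add, mul_comm]
    push_cast
    ring_nf

theorem eigensystemL {g : ℝ} (hg : 1 / 2 < g) : Eigensystem modelL.dom (𝓝[>] 0) atTop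
    (modelL.U g) (fun n : ℕ => modelL.E n g) fun n => modelL.phi n g := by
  have hK : ∀ k : ℕ, g + k • sysL.shift ∈ sysL.params := fun _ => Set.mem_univ _
  refine eigensystem_of_weight (η' := fun x => 2 * x) (weightL hg)
    (fun n => degree_laguerreL n (g - 1 / 2)) Set.ordConnected_Ioi
    (fun x hx => ?_) (fun x hx => ?_) (fun x hx => ?_) (fun n => modelL_matches.solOn_phi hK n) ?_
    (fun n => rfl) ⟨1, Set.mem_Ioi.2 one_pos⟩ (fun n => modelL_matches.exists_phi_ne_zero hK n)
    (fun x hx => ?_) (fun x _ => (hasDerivAt_pow 2 x).congr_deriv (by simp))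
    (fun q => ?_) (fun q => ?_)
  · exact Ioo_mem_nhdsGT hx
  · filter_upwards [eventually_gt_atTop x] with y hy using ⟨lt_trans hx hy, hy⟩
  · have hx0 : x ≠ 0 := ne_of_gt hx
    simp only [modelL]
    have : x ^ 2 ≠ 0 := pow_ne_zero 2 hx0
    fun_prop (disch := assumption)
  · intro m n hmn
    simp only [modelL]
    have : (m : ℝ) < n := by exact_mod_cast hmn
    push_cast
    linarith
  · exact (hasDerivAt_exp_neg_sq x).differentiableAt.mul
      (Real.differentiableAt_rpow_const_of_ne g (ne_of_gt hx))
  · have hc : ContinuousAt (fun x : ℝ => (Real.exp (-x ^ 2 / 2) * x ^ g) ^ 2 * (2 * x) *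
        q.eval (x ^ 2)) 0 := by
      have h1 : ContinuousAt (fun x : ℝ => x ^ g) 0 :=
        Real.continuousAt_rpow_const 0 g (Or.inr (by linarith))
      have h2 : Continuous fun x : ℝ => q.eval (x ^ 2) := q.continuous.comp (continuous_pow 2)
      fun_prop
    have := hc.tendsto.mono_left (nhdsWithin_le_nhds (s := Set.Ioi 0))
    simpa using this
  · refine (tendsto_exp_neg_sq_mul_eval (2 * g) (C 2 * X * q.comp (X ^ 2))).congr' ?_
    filter_upwards [eventually_gt_atTop 0] with x hx
    rw [mul_pow, ← Real.exp_nat_mul, ← Real.rpow_natCast (x ^ g), ← Real.rpow_mul hx.le]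
    simp only [eval_mul, eval_C, eval_X, eval_comp, eval_pow]
    push_cast
    ring_nf

theorem nodelessCriterionL {g : ℝ} (hg : 1 / 2 < g) : modelL.NodelessCriterion g := by
  refine (eigensystemL hg).nodelessCriterion (fun n x hx => ?_) endGauge_zero endGauge_atTop
    (fun n => ⟨_, ⟨g, by linarith, rfl⟩, (laguerreL n (g - 1 / 2)).eval 0,
      laguerreL_eval_zero_ne_zero n (by linarith), ?_⟩) (fun n => ?_) ⟨1, Set.mem_Ioi.2 one_pos⟩
  · have hx : 0 < x := hx
    simp only [modelL]
    have h1 : AnalyticAt ℝ (fun x : ℝ => (laguerreL n (g - 1 / 2)).eval (x ^ 2)) x :=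
      AnalyticAt.aeval_polynomial (f := fun x : ℝ => x ^ 2) (by fun_prop) (laguerreL n (g - 1 / 2))
    have h2 : AnalyticAt ℝ (fun x : ℝ => x ^ g) x := analyticAt_rpow_const analyticAt_id hx
    fun_prop
  · have hc : Continuous fun x : ℝ => Real.exp (-x ^ 2 / 2) *
        (laguerreL n (g - 1 / 2)).eval (x ^ 2) :=
      Continuous.mul (by fun_prop) ((laguerreL n (g - 1 / 2)).continuous.comp (continuous_pow 2))
    have := (hc.tendsto 0).mono_left (nhdsWithin_le_nhds (s := Set.Ioi 0))
    simp only [ne_eq, OfNat.ofNat_ne_zero, not_false_eq_true, zero_pow, neg_zero, zero_div,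
      Real.exp_zero, one_mul] at this
    refine this.congr' ?_
    filter_upwards [self_mem_nhdsWithin] with x hx
    have hx : 0 < x := hx
    have hg0 := (Real.rpow_pos_of_pos hx g).ne'
    simp only [modelL]
    rw [mul_comm g, ← Real.rpow_def_of_pos hx]
    field_simp
  · exact hasGauge_atTop (degree_laguerreL n (g - 1 / 2)) two_ne_zero fun x _ => rfl

/-! ### The Pöschl-Teller potential -/

theorem weightJ {g h : ℝ} (hg : 1 / 2 < g) (hh : 1 / 2 < h) :
    Weight (Set.Ioo 0 (Real.pi / 2)) (fun x => Real.cos (2 * x))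
      (fun x => Real.sin x ^ g * Real.cos x ^ h) 1 where
  isOpen := isOpen_Ioo
  continuous := by fun_prop
  injOn := fun x hx y hy h => by
    have := Real.injOn_cos (show 2 * x ∈ Set.Icc 0 Real.pi from
      ⟨by linarith [hx.1], by linarith [hx.2]⟩) (show 2 * y ∈ Set.Icc 0 Real.pi from
      ⟨by linarith [hy.1], by linarith [hy.2]⟩) h
    linarith
  continuousOn := by
    refine ContinuousOn.mul ?_ ?_
    · exact Real.continuous_sin.continuousOn.rpow_const fun x _ => Or.inr (by linarith)
    · exact Real.continuous_cos.continuousOn.rpow_const fun x _ => Or.inr (by linarith)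
  ne_zero := fun x hx => by
    have := sin_pos_J hx
    have := cos_pos_J hx
    positivity
  pos := one_pos
  memLp := by
    refine MemLp.of_bound (ContinuousOn.aestronglyMeasurable (ContinuousOn.mul (by fun_prop)
      (ContinuousOn.mul ?_ ?_)) measurableSet_Ioo) (Real.exp 1) ?_
    · exact Real.continuous_sin.continuousOn.rpow_const fun x _ => Or.inr (by linarith)
    · exact Real.continuous_cos.continuousOn.rpow_const fun x _ => Or.inr (by linarith)
    · filter_upwards [ae_restrict_mem measurableSet_Ioo] with x hx
      have h1 := sin_pos_J hx
      have h2 := cos_pos_J hx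
      rw [Real.norm_of_nonneg (by positivity)]
      have h3 : Real.sin x ^ g ≤ 1 := Real.rpow_le_one h1.le (Real.sin_le_one x) (by linarith)
      have h4 : Real.cos x ^ h ≤ 1 := Real.rpow_le_one h2.le (Real.cos_le_one x) (by linarith)
      have h5 : Real.exp (1 * |Real.cos (2 * x)|) ≤ Real.exp 1 := by
        rw [one_mul, Real.exp_le_exp]
        exact Real.abs_cos_le_one _
      calc _ ≤ Real.exp 1 * (1 * 1) := by gcongr
        _ = Real.exp 1 := by ring

/-- The reflection of `(0, π/2)`. -/
theorem hasDerivAt_half_pi_sub (x : ℝ) : HasDerivAt (fun x : ℝ => Real.pi / 2 - x) (-1) x := by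
  simpa using (hasDerivAt_id x).const_sub (Real.pi / 2)

theorem half_pi_sub_half_pi_sub (x : ℝ) : Real.pi / 2 - (Real.pi / 2 - x) = x := by ring

theorem cos_two_mul_half_pi_sub (x : ℝ) : Real.cos (2 * (Real.pi / 2 - x)) = -Real.cos (2 * x) := by
  rw [show 2 * (Real.pi / 2 - x) = Real.pi - 2 * x by ring, Real.cos_pi_sub]

theorem sin_two_mul_half_pi_sub (x : ℝ) : Real.sin (2 * (Real.pi / 2 - x)) = Real.sin (2 * x) := by
  rw [show 2 * (Real.pi / 2 - x) = Real.pi - 2 * x by ring, Real.sin_pi_sub]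

instance : (Filter.map (fun x : ℝ => Real.pi / 2 - x) (𝓝[>] 0)).NeBot :=
  Filter.NeBot.map inferInstance _

theorem tendsto_boundaryJ {g h : ℝ} (hg : 1 / 2 < g) (hh : 1 / 2 < h) (q : ℝ[X]) :
    Tendsto (fun x => (Real.sin x ^ g * Real.cos x ^ h) ^ 2 * (-Real.sin (2 * x) * 2) *
      q.eval (Real.cos (2 * x))) (𝓝[>] 0) (𝓝 0) := by
  have h1 : Continuous fun x => Real.sin x ^ g :=
    Real.continuous_sin.rpow_const fun x => Or.inr (by linarith)
  have h2 : Continuous fun x => Real.cos x ^ h :=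
    Real.continuous_cos.rpow_const fun x => Or.inr (by linarith)
  have h3 : Continuous fun x : ℝ => q.eval (Real.cos (2 * x)) :=
    q.continuous.comp (by fun_prop)
  have hc : Continuous fun x => (Real.sin x ^ g * Real.cos x ^ h) ^ 2 * (-Real.sin (2 * x) * 2) *
      q.eval (Real.cos (2 * x)) := by fun_prop
  have := (hc.tendsto 0).mono_left (nhdsWithin_le_nhds (s := Set.Ioi 0))
  simpa using this

theorem hasGaugeJ {g h : ℝ} (hg : 1 / 2 < g) (hh : 1 / 2 < h) {q : ℝ[X]} (hq : q.eval 1 ≠ 0)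
    {f : ℝ → ℝ} (hf : ∀ x, f x = Real.sin x ^ g * Real.cos x ^ h * q.eval (Real.cos (2 * x))) :
    HasGauge (𝓝[>] (0 : ℝ)) {γ | ∃ a : ℝ, 0 < a ∧ γ = fun x => Real.exp (a * Real.log x)} f := by
  refine ⟨_, ⟨g, by linarith, rfl⟩, q.eval 1, hq, ?_⟩
  have h1 : Tendsto (fun x => Real.sin x / x) (𝓝[>] 0) (𝓝 1) := by
    have := (Real.hasDerivAt_sin 0).tendsto_slope_zero_right
    simp only [zero_add, Real.sin_zero, sub_zero, Real.cos_zero, smul_eq_mul] at this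
    refine this.congr fun x => ?_
    rw [div_eq_inv_mul]
  have h2 : Tendsto (fun x => (Real.sin x / x) ^ g) (𝓝[>] 0) (𝓝 1) := by
    have := h1.rpow_const (p := g) (Or.inl one_ne_zero)
    rwa [Real.one_rpow] at this
  have h3 : Continuous fun x : ℝ => Real.cos x ^ h * q.eval (Real.cos (2 * x)) :=
    (Real.continuous_cos.rpow_const fun x => Or.inr (by linarith)).mul
      (q.continuous.comp (by fun_prop))
  have h4 := h2.mul ((h3.tendsto 0).mono_left (nhdsWithin_le_nhds (s := Set.Ioi 0)))
  simp only [mul_zero, Real.cos_zero, Real.one_rpow, one_mul] at h4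
  refine h4.congr' ?_
  filter_upwards [Ioo_mem_nhdsGT (show (0 : ℝ) < Real.pi / 2 by positivity)] with x hx
  have hx0 : 0 < x := hx.1
  have hxg := (Real.rpow_pos_of_pos hx0 g).ne'
  rw [hf, mul_comm g, ← Real.rpow_def_of_pos hx0, Real.div_rpow (sin_pos_J hx).le hx0.le]
  field_simp

theorem eigensystemJ {g h : ℝ} (hg : 1 / 2 < g) (hh : 1 / 2 < h) :
    Eigensystem modelJ.dom (𝓝[>] 0) (Filter.map (fun x : ℝ => Real.pi / 2 - x) (𝓝[>] 0))
      (modelJ.U (g, h)) (fun n : ℕ => modelJ.E n (g, h)) fun n => modelJ.phi n (g, h) := by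
  have hK : ∀ k : ℕ, (g, h) + k • sysJ.shift ∈ sysJ.params := fun k => by
    have : (0 : ℝ) ≤ k := k.cast_nonneg
    simp only [sysJ, Prod.smul_mk, nsmul_eq_mul, mul_one, Prod.mk_add_mk, mem_ofPred_eq]
    linarith
  have hpi := Real.pi_pos
  refine eigensystem_of_weight (η' := fun x => -Real.sin (2 * x) * 2) (weightJ hg hh)
    (fun n => degree_jacobiP n (α := g - 1 / 2) (β := h - 1 / 2) (by linarith)) Set.ordConnected_Ioo
    (fun x hx => ?_) (fun x hx => ?_) (fun x hx => ?_) (fun n => modelJ_matches.solOn_phi hK n) ?_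
    (fun n => rfl) (Set.nonempty_Ioo.2 (by positivity))
    (fun n => modelJ_matches.exists_phi_ne_zero hK n)
    (fun x hx => ?_) (fun x _ => ?_) (fun q => tendsto_boundaryJ hg hh q) (fun q => ?_)
  · filter_upwards [Ioo_mem_nhdsGT hx.1] with y hy using ⟨⟨hy.1, hy.2.trans hx.2⟩, hy.2⟩
  · rw [eventually_map]
    filter_upwards [Ioo_mem_nhdsGT (show 0 < Real.pi / 2 - x by linarith [hx.2])] with y hy
    exact ⟨⟨by linarith [hy.2, hx.1], by linarith [hy.1]⟩, by linarith [hy.2]⟩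
  · have h1 := pow_ne_zero 2 (sin_pos_J hx).ne'
    have h2 := pow_ne_zero 2 (cos_pos_J hx).ne'
    simp only [modelJ]
    have h3 : ContDiffAt ℝ ∞ Real.sin x := Real.contDiff_sin.contDiffAt
    have h4 : ContDiffAt ℝ ∞ Real.cos x := Real.contDiff_cos.contDiffAt
    exact ((contDiffAt_const.div (h3.pow 2) h1).add (contDiffAt_const.div (h4.pow 2) h2)).sub
      contDiffAt_const
  · intro m n hmn
    simp only [modelJ]
    have h1 : (m : ℝ) < n := by exact_mod_cast hmn
    have h2 : (0 : ℝ) ≤ m := m.cast_nonneg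
    push_cast
    nlinarith [mul_pos (sub_pos.2 h1) (show 0 < g + h by linarith)]
  · exact (Real.differentiableAt_sin.rpow_const (Or.inl (sin_pos_J hx).ne')).mul
      (Real.differentiableAt_cos.rpow_const (Or.inl (cos_pos_J hx).ne'))
  · exact (Real.hasDerivAt_cos (2 * x)).comp x (by simpa using (hasDerivAt_id x).const_mul 2)
  · rw [tendsto_map'_iff]
    refine (tendsto_boundaryJ hh hg (q.comp (-X))).congr fun x => ?_
    simp only [Function.comp, Real.sin_pi_div_two_sub, Real.cos_pi_div_two_sub,
      cos_two_mul_half_pi_sub, sin_two_mul_half_pi_sub, eval_comp, eval_neg, eval_X]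
    ring

theorem nodelessCriterionJ {g h : ℝ} (hg : 1 / 2 < g) (hh : 1 / 2 < h) :
    modelJ.NodelessCriterion (g, h) := by
  refine (eigensystemJ hg hh).nodelessCriterion (fun n x hx => ?_) endGauge_zero
    (endGauge_zero.reflect half_pi_sub_half_pi_sub hasDerivAt_half_pi_sub)
    (fun n => hasGaugeJ hg hh (jacobiP_eval_one_ne_zero n _ (by linarith)) fun x => rfl)
    (fun n => HasGauge.reflect half_pi_sub_half_pi_sub
      (hasGaugeJ hh hg (q := (jacobiP n (g - 1 / 2) (h - 1 / 2)).comp (-X)) ?_ fun x => ?_))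
    (Set.nonempty_Ioo.2 (by positivity))
  · simp only [modelJ]
    have h1 : AnalyticAt ℝ (fun x : ℝ => (jacobiP n (g - 1 / 2) (h - 1 / 2)).eval
        (Real.cos (2 * x))) x :=
      AnalyticAt.aeval_polynomial (f := fun x : ℝ => Real.cos (2 * x))
        (Real.analyticAt_cos.comp (by fun_prop)) (jacobiP n (g - 1 / 2) (h - 1 / 2))
    have h2 : AnalyticAt ℝ (fun x : ℝ => Real.sin x ^ g) x :=
      analyticAt_rpow_const Real.analyticAt_sin (sin_pos_J hx)
    have h3 : AnalyticAt ℝ (fun x : ℝ => Real.cos x ^ h) x :=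
      analyticAt_rpow_const Real.analyticAt_cos (cos_pos_J hx)
    fun_prop
  · rw [eval_comp, eval_neg, eval_X]
    exact jacobiP_eval_neg_one_ne_zero n _ (by linarith)
  · simp only [Function.comp, modelJ, Real.sin_pi_div_two_sub, Real.cos_pi_div_two_sub,
      cos_two_mul_half_pi_sub, eval_comp, eval_neg, eval_X]
    ring

end

section

open Filter Set Topology
open scoped ContDiff

/-! ### The Krein-Adler condition and zeros of the Wronskians -/

/-- Only the signs of the factors matter, and an increasing sequence of energies has the order of
its indices. -/
theorem prod_sub_nonneg_iff {ε : ℕ → ℝ} (hε : StrictMono ε) (l : List ℕ) (n : ℕ) :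
    0 ≤ (l.map fun e => ε n - ε e).prod ↔ 0 ≤ (l.map fun e : ℕ => (n : ℤ) - (e : ℤ)).prod := by
  have hs : ∀ e : ℕ, SignType.sign (ε n - ε e) = SignType.sign ((n : ℤ) - (e : ℤ)) := fun e => by
    rcases lt_trichotomy n e with h | h | h
    · rw [sign_neg (sub_neg.2 (hε h)), sign_neg (by omega)]
    · simp [h]
    · rw [sign_pos (sub_pos.2 (hε h)), sign_pos (by omega)]
  rw [← sign_nonneg_iff, ← sign_nonneg_iff (a := (l.map fun e : ℕ => (n : ℤ) - (e : ℤ)).prod)]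
  have e1 : SignType.sign (l.map fun e => ε n - ε e).prod =
      SignType.sign (l.map fun e : ℕ => (n : ℤ) - (e : ℤ)).prod := by
    induction l with
    | nil => simp
    | cons a l ih =>
      rw [List.map_cons, List.map_cons, List.prod_cons, List.prod_cons, sign_mul, sign_mul, hs, ih]
  rw [e1]

theorem sign_prod_neg {l : List ℕ} (hl : 0 ∉ l) :
    SignType.sign (l.map fun e : ℕ => ((0 : ℕ) : ℤ) - (e : ℤ)).prod = (-1) ^ l.length := by
  induction l with
  | nil => simp
  | cons a l ih =>
    rw [List.mem_cons, not_or] at hl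
    rw [List.map_cons, List.prod_cons, sign_mul, ih hl.2, List.length_cons, pow_succ', sign_neg (a := ((0 : ℕ) : ℤ) - (a : ℤ))]
    · have := Nat.pos_of_ne_zero (Ne.symm hl.1)
      omega

/-- Otherwise the product at m = 0 would consist of an odd number of negative factors. -/
theorem zero_mem_of_odd {l : List ℕ} (hodd : ¬ Even l.length)
    (h : 0 ≤ (l.map fun e : ℕ => ((0 : ℕ) : ℤ) - (e : ℤ)).prod) : 0 ∈ l := by
  by_contra h0
  rw [← sign_nonneg_iff, sign_prod_neg h0, (Nat.not_even_iff_odd.1 hodd).neg_one_pow] at h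
  exact absurd h (by decide)

/-- In the definition the index list is coerced to integers as a whole, through the list monad; this
brings the cast inside the map. -/
theorem kreinAdler_iff {N : ℕ} {d : List ℕ} : KreinAdler N d ↔
    ∀ m : ℕ, 0 ≤ ((barD N d).map fun e : ℕ => (m : ℤ) - (e : ℤ)).prod := by
  have e : ((barD N d) >>= fun a => pure (a : ℤ)) = (barD N d).map fun a : ℕ => (a : ℤ) :=
    List.flatMap_pure_eq_map _ _
  unfold KreinAdler
  rw [e]
  simp only [List.map_map, Function.comp_def]

/-- The criterion for even length applies directly. For odd length the ground state is among the
seeds, and one rung of the ladder reduces to an even number of bound states at the next parameter;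
this is why a second criterion `h₁` enters. -/
theorem Model.Matches.wronskian_seedsKA_ne_zero_iff {P : Type*} [AddCommGroup P] {M : Model P}
    {S : ShapeInvariantSystem P} (h : M.Matches S) {N : ℕ} {lam : P} (d : List ℕ)
    (hK : ∀ k : ℕ, S.toModel.barParam N lam + k • S.shift ∈ S.params)
    (h₀ : M.NodelessCriterion (M.barParam N lam))
    (h₁ : M.NodelessCriterion (M.barParam N lam + M.shift)) :
    (∀ x ∈ M.dom, wronskian (M.seedsKA N lam d) x ≠ 0) ↔ KreinAdler N d := by
  rw [kreinAdler_iff]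
  refine ⟨fun hW n => ?_, fun hKA => ?_⟩
  · exact (prod_sub_nonneg_iff h₀.strictMono _ n).1 (h₀.prod_nonneg _ (barD_nodup N d) hW n)
  · by_cases heven : Even (barD N d).length
    · exact h₀.ne_zero _ (barD_nodup N d) heven
        fun n => (prod_sub_nonneg_iff h₀.strictMono _ n).2 (hKA n)
    · have h0 : 0 ∈ barD N d := zero_mem_of_odd heven (hKA 0)
      set E := barD N d with hE
      have hp : E.Perm (0 :: E.filter fun m => 1 ≤ m) := by
        have := ShapeInvariantSystem.seedIdx_succ_of_mem (barD_nodup N d) h0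
        simpa [ShapeInvariantSystem.seedIdx, ← hE, h0] using this
      set l := (E.filter fun m => 1 ≤ m).map fun e => e - 1 with hl
      have hlen : l.length + 1 = E.length := by
        rw [hp.length_eq, hl]; simp
      have hle : Even l.length := by
        rw [← hlen, Nat.even_add_one, not_not] at heven
        exact heven
      have hnd : l.Nodup := by
        refine List.Nodup.map_on (fun x hx y hy hxy => ?_) ((barD_nodup N d).filter _)
        simp only [List.mem_filter, decide_eq_true_eq] at hx hy
        omega
      -- The condition for the shifted indices at n is the original one at n + 1 divided by the
      -- positive factor n + 1 that belongs to index 0.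
      have hne := h₁.ne_zero l hnd hle fun n => (prod_sub_nonneg_iff h₁.strictMono _ n).2 (by
        have h2 := hKA (n + 1)
        rw [(hp.map _).prod_eq, List.map_cons, List.prod_cons] at h2
        have h3 := nonneg_of_mul_nonneg_right h2 (by push_cast; omega)
        rw [hl, List.map_map]
        refine h3.trans_eq (congrArg List.prod (List.map_congr_left fun e he => ?_))
        simp only [List.mem_filter, decide_eq_true_eq] at he
        simp only [Function.comp]
        omega)
      intro x hx
      obtain ⟨c₁, hc₁0, hc₁⟩ := h.seedsKA N lam d
      obtain ⟨c₂, hc₂0, hc₂⟩ := ShapeInvariantSystem.wronskian_seedIdx_succ (K := N + 1)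
        (fun k _ => hK k) (barD_nodup N d)
        (fun e he => (mem_barD.1 he).1.trans (Nat.le_succ N)) (Nat.le_add_left (0 + 1) N)
      obtain ⟨c₃, hc₃0, hc₃⟩ := wronskian_map_propOn S.isOpen_dom (l := l)
        (F := fun e => M.phi e (M.barParam N lam + M.shift))
        (G := fun e => S.phi e (M.barParam N lam + M.shift)) fun a _ => h.phi a _
      have hx' : x ∈ S.dom := h.dom ▸ hx
      have e0 : (ShapeInvariantSystem.seedIdx E 0).map (S.ladder (S.toModel.barParam N lam) 0) =
          S.toModel.seedsKA N lam d := by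
        simp only [ShapeInvariantSystem.seedIdx, List.range_zero, List.filter_nil, List.nil_append,
          Nat.zero_le, decide_true, List.filter_true]
        exact List.map_congr_left fun k _ => ShapeInvariantSystem.ladder_zero _ k
      have e1 : (ShapeInvariantSystem.seedIdx E (0 + 1)).map
          (S.ladder (S.toModel.barParam N lam) (0 + 1)) =
          l.map fun e => S.phi e (M.barParam N lam + M.shift) := by
        have : ShapeInvariantSystem.seedIdx E (0 + 1) = E.filter fun m => 1 ≤ m := by
          simp [ShapeInvariantSystem.seedIdx, h0]
        rw [this, hl, List.map_map]
        refine List.map_congr_left fun e he => ?_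
        simp only [List.mem_filter, decide_eq_true_eq] at he
        simp only [ShapeInvariantSystem.ladder, Function.comp, h.barParam, h.shift, zero_add,
          one_smul, if_neg (show ¬ e < 1 by omega)]
      have h4 := hc₂ x hx'
      rw [e0, e1] at h4
      rw [hc₁ x hx', h4]
      have h5 := hne x hx
      rw [hc₃ x hx'] at h5
      exact mul_ne_zero hc₁0 (mul_ne_zero (mul_ne_zero hc₂0 (Real.exp_ne_zero _))
        (right_ne_zero_of_mul h5))

theorem Model.Matches.wronskian_seedsDP_ne_zero_iff {P : Type*} [AddCommGroup P] {M : Model P}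
    {S : ShapeInvariantSystem P} (h : M.Matches S) {N : ℕ} {lam : P} {d : List ℕ} (hd : d.Nodup)
    (hN : ∀ v ∈ d, v ≤ N)
    (hK : ∀ k : ℕ, S.toModel.barParam N lam + k • S.shift ∈ S.params)
    (h₀ : M.NodelessCriterion (M.barParam N lam))
    (h₁ : M.NodelessCriterion (M.barParam N lam + M.shift)) :
    (∀ x ∈ M.dom, wronskian (M.seedsDP lam d) x ≠ 0) ↔ KreinAdler N d := by
  rw [← h.wronskian_seedsKA_ne_zero_iff d hK h₀ h₁]
  exact forall₂_congr fun x hx => not_congr ((h.equivalent hd hN hK).1 x hx)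

/-! ### A single seed -/

/-- The product vanishes for m ≤ N other than N - v and is positive beyond N. At m = N - v exactly
the v indices above it contribute a negative sign. -/
theorem kreinAdler_singleton {N v : ℕ} (hv : v ≤ N) : KreinAdler N [v] ↔ Even v := by
  rw [kreinAdler_iff]
  have hlt : ∀ n k : ℕ, k ≤ n → SignType.sign ((List.range k).map fun e : ℕ =>
      (n : ℤ) - (e : ℤ)).prod = 1 := by
    intro n k
    induction k with
    | zero => simp
    | succ k ih =>
      intro hk
      rw [List.range_succ, List.map_append, List.prod_append, sign_mul, ih (by omega)]
      simp only [List.map_cons, List.map_nil, List.prod_singleton, one_mul]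
      exact sign_pos (by omega)
  have hgt : ∀ n k : ℕ, SignType.sign (((List.range k).map fun i => n + 1 + i).map fun e : ℕ =>
      (n : ℤ) - (e : ℤ)).prod = (-1) ^ k := by
    intro n k
    induction k with
    | zero => simp
    | succ k ih =>
      rw [List.range_succ, List.map_append, List.map_append, List.prod_append, sign_mul, ih,
        pow_succ]
      simp only [List.map_cons, List.map_nil, List.prod_singleton]
      rw [sign_neg (by push_cast; omega)]
  have hperm : (barD N [v]).Perm
      (List.range (N - v) ++ (List.range v).map fun i => N - v + 1 + i) := by
    refine (List.perm_ext_iff_of_nodup (barD_nodup _ _) ?_).2 fun a => ?_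
    · refine List.Nodup.append List.nodup_range
        (List.nodup_range.map fun x y hxy => by simpa using hxy) fun a h1 h2 => ?_
      simp at h1 h2; omega
    · simp only [mem_barD, List.mem_append, List.mem_range, List.mem_map, List.mem_singleton,
        forall_eq]
      constructor
      · rintro ⟨h1, h2⟩
        rcases lt_or_ge a (N - v) with h3 | h3
        · exact Or.inl h3
        · exact Or.inr ⟨a - (N - v + 1), by omega, by omega⟩
      · rintro (h | ⟨i, hi, rfl⟩)
        · omega
        · omega
  have hself : SignType.sign ((barD N [v]).map fun e : ℕ => ((N - v : ℕ) : ℤ) - (e : ℤ)).prod =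
      (-1) ^ v := by
    rw [(hperm.map _).prod_eq, List.map_append, List.prod_append, sign_mul, hlt _ _ le_rfl, hgt,
      one_mul]
  constructor
  · intro h
    by_contra hodd
    have := sign_nonneg_iff.2 (h (N - v))
    rw [hself, (Nat.not_even_iff_odd.1 hodd).neg_one_pow] at this
    exact absurd this (by decide)
  · intro hev m
    rcases eq_or_ne m (N - v) with rfl | hm
    · rw [← sign_nonneg_iff, hself, hev.neg_one_pow]
      decide
    · rcases le_or_gt m N with hmN | hmN
      · refine (List.prod_eq_zero (List.mem_map.2 ⟨m, mem_barD.2 ⟨hmN, ?_⟩, sub_self _⟩)).ge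
        simp only [List.mem_singleton, forall_eq]
        exact hm.symm
      · refine List.prod_nonneg fun a ha => ?_
        obtain ⟨e, he, rfl⟩ := List.mem_map.1 ha
        have := (mem_barD.1 he).1
        omega

end

section

open Filter Set Topology
open scoped ContDiff

/-! ### Singularities of the transformed potential -/

/-- The mean value inequality applied twice on a bounded convex set, first to L' and then to L. -/
theorem exists_abs_le_of_abs_iteratedDeriv_two_le {L : ℝ → ℝ} {s : Set ℝ} {a b K : ℝ}
    (hs : Convex ℝ s) (hab : s ⊆ Set.Icc a b) (hL : ∀ x ∈ s, ContDiffAt ℝ ∞ L x)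
    (hK : ∀ x ∈ s, |iteratedDeriv 2 L x| ≤ K) : ∃ C : ℝ, ∀ x ∈ s, |L x| ≤ C := by
  rcases s.eq_empty_or_nonempty with rfl | ⟨y, hy⟩
  · exact ⟨0, fun x hx => hx.elim⟩
  have hstep : ∀ (f : ℝ → ℝ) (D : ℝ), (∀ x ∈ s, DifferentiableAt ℝ f x) →
      (∀ x ∈ s, ‖deriv f x‖ ≤ D) → ∀ x ∈ s, ‖f x‖ ≤ ‖f y‖ + D * (b - a) := by
    intro f D hf hD x hx
    have h1 := hs.norm_image_sub_le_of_norm_deriv_le hf hD hy hx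
    have hD0 : 0 ≤ D := (norm_nonneg _).trans (hD y hy)
    have h2 : ‖x - y‖ ≤ b - a := by
      rw [Real.norm_eq_abs, abs_le]
      constructor <;> linarith [(hab hx).1, (hab hx).2, (hab hy).1, (hab hy).2]
    have h3 := mul_le_mul_of_nonneg_left h2 hD0
    have h4 := norm_le_norm_add_norm_sub' (f x) (f y)
    linarith
  have h1 := hstep (deriv L) K
    (fun x hx => ((hL x hx).deriv_infty).differentiableAt (by norm_num)) fun x hx => by
      have := hK x hx
      rwa [ShapeInvariantSystem.iteratedDeriv_two] at this
  exact ⟨_, hstep L _ (fun x hx => (hL x hx).differentiableAt (by norm_num)) h1⟩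

theorem contDiffAt_log_abs {W : ℝ → ℝ} {x : ℝ} (hW : ContDiffAt ℝ ∞ W x) (h0 : W x ≠ 0) :
    ContDiffAt ℝ ∞ (fun y => Real.log |W y|) x := by
  simp only [Real.log_abs]
  exact hW.log h0

/-- If `(log |W|)''` is bounded on an interval without zeros of `W`, then `W` does not vanish at
the end points either. -/
theorem ne_zero_of_mem_closure {W : ℝ → ℝ} {s : Set ℝ} {a b K z : ℝ}
    (hs : Convex ℝ s) (hab : s ⊆ Set.Icc a b) (hW : ∀ x ∈ s, ContDiffAt ℝ ∞ W x)
    (h0 : ∀ x ∈ s, W x ≠ 0)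
    (hK : ∀ x ∈ s, |iteratedDeriv 2 (fun y => Real.log |W y|) x| ≤ K) (hz : z ∈ closure s)
    (hWz : ContinuousAt W z) : W z ≠ 0 := by
  obtain ⟨C, hC⟩ := exists_abs_le_of_abs_iteratedDeriv_two_le hs hab
    (fun x hx => contDiffAt_log_abs (hW x hx) (h0 x hx)) hK
  intro hz0
  have h1 : ∀ᶠ x in 𝓝 z, |W x| < Real.exp (-C) := by
    refine hWz.abs.eventually (gt_mem_nhds ?_)
    simp only [hz0, abs_zero]
    exact Real.exp_pos _
  obtain ⟨x, hxs, hx⟩ := ((mem_closure_iff_frequently.1 hz).and_eventually h1).exists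
  have h2 := (abs_le.1 (hC x hxs)).1
  rw [Real.le_log_iff_exp_le (abs_pos.2 (h0 x hxs))] at h2
  linarith

/-- A smooth potential makes (log|W|)'' bounded on compact segments, so log|W| stays bounded up to
the zero of W nearest to a regular point, whereas it should tend to -∞ there. -/
theorem contDiffOn_darbouxPotential_iff {I : Set ℝ} (hI : IsOpen I) (hord : I.OrdConnected)
    {U : ℝ → ℝ} (hU : ContDiffOn ℝ ∞ U I) {l : List (ℝ → ℝ)}
    (hl : ∀ x ∈ I, ContDiffAt ℝ ∞ (wronskian l) x) {y : ℝ} (hy : y ∈ I)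
    (hy0 : wronskian l y ≠ 0) :
    ContDiffOn ℝ ∞ (darbouxPotential U l) I ↔ ∀ x ∈ I, wronskian l x ≠ 0 := by
  constructor
  · intro hP z hz hz0
    have hQ : ContinuousOn (iteratedDeriv 2 fun y => Real.log |wronskian l y|) I := by
      have : ContinuousOn (fun x => (U x - darbouxPotential U l x) / 2) I :=
        (hU.continuousOn.sub hP.continuousOn).div_const 2
      refine this.congr fun x _ => ?_
      simp only [darbouxPotential]
      ring
    have hWc : ContinuousOn (wronskian l) I := fun x hx => (hl x hx).continuousAt.continuousWithinAt
    have hsub : ∀ a ∈ I, ∀ b ∈ I, Set.Icc a b ⊆ I := fun a ha b hb => hord.out ha hb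
    have hcomp : ∀ a ∈ I, ∀ b ∈ I, IsCompact (Set.Icc a b ∩ wronskian l ⁻¹' {0}) :=
      fun a ha b hb => isCompact_Icc.of_isClosed_subset
        ((hWc.mono (hsub a ha b hb)).preimage_isClosed_of_isClosed isClosed_Icc isClosed_singleton)
        Set.inter_subset_left
    have key : ∀ a ∈ I, ∀ b ∈ I, ∀ s : Set ℝ, Convex ℝ s → s ⊆ Set.Icc a b →
        (∀ x ∈ s, wronskian l x ≠ 0) → ∀ t ∈ closure s, t ∈ I → wronskian l t ≠ 0 := by
      intro a ha b hb s hs hsab hs0 t ht htI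
      obtain ⟨K, hK⟩ := isCompact_Icc.exists_bound_of_continuousOn (hQ.mono (hsub a ha b hb))
      exact ne_zero_of_mem_closure hs hsab (fun x hx => hl x (hsub a ha b hb (hsab hx))) hs0
        (fun x hx => hK x (hsab hx)) ht (hl t htI).continuousAt
    rcases lt_trichotomy y z with hyz | rfl | hzy
    -- The zero nearest to y on its right exists by compactness, and the half-open segment before it
    -- is free of zeros.
    · obtain ⟨t, ht, hmin⟩ := (hcomp y hy z hz).exists_isLeast
        ⟨z, ⟨hyz.le, le_rfl⟩, hz0⟩
      have hyt : y < t := lt_of_le_of_ne ht.1.1 fun h => hy0 (h ▸ ht.2)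
      refine key y hy z hz (Set.Ico y t) (convex_Ico y t)
        (fun x hx => ⟨hx.1, hx.2.le.trans ht.1.2⟩) (fun x hx h => ?_) t ?_
        (hsub y hy z hz ht.1) ht.2
      · exact absurd (hmin ⟨⟨hx.1, hx.2.le.trans ht.1.2⟩, h⟩) (not_le.2 hx.2)
      · rw [closure_Ico hyt.ne]
        exact ⟨hyt.le, le_rfl⟩
    · exact hy0 hz0
    · obtain ⟨t, ht, hmax⟩ := (hcomp z hz y hy).exists_isGreatest
        ⟨z, ⟨le_rfl, hzy.le⟩, hz0⟩
      have hty : t < y := lt_of_le_of_ne ht.1.2 fun h => hy0 (h ▸ ht.2)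
      refine key z hz y hy (Set.Ioc t y) (convex_Ioc t y)
        (fun x hx => ⟨ht.1.1.trans hx.1.le, hx.2⟩) (fun x hx h => ?_) t ?_
        (hsub z hz y hy ht.1) ht.2
      · exact absurd (hmax ⟨⟨ht.1.1.trans hx.1.le, hx.2⟩, h⟩) (not_le.2 hx.1)
      · rw [closure_Ioc hty.ne]
        exact ⟨le_rfl, hty.le⟩
  · intro h0 x hx
    refine ContDiffAt.contDiffWithinAt ?_
    have h1 := (contDiffAt_log_abs (hl x hx) (h0 x hx)).deriv_infty.deriv_infty
    have h2 : ContDiffAt ℝ ∞ U x := hU.contDiffAt (hI.mem_nhds hx)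
    have h3 : ContDiffAt ℝ ∞ (iteratedDeriv 2 fun y => Real.log |wronskian l y|) x := by
      rwa [ShapeInvariantSystem.iteratedDeriv_two]
    exact h2.sub (contDiffAt_const.mul h3)

/-- The nodelessness criteria at `λ - (N+1) δ` and `λ - N δ` imply the whole statement on
singularities. -/
theorem Model.Matches.singularityConditions {P : Type*} [AddCommGroup P] {M : Model P}
    {S : ShapeInvariantSystem P} (h : M.Matches S) {N : ℕ} {lam : P} {d : List ℕ} (hd : d.Nodup)
    (hN : ∀ v ∈ d, v ≤ N)
    (hK : ∀ k : ℕ, S.toModel.barParam N lam + k • S.shift ∈ S.params)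
    (h₀ : M.NodelessCriterion (M.barParam N lam))
    (h₁ : M.NodelessCriterion (M.barParam N lam + M.shift))
    (hU : ContDiffOn ℝ ∞ (M.U lam) M.dom) :
    M.SingularityConditions N lam d := by
  have hW := h.wronskian_seedsDP_ne_zero_iff hd hN hK h₀ h₁
  refine ⟨?_, hW, fun v hv => ⟨kreinAdler_singleton hv, fun hev x hx => ?_⟩⟩
  · obtain ⟨x, hx⟩ := S.nonempty_dom
    obtain ⟨c, hc0, hc⟩ := h.seedsDP lam d
    have hdense := (h.equivalent hd hN hK).2.1
    rw [h.dom] at hdense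
    obtain ⟨y, hy⟩ : (M.regularSet lam d).Nonempty := closure_nonempty_iff.1 ⟨x, hdense hx⟩
    rw [← hW]
    refine contDiffOn_darbouxPotential_iff (h.dom ▸ S.isOpen_dom) (h.dom ▸ S.ordConnected_dom) hU
      (fun t ht => ?_) hy.1 hy.2
    rw [h.dom] at ht
    have h1 : ContDiffAt ℝ ∞ (fun s => c * wronskian (S.toModel.seedsDP lam d) s) t :=
      contDiffAt_const.mul (contDiffAt_wronskian
        (ShapeInvariantSystem.contDiffAt_seedsDP hN (fun k _ => hK k) ht))
    refine h1.congr_of_eventuallyEq ?_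
    filter_upwards [S.isOpen_dom.mem_nhds ht] with s hs using hc s hs
  · have := (h.wronskian_seedsDP_ne_zero_iff (List.nodup_singleton v)
      (fun w hw => (List.mem_singleton.1 hw).trans_le hv) hK h₀ h₁).2
      ((kreinAdler_singleton hv).2 hev) x hx
    rwa [Model.seedsDP, List.map_singleton, wronskian_singleton] at this

end

section

open Filter Set Topology
open scoped ContDiff

/-! ### The three classical systems -/

theorem contDiffOn_U_L (g : ℝ) : ContDiffOn ℝ ∞ (modelL.U g) modelL.dom := by
  intro x hx
  have hx0 : x ^ 2 ≠ 0 := pow_ne_zero 2 (ne_of_gt hx)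
  simp only [modelL]
  fun_prop (disch := assumption)

theorem contDiffOn_U_J (p : ℝ × ℝ) : ContDiffOn ℝ ∞ (modelJ.U p) modelJ.dom := by
  intro x hx
  have hs : Real.sin x ^ 2 ≠ 0 := pow_ne_zero 2 (sin_pos_J hx).ne'
  have hc : Real.cos x ^ 2 ≠ 0 := pow_ne_zero 2 (cos_pos_J hx).ne'
  simp only [modelJ]
  fun_prop (disch := assumption)

theorem barParamL (N : ℕ) (g : ℝ) : modelL.barParam N g = g - (N + 1) := by
  simp [Model.barParam, modelL]

theorem barParamJ (N : ℕ) (g h : ℝ) :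
    modelJ.barParam N (g, h) = (g - (N + 1), h - (N + 1)) := by
  simp [Model.barParam, modelJ]

theorem dualityH {d : List ℕ} {N : ℕ} (hd : d.Nodup) (hN : ∀ v ∈ d, v ≤ N) :
    modelH.Equivalent N () d Set.univ ∧ modelH.SingularityConditions N () d := by
  refine ⟨modelH_matches.equivalent hd hN fun _ => Set.mem_univ _,
    modelH_matches.singularityConditions hd hN (fun _ => Set.mem_univ _) nodelessCriterionH
      nodelessCriterionH ?_⟩
  simp only [modelH]
  fun_prop

theorem dualityL {d : List ℕ} {N : ℕ} {g : ℝ} (hd : d.Nodup) (hN : ∀ v ∈ d, v ≤ N)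
    (hg : 1 / 2 < g - (N + 1)) :
    modelL.Equivalent N g d Set.univ ∧ modelL.SingularityConditions N g d := by
  refine ⟨modelL_matches.equivalent hd hN fun _ => Set.mem_univ _,
    modelL_matches.singularityConditions hd hN (fun _ => Set.mem_univ _)
      (nodelessCriterionL ?_) (nodelessCriterionL ?_) (contDiffOn_U_L g)⟩
  · rwa [barParamL]
  · rw [barParamL]
    simp only [modelL]
    linarith

theorem dualityJ {d : List ℕ} {N : ℕ} {g h : ℝ} (hd : d.Nodup) (hN : ∀ v ∈ d, v ≤ N)
    (hg : 1 / 2 < g - (N + 1)) (hh : 1 / 2 < h - (N + 1)) :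
    modelJ.Equivalent N (g, h) d Set.univ ∧ modelJ.SingularityConditions N (g, h) d := by
  have hK : ∀ k : ℕ, sysJ.toModel.barParam N (g, h) + k • sysJ.shift ∈ sysJ.params := fun k => by
    rw [← modelJ_matches.barParam, barParamJ]
    have hk : (0 : ℝ) ≤ k := k.cast_nonneg
    simp only [sysJ, Set.mem_ofPred_eq, Prod.smul_mk, Prod.mk_add_mk, nsmul_eq_mul, mul_one]
    linarith
  refine ⟨modelJ_matches.equivalent hd hN hK,
    modelJ_matches.singularityConditions hd hN hK ?_ ?_ (contDiffOn_U_J (g, h))⟩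
  · rw [barParamJ]
    exact nodelessCriterionJ hg hh
  · rw [barParamJ]
    exact nodelessCriterionJ (by simp only [modelJ]; linarith) (by simp only [modelJ]; linarith)

end

end Duality

end

theorem mainTheorem1 :
    -- arbitrary shape-invariant systems
    (∀ (P : Type*) [AddCommGroup P] (S : Duality.ShapeInvariantSystem P)
      (d : List ℕ) (N : ℕ) (lam : P), d.Nodup → (∀ v ∈ d, v ≤ N) →
      (∀ k ≤ N + 1, lam - (N + 1) • S.shift + k • S.shift ∈ S.params) →
      S.toModel.Equivalent N lam d (S.levels N lam)) ∧
    -- the harmonic oscillator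
    (∀ (d : List ℕ) (N : ℕ), d.Nodup → (∀ v ∈ d, v ≤ N) →
      Duality.modelH.Equivalent N () d Set.univ ∧
      Duality.modelH.SingularityConditions N () d) ∧
    -- the radial oscillator
    (∀ (d : List ℕ) (N : ℕ) (g : ℝ), d.Nodup → (∀ v ∈ d, v ≤ N) →
      1 / 2 < g - (N + 1) →
      Duality.modelL.Equivalent N g d Set.univ ∧
      Duality.modelL.SingularityConditions N g d) ∧
    -- the Pöschl-Teller potential
    (∀ (d : List ℕ) (N : ℕ) (g h : ℝ), d.Nodup → (∀ v ∈ d, v ≤ N) →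
      1 / 2 < g - (N + 1) → 1 / 2 < h - (N + 1) →
      Duality.modelJ.Equivalent N (g, h) d Set.univ ∧
      Duality.modelJ.SingularityConditions N (g, h) d) := by
  refine ⟨fun P _ S d N lam hd hN hK => Duality.ShapeInvariantSystem.equivalent hd hN hK,
    fun d N hd hN => Duality.dualityH hd hN, fun d N g hd hN hg => Duality.dualityL hd hN hg,
    fun d N g h hd hN hg hh => Duality.dualityJ hd hN hg hh⟩
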